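/- A design is a finite incidence structure, and its $2$-rank is the rank over $GF(2)$ of its point-by-block incidence matrix. For a block $B$ of a design $\mathcal E$, the residual design $\mathcal E_B$ has as points the points not on $B$ and as blocks the sets $C\setminus B$, for the blocks $C\ne B$ of $\mathcal E$. A design $\mathcal R$ is linearly embeddable over $GF(2)$ in $\mathcal E$ if $\mathcal E$ has a block $B$ (the embedding block) such that $\mathcal R\cong\mathcal E_B$ and $\operatorname{rank}_2\mathcal E=\operatorname{rank}_2\mathcal E_B+1$. A $2$-$(64,16,5)$ design is affine resolvable if its $84$ blocks can be partitioned into $21$ classes of $4$ pairwise disjoint blocks. A block $B$ of such a design is good if the nonempty intersections of $B$ with the other blocks form a $2$-$(16,4,4)$ design whose collection of blocks consists of $4$ copies of the block set of a $2$-$(16,4,1)$ design. Let $AG_2(3,4)$ be the design of points and planes of the $3$-dimensional affine space over $GF(4)$. A symmetric $(4,4)$-net is a $1$-$(64,16,16)$ design with $64$ blocks such that both it and its dual can be resolved into $16$ parallel classes of $4$ pairwise disjoint blocks, any two blocks from different classes meeting in exactly $4$ points. The affine design arising from a symmetric $(4,4)$-net is the one whose blocks are the supports of the minimum weight codewords of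 the binary code spanned by the blocks of the net. The affine design arising from a line spread of $PG(5,2)$ (a set of $21$ lines partitioning the points) has as points the linear functionals on $GF(2)^6$, and as blocks, for each spread line (viewed as a $2$-dimensional subspace $L$ of $GF(2)^6$), the four classes of functionals that agree on $L$. Theorem. There are affine resolvable $2$-$(64,16,5)$ designs $\mathcal E_1$ and $\mathcal E_2$ of $2$-rank $16$, with full automorphism groups of orders $92160$ and $368640$ respectively, each arising from a symmetric $(4,4)$-net whose binary code has dimension $16$, and with $\mathcal E_2$ also arising from a line spread in $PG(5,2)$, such that the following hold. (i) $AG_2(3,4)$ is an affine resolvable $2$-$(64,16,5)$ design not isomorphic to $\mathcal E_1$, and any residual design of $AG_2(3,4)$ has, up to isomorphism, exactly two linear embeddings over $GF(2)$ in affine resolvable $2$-$(64,16,5)$ designs: one in $AG_2(3,4)$ and one in $\mathcal E_1$. (ii) $\mathcal E_1$ has exactly two types of good blocks, that is, its good blocks form exactly two orbits under its automorphism group. Up to isomorphism, the affine resolvable $2$-$(64,16,5)$ designs in which the residual design of $\mathcal E_1$ at a good block is linearly embeddable over $GF(2)$ are exactly $\mathcal E_1$ and $AG_2(3,4)$ if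 the block is of the first type, and exactly $\mathcal E_1$ and $\mathcal E_2$ if it is of the second type. (iii) $\mathcal E_2$ has good blocks, and, up to isomorphism, the affine resolvable $2$-$(64,16,5)$ designs in which the residual design of $\mathcal E_2$ at a good block is linearly embeddable over $GF(2)$ are exactly $\mathcal E_2$ and $\mathcal E_1$. In all these linear embeddings the embedding block is good. -/

import Mathlib

/-- An incidence structure with points `P` and blocks indexed by `β`
(repeated blocks are allowed, as in a collection of subsets). -/
structure IncStruct (P β : Type*) where
  /-- `inc x b`: the point `x` lies in the block `b`. -/
  inc : P → β → Prop

namespace IncStruct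

variable {P β Q γ : Type*}

/-- The set of points of a block. -/
def pts (D : IncStruct P β) (b : β) : Set P := {x | D.inc x b}

/-- The dual incidence structure. -/
def dual (D : IncStruct P β) : IncStruct β P := ⟨fun b x => D.inc x b⟩

/-- Isomorphisms of incidence structures. -/
structure Iso (D : IncStruct P β) (E : IncStruct Q γ) where
  onPoints : P ≃ Q
  onBlocks : β ≃ γ
  inc_iff : ∀ x b, D.inc x b ↔ E.inc (onPoints x) (onBlocks b)

/-- `D` and `E` are isomorphic. -/
def Isomorphic (D : IncStruct P β) (E : IncStruct Q γ) : Prop := Nonempty (Iso D E)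

/-- The full automorphism group, acting on points and blocks. -/
def aut (D : IncStruct P β) : Subgroup (Equiv.Perm P × Equiv.Perm β) where
  carrier := {g | ∀ x b, D.inc (g.1 x) (g.2 b) ↔ D.inc x b}
  one_mem' := fun _ _ => Iff.rfl
  mul_mem' := fun {g h} hg hh x b => (hg (h.1 x) (h.2 b)).trans (hh x b)
  inv_mem' := fun {g} hg x b => by
    have := hg (g.1⁻¹ x) (g.2⁻¹ b)
    simpa using this.symm

/-- Two blocks in the same orbit of the full automorphism group. -/
def SameOrbit (D : IncStruct P β) (b c : β) : Prop := ∃ g ∈ D.aut, g.2 b = c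

open Classical in
/-- The point-by-block incidence matrix with entries in `R`. -/
noncomputable def incMatrix (D : IncStruct P β) (R : Type*) [Zero R] [One R] : Matrix P β R :=
  Matrix.of fun x b => if D.inc x b then 1 else 0

/-- The `p`-rank: the rank of the incidence matrix over `GF(p)`. -/
noncomputable def pRank (D : IncStruct P β) (p : ℕ) [Finite β] : ℕ :=
  haveI := Fintype.ofFinite β
  (D.incMatrix (ZMod p)).rank

/-- `t`-`(v,k,l)` designs. -/
structure IsDesign (D : IncStruct P β) (t v k l : ℕ) : Prop where
  t_le : t ≤ k
  k_le : k ≤ v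
  card_points : Nat.card P = v
  block_size : ∀ b, (D.pts b).ncard = k
  balanced : ∀ s : Finset P, s.card = t → {b | ∀ x ∈ s, D.inc x b}.ncard = l

/-- The collection `c` of sets of blocks is a partition of the blocks into `r` classes, each
consisting of `q` pairwise disjoint blocks. -/
structure IsResolution (D : IncStruct P β) (q r : ℕ) (c : Set (Set β)) : Prop where
  partition : Setoid.IsPartition c
  card_classes : c.ncard = r
  class_size : ∀ S ∈ c, S.ncard = q
  class_disjoint : ∀ S ∈ c, S.Pairwise fun a b => Disjoint (D.pts a) (D.pts b)

/-- Affine resolvable `2`-`(qk,k,l)` designs: with `r` the replication number, there is a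
resolution, and the number of blocks is `v + r - 1`. -/
def IsAffineResolvable (D : IncStruct P β) (q k l : ℕ) : Prop :=
  1 < q ∧ 0 < k ∧ D.IsDesign 2 (q * k) k l ∧
    ∃ r, (∀ x, {b | D.inc x b}.ncard = r) ∧ (∃ c, D.IsResolution q r c) ∧
      Nat.card β + 1 = q * k + r

/-- The residual structure with respect to the block `B`. -/
def residual (D : IncStruct P β) (B : β) : IncStruct {x // ¬ D.inc x B} {C // C ≠ B} :=
  ⟨fun x C => D.inc x C⟩

/-- The blocks other than `B` which meet `B`. -/
def Meeting (D : IncStruct P β) (B : β) : Type _ :=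
  {C : β // C ≠ B ∧ ∃ x, D.inc x C ∧ D.inc x B}

/-- The points of `B`, with the nonempty intersections of `B` with the other blocks. -/
def derived (D : IncStruct P β) (B : β) : IncStruct {x // D.inc x B} (D.Meeting B) :=
  ⟨fun x C => D.inc x C.1⟩

/-- The simple incidence structure given by a set of subsets. -/
def ofSets (S : Set (Set P)) : IncStruct P S := ⟨fun x s => x ∈ s.1⟩

/-- Good blocks of an affine resolvable `2`-`(q^n, q^(n-1), (q^(n-1)-1)/(q-1))` design
(all divisions are exact). -/
def IsGood (D : IncStruct P β) (q n : ℕ) (B : β) : Prop :=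
  (D.derived B).IsDesign 2 (q ^ (n - 1)) (q ^ (n - 2)) (q * ((q ^ (n - 2) - 1) / (q - 1))) ∧
    ∃ S : Set (Set {x // D.inc x B}),
      (ofSets S).IsDesign 2 (q ^ (n - 1)) (q ^ (n - 2)) ((q ^ (n - 2) - 1) / (q - 1)) ∧
      (∀ C, (D.derived B).pts C ∈ S) ∧
      ∀ s ∈ S, {C | (D.derived B).pts C = s}.ncard = q

/-- `R` is, up to isomorphism, the residual structure of `E` with respect to `B`, and
it is linearly embedded in `E` over `GF(p)`. -/
def IsLinearEmbedding (p : ℕ) (R : IncStruct Q γ) (E : IncStruct P β) [Finite β] (B : β) : Prop :=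
  R.Isomorphic (E.residual B) ∧ E.pRank p = (E.residual B).pRank p + 1

/-- Among the affine resolvable `2`-`(64,16,5)` designs, the ones in which `R` is linearly
embedded over `GF(2)` are, up to isomorphism, exactly `E` and `E'`; and all embeddings are with
respect to good blocks. -/
def EmbedsExactlyIn {P₁ β₁ P₂ β₂ : Type*} (R : IncStruct Q γ) (E : IncStruct P₁ β₁)
    (E' : IncStruct P₂ β₂) : Prop :=
  ∀ (P β : Type) [Finite P] [Finite β] (F : IncStruct P β), F.IsAffineResolvable 4 16 5 →
    ((∃ B, IsLinearEmbedding 2 R F B) ↔ (F.Isomorphic E ∨ F.Isomorphic E')) ∧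
    ∀ B, IsLinearEmbedding 2 R F B → F.IsGood 4 3 B

/-- The design `AG_d(n,F)` of points and `d`-dimensional subspaces of the `n`-dimensional affine
geometry over `F`. -/
def AG (d n : ℕ) (F : Type*) [Field F] :
    IncStruct (Fin n → F)
      {A : AffineSubspace F (Fin n → F) //
        (A : Set (Fin n → F)).Nonempty ∧ Module.finrank F A.direction = d} :=
  ⟨fun x A => x ∈ A.1⟩

instance {d n : ℕ} {F : Type*} [Field F] [Finite F] :
    Finite {A : AffineSubspace F (Fin n → F) //
      (A : Set (Fin n → F)).Nonempty ∧ Module.finrank F A.direction = d} := by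
  have : Finite (AffineSubspace F (Fin n → F)) :=
    Finite.of_injective (fun A : AffineSubspace F (Fin n → F) => (A : Set (Fin n → F)))
      SetLike.coe_injective
  infer_instance

/-- Affine `1`-designs with `s * m` parallel classes of `s` blocks (nets): nonparallel blocks
meet in exactly `m` points. -/
def IsNet (D : IncStruct P β) (s m : ℕ) : Prop :=
  D.IsDesign 1 (s ^ 2 * m) (s * m) (s * m) ∧
    ∃ c, D.IsResolution s (s * m) c ∧
      ∀ S ∈ c, ∀ T ∈ c, S ≠ T → ∀ a ∈ S, ∀ b ∈ T, (D.pts a ∩ D.pts b).ncard = m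

/-- Symmetric `(s,m)`-nets. -/
def IsSymmetricNet (D : IncStruct P β) (s m : ℕ) : Prop := D.IsNet s m ∧ D.dual.IsNet s m

/-- The linear code over `GF(p)` spanned by the incidence vectors of the blocks. -/
noncomputable def code (D : IncStruct P β) (p : ℕ) : Submodule (ZMod p) (P → ZMod p) :=
  Submodule.span (ZMod p) (Set.range fun b x => D.incMatrix (ZMod p) x b)

/-- The supports of the codewords of minimum nonzero weight of a linear code. -/
def minSupports {p : ℕ} (C : Submodule (ZMod p) (P → ZMod p)) : Set (Set P) :=
  {s | ∃ w ∈ C, w ≠ 0 ∧ Function.support w = s ∧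
    ∀ c ∈ C, c ≠ 0 → (Function.support w).ncard ≤ (Function.support c).ncard}

/-- The design supported by the minimum weight codewords of a linear code. -/
def minWordDesign {p : ℕ} (C : Submodule (ZMod p) (P → ZMod p)) : IncStruct P (minSupports C) :=
  ofSets (minSupports C)

/-- `E` is supported by the minimum weight codewords of a `16`-dimensional binary code spanned by
a symmetric `(4,4)`-net. -/
def ArisesFromNet (E : IncStruct P β) : Prop :=
  ∃ N : IncStruct (Fin 64) (Fin 64), N.IsSymmetricNet 4 4 ∧
    Module.finrank (ZMod 2) (N.code 2) = 16 ∧ E.Isomorphic (minWordDesign (N.code 2))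

/-- `S` is a line spread of the projective space of `V`: a set of lines (`2`-dimensional subspaces
of `V`) partitioning the points (the nonzero vectors up to scalars). -/
def IsLineSpread {K V : Type*} [Field K] [AddCommGroup V] [Module K V]
    (S : Set (Submodule K V)) : Prop :=
  (∀ L ∈ S, Module.finrank K L = 2) ∧ ∀ v : V, v ≠ 0 → ∃! L, L ∈ S ∧ v ∈ L

/-- The affine structure of a line spread `S`. The points are the linear functionals on `V`
(the hyperplanes, as kernels when `K = GF(2)`, and one further point `0`). Each spread line `L`
gives a parallel class: two functionals are in the same block if they agree on `L`. -/
def spreadDesign {K V : Type*} [Field K] [AddCommGroup V] [Module K V]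
    (S : Set (Submodule K V)) :
    IncStruct (Module.Dual K V) (Σ L : S, Module.Dual K (L : Submodule K V)) :=
  ⟨fun f b => f.domRestrict b.1.1 = b.2⟩

/-- `E` arises from a line spread of `PG(5,2)`. -/
def ArisesFromLineSpread (E : IncStruct P β) : Prop :=
  ∃ S : Set (Submodule (ZMod 2) (Fin 6 → ZMod 2)), IsLineSpread S ∧ E.Isomorphic (spreadDesign S)

end IncStruct

/-!
All designs of the theorem belong to one family. For a function `f` on the field with four
elements, `planeDesign f` has as points the affine space of dimension `3` over this field, and as
blocks the planes `z = t`, `y + a z = c` and the deformed planes `x + m y + f z m² + a z = c`. It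
is affine resolvable for every `f`, its planes `z = t` are good blocks, and up to isomorphism it
depends only on `f` modulo affine functions, scalings and shifts of the argument. The function `0`
gives the design of points and planes, `δ₀` (called `bump 1 0`) gives `E₁`, and `z²` (called `bump
0 1`) gives `E₂`.

The linear embeddings are found from the residual structure at `z = 0`, which depends only on `f`
off `0`. Let `F` be a design with this residual structure at `B`, for `f = α z²` off `0`. Distinct
blocks of an affine resolvable design have `0` or `4` common points
(`IsAffineResolvable.ncard_inter`). So in each group `g` of `16` blocks `pl g a c`, the blocks
through a point of `B` are the four ones with a given `c` or the four ones with a given `a`, with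
the same alternative for all points (`columns_or_rows`). Embeddings are linear over `GF(2)` if and
only if the words of the code of `F` which vanish off `B` are constant on `B`
(`pRank_eq_residual_add_one_iff`). Applied to linear relations between blocks given by the trace,
this forces the same alternative in all groups (`all_columns_or_all_rows`), up to a symmetry of
the residual structure, and shows that the labels `h g x` of the points of `B` are affine
functions of two of them; the relation given by the norm shows that the constant terms of these
functions are in a Hermitian dual code. Hence `F` is `planeDesign` of a function that agrees with
`f` off `0` (`exists_iso_of_linear_embedding`). Such functions `bump κ α` are of two types for
each of `α = 0` and `α = 1`: the functions `κ δ₀` give the design of planes for `κ = 0` and `E₁`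
otherwise, and the functions `z² + κ δ₀` give `E₂` for `κ = 0` and `E₁` otherwise, since `z² + κ
δ₀` is `κ δ_τ` with `τ = κ⁻¹` up to an affine function. The residual structures of `E₁` at `z = t`
are thus of the first kind for `t = 0` and of the second kind for `t ≠ 0`. The other blocks of
`E₁` and `E₂` have intersections which occur only once, and are not good.

That the designs have rank `16` and that these embeddings really are linear follows from one
property of the codes (`HasLightCode`): the code of the `64` blocks other than those of the groups
`∞` and `z = t`, which form a symmetric net, has dimension `16`, contains all blocks, and all its
nonzero words of weight at most `16` are blocks. This is checked over all `2¹⁶` words at once, by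
arithmetic on numbers with `2¹⁶` binary digits, one digit for each word (`lightCheck`). For `f =
z²` the blocks are the fibres of the restrictions of the trace functionals to the lines of a
spread, because `tr (u²) = tr u`.

The orders of the automorphism groups are products of orbit lengths along the chain of stabilizers
of four points (`card_fixer`); the orbits are obtained from explicit automorphisms, and an
automorphism which fixes the four points fixes the block `z = 0`, and then successively all blocks
and points determined by incidence and disjointness with those already fixed (`fixClosure`).
-/

/-! ### Isomorphisms of incidence structures -/

namespace IncStruct

variable {P β Q γ P' β' : Type*} {D : IncStruct P β} {E : IncStruct Q γ} {D' : IncStruct P' β'}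

namespace Iso

/-- The identity isomorphism. -/
def refl (D : IncStruct P β) : Iso D D := ⟨Equiv.refl P, Equiv.refl β, fun _ _ => Iff.rfl⟩

/-- The inverse isomorphism. -/
def symm (i : Iso D E) : Iso E D :=
  ⟨i.onPoints.symm, i.onBlocks.symm, fun x b => by simp [i.inc_iff]⟩

/-- The composite isomorphism. -/
def trans (i : Iso D E) (j : Iso E D') : Iso D D' :=
  ⟨i.onPoints.trans j.onPoints, i.onBlocks.trans j.onBlocks,
    fun x b => by simp [i.inc_iff, j.inc_iff]⟩

theorem pts_onBlocks (i : Iso D E) (b : β) : E.pts (i.onBlocks b) = i.onPoints '' D.pts b := by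
  ext x
  simp only [pts, Set.mem_ofPred_eq, Set.mem_image]
  constructor
  · intro h
    exact ⟨i.onPoints.symm x, by simpa [i.inc_iff] using h, by simp⟩
  · rintro ⟨y, hy, rfl⟩
    exact (i.inc_iff _ _).1 hy

theorem isDesign (i : Iso D E) {t v k l : ℕ} (h : D.IsDesign t v k l) : E.IsDesign t v k l where
  t_le := h.t_le
  k_le := h.k_le
  card_points := by rw [← h.card_points]; exact Nat.card_congr i.onPoints.symm
  block_size b := by
    obtain ⟨b, rfl⟩ := i.onBlocks.surjective b
    rw [i.pts_onBlocks, Set.ncard_image_of_injective _ i.onPoints.injective, h.block_size]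
  balanced s hs := by
    have := h.balanced (s.map i.onPoints.symm.toEmbedding) (by simpa using hs)
    rw [← this, ← Set.ncard_image_of_injective _ i.onBlocks.injective]
    congr 1
    ext c
    obtain ⟨c, rfl⟩ := i.onBlocks.surjective c
    simp only [Finset.mem_map_equiv, Equiv.symm_symm, i.inc_iff, Set.mem_ofPred_eq,
      i.onBlocks.injective.mem_set_image]
    exact ⟨fun h x hx => h _ hx,
      fun h x hx => by simpa using h (i.onPoints.symm x) (by simpa using hx)⟩

theorem isResolution (i : Iso D E) {q r : ℕ} {c : Set (Set β)} (h : D.IsResolution q r c) :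
    E.IsResolution q r ((fun S => i.onBlocks '' S) '' c) where
  partition := by
    refine ⟨?_, fun a => ?_⟩
    · rintro ⟨S, hS, h0⟩
      exact h.partition.1 (by simpa using (Set.image_eq_empty.1 h0) ▸ hS)
    · obtain ⟨a, rfl⟩ := i.onBlocks.surjective a
      obtain ⟨S, ⟨hS, haS⟩, hu⟩ := h.partition.2 a
      refine ⟨i.onBlocks '' S, ⟨⟨S, hS, rfl⟩, ⟨a, haS, rfl⟩⟩, ?_⟩
      rintro _ ⟨⟨T, hT, rfl⟩, haT⟩
      rw [hu T ⟨hT, by simpa using haT⟩]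
  card_classes := by
    rw [Set.ncard_image_of_injective _ i.onBlocks.injective.image_injective, h.card_classes]
  class_size := by
    rintro _ ⟨S, hS, rfl⟩
    rw [Set.ncard_image_of_injective _ i.onBlocks.injective, h.class_size S hS]
  class_disjoint := by
    rintro _ ⟨S, hS, rfl⟩ _ ⟨a, ha, rfl⟩ _ ⟨b, hb, rfl⟩ hab
    have := h.class_disjoint S hS ha hb (fun e => hab (e ▸ rfl))
    simp only [pts_onBlocks]
    exact (Set.disjoint_image_iff i.onPoints.injective).2 this

theorem isAffineResolvable (i : Iso D E) {q k l : ℕ} (h : D.IsAffineResolvable q k l) :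
    E.IsAffineResolvable q k l := by
  obtain ⟨hq, hk, hd, r, hr, ⟨c, hc⟩, hcard⟩ := h
  refine ⟨hq, hk, i.isDesign hd, r, fun x => ?_, ⟨_, i.isResolution hc⟩, ?_⟩
  · obtain ⟨x, rfl⟩ := i.onPoints.surjective x
    rw [← hr x, ← Set.ncard_image_of_injective _ i.onBlocks.injective]
    congr 1
    ext c
    obtain ⟨c, rfl⟩ := i.onBlocks.surjective c
    simp [i.inc_iff]
  · rw [← hcard, Nat.card_congr i.onBlocks]

/-- The residual structures at corresponding blocks are isomorphic. -/
def residual (i : Iso D E) (B : β) : Iso (D.residual B) (E.residual (i.onBlocks B)) where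
  onPoints := i.onPoints.subtypeEquiv fun x => not_congr (i.inc_iff x B)
  onBlocks := i.onBlocks.subtypeEquiv fun C => by simp
  inc_iff x C := i.inc_iff x.1 C.1

/-- The derived structures at corresponding blocks are isomorphic. -/
def derived (i : Iso D E) (B : β) : Iso (D.derived B) (E.derived (i.onBlocks B)) where
  onPoints := i.onPoints.subtypeEquiv fun x => i.inc_iff x B
  onBlocks := i.onBlocks.subtypeEquiv fun C => by
    refine and_congr (by simp) ⟨?_, ?_⟩
    · rintro ⟨x, h1, h2⟩
      exact ⟨i.onPoints x, (i.inc_iff _ _).1 h1, (i.inc_iff _ _).1 h2⟩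
    · rintro ⟨x, h1, h2⟩
      exact ⟨i.onPoints.symm x, (i.inc_iff _ _).2 (by simpa using h1),
        (i.inc_iff _ _).2 (by simpa using h2)⟩
  inc_iff x C := i.inc_iff x.1 C.1

theorem isGood (i : Iso D E) {q n : ℕ} {B : β} (h : D.IsGood q n B) :
    E.IsGood q n (i.onBlocks B) := by
  obtain ⟨hd, S, hS, hmem, hcard⟩ := h
  set j := i.derived B
  have hinj := j.onPoints.injective.image_injective
  refine ⟨j.isDesign hd, (fun s => j.onPoints '' s) '' S, ?_, fun C => ?_, ?_⟩
  · refine Iso.isDesign (D := ofSets S)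
      ⟨j.onPoints, Equiv.Set.image _ S hinj, fun x s => ?_⟩ hS
    simp [ofSets]
  · obtain ⟨C, rfl⟩ := j.onBlocks.surjective C
    exact ⟨_, hmem C, (j.pts_onBlocks C).symm⟩
  · rintro _ ⟨s, hs, rfl⟩
    rw [← hcard s hs, ← Set.ncard_image_of_injective _ j.onBlocks.injective]
    congr 1
    ext C
    obtain ⟨C, rfl⟩ := j.onBlocks.surjective C
    simp only [Set.mem_ofPred_eq, j.pts_onBlocks, j.onBlocks.injective.mem_set_image]
    exact hinj.eq_iff

theorem isGood_iff (i : Iso D E) {q n : ℕ} {B : β} :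
    E.IsGood q n (i.onBlocks B) ↔ D.IsGood q n B :=
  ⟨fun h => by simpa [symm] using i.symm.isGood h, i.isGood⟩

/-- Conjugation of automorphisms by an isomorphism. -/
theorem mem_aut_conj (i : Iso D E) {g : Equiv.Perm P × Equiv.Perm β} (hg : g ∈ D.aut) :
    (i.onPoints.permCongr g.1, i.onBlocks.permCongr g.2) ∈ E.aut := by
  intro x b
  obtain ⟨x, rfl⟩ := i.onPoints.surjective x
  obtain ⟨b, rfl⟩ := i.onBlocks.surjective b
  simpa [i.inc_iff] using hg x b

theorem card_aut (i : Iso D E) : Nat.card E.aut = Nat.card D.aut := by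
  refine Nat.card_congr (Equiv.symm (Equiv.subtypeEquiv
    (i.onPoints.permCongr.prodCongr i.onBlocks.permCongr) fun g => ⟨i.mem_aut_conj, fun h => ?_⟩))
  have := i.symm.mem_aut_conj h
  convert this using 1
  ext x <;> simp [symm]

theorem sameOrbit (i : Iso D E) {b c : β} (h : D.SameOrbit b c) :
    E.SameOrbit (i.onBlocks b) (i.onBlocks c) := by
  obtain ⟨g, hg, rfl⟩ := h
  exact ⟨_, i.mem_aut_conj hg, by simp⟩

theorem sameOrbit_iff (i : Iso D E) {b c : β} :
    E.SameOrbit (i.onBlocks b) (i.onBlocks c) ↔ D.SameOrbit b c :=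
  ⟨fun h => by simpa [symm] using i.symm.sameOrbit h, i.sameOrbit⟩

/-- An automorphism as an isomorphism. -/
def ofAut {g : Equiv.Perm P × Equiv.Perm β} (hg : g ∈ D.aut) : Iso D D :=
  ⟨g.1, g.2, fun x b => (hg x b).symm⟩

/-- An isomorphism of a structure with itself as an automorphism. -/
theorem mem_aut (i : Iso D D) : (i.onPoints, i.onBlocks) ∈ D.aut :=
  fun x b => (i.inc_iff x b).symm

theorem code_eq (i : Iso D E) (p : ℕ) :
    E.code p = (D.code p).map
      (LinearEquiv.funCongrLeft (ZMod p) (ZMod p) i.onPoints.symm).toLinearMap := by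
  rw [code, code, Submodule.map_span, ← Set.range_comp]
  congr 1
  have : (fun b x => E.incMatrix (ZMod p) x b) ∘ i.onBlocks =
      ((LinearEquiv.funCongrLeft (ZMod p) (ZMod p) i.onPoints.symm).toLinearMap ∘
        fun b x => D.incMatrix (ZMod p) x b) := by
    funext b x
    have := i.inc_iff (i.onPoints.symm x) b
    rw [Equiv.apply_symm_apply] at this
    classical exact if_congr this.symm rfl rfl
  rw [← this, i.onBlocks.surjective.range_comp]

end Iso

theorem Isomorphic.refl (D : IncStruct P β) : D.Isomorphic D := ⟨Iso.refl D⟩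

theorem Isomorphic.symm (h : D.Isomorphic E) : E.Isomorphic D := h.map Iso.symm

theorem Isomorphic.trans (h : D.Isomorphic E) (h' : E.Isomorphic D') : D.Isomorphic D' :=
  let ⟨i⟩ := h; let ⟨j⟩ := h'; ⟨i.trans j⟩

/-- A bijection of the points that maps the point sets of the blocks onto those of the blocks of a
second structure, both structures being without repeated blocks, is induced by an isomorphism. -/
theorem isomorphic_of_simple (hD : Function.Injective D.pts) (hE : Function.Injective E.pts)
    (e : P ≃ Q) (h₁ : ∀ b, ∃ c, e '' D.pts b = E.pts c) (h₂ : ∀ c, ∃ b, e '' D.pts b = E.pts c) :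
    D.Isomorphic E := by
  choose f hf using h₁
  refine ⟨e, Equiv.ofBijective f ⟨fun b b' hb => ?_, fun c => ?_⟩, fun x b => ?_⟩
  · exact hD (e.injective.image_injective (by rw [hf, hf, hb]))
  · obtain ⟨b, hb⟩ := h₂ c
    exact ⟨b, hE (by rw [← hf, hb])⟩
  · have := Set.ext_iff.1 (hf b) (e x)
    rw [e.injective.mem_set_image] at this
    exact this

/-! ### Codes, ranks and residual structures -/

theorem col_mem_code (D : IncStruct P β) (p : ℕ) (b : β) :
    (fun x => D.incMatrix (ZMod p) x b) ∈ D.code p :=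
  Submodule.subset_span ⟨b, rfl⟩

theorem pRank_eq_finrank_code [Finite β] (D : IncStruct P β) (p : ℕ) :
    D.pRank p = Module.finrank (ZMod p) (D.code p) := by
  exact @Matrix.rank_eq_finrank_span_cols _ _ _ (Fintype.ofFinite β) _ (D.incMatrix (ZMod p))

theorem code_residual (D : IncStruct P β) (p : ℕ) (B : β) :
    (D.residual B).code p =
      (D.code p).map (LinearMap.funLeft (ZMod p) (ZMod p) (Subtype.val : {x // ¬ D.inc x B} → P)) := by
  apply le_antisymm
  · refine Submodule.span_le.2 ?_
    rintro _ ⟨C, rfl⟩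
    exact ⟨_, D.col_mem_code p C.1, rfl⟩
  · rw [Submodule.map_le_iff_le_comap]
    refine Submodule.span_le.2 ?_
    rintro _ ⟨C, rfl⟩
    by_cases hC : C = B
    · subst hC
      have : LinearMap.funLeft (ZMod p) (ZMod p) (Subtype.val : {x // ¬ D.inc x C} → P)
          (fun x => D.incMatrix (ZMod p) x C) = 0 := by
        ext x
        simp [incMatrix, LinearMap.funLeft_apply, x.2]
      simp only [Submodule.comap_coe, Set.mem_preimage, this]
      exact Submodule.zero_mem _
    · exact (D.residual B).col_mem_code p ⟨C, hC⟩

/-- The rank drops by exactly one in passing to the residual structure at `B` if and only if the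
codewords which vanish off `B` are constant on `B`. -/
theorem pRank_eq_residual_add_one_iff [Finite P] [Finite β] (D : IncStruct P β) {p : ℕ}
    [Fact p.Prime] {B : β} (hB : ∃ x, D.inc x B) :
    D.pRank p = (D.residual B).pRank p + 1 ↔
      ∀ w ∈ D.code p, (∀ x, ¬ D.inc x B → w x = 0) →
        ∀ x y, D.inc x B → D.inc y B → w x = w y := by
  have := Fintype.ofFinite P
  obtain ⟨x₀, hx₀⟩ := hB
  set ρ := LinearMap.funLeft (ZMod p) (ZMod p) (Subtype.val : {x // ¬ D.inc x B} → P) with hρ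
  rw [pRank_eq_finrank_code, pRank_eq_finrank_code, code_residual, ← hρ,
    ← LinearMap.range_domRestrict, ← LinearMap.finrank_range_add_finrank_ker (ρ.domRestrict (D.code p)),
    Nat.add_left_cancel_iff]
  set b : LinearMap.ker (ρ.domRestrict (D.code p)) :=
    ⟨⟨_, D.col_mem_code p B⟩, by ext x; simp [incMatrix, hρ, LinearMap.funLeft_apply, x.2]⟩ with hb
  have hbx : ∀ x, D.inc x B → b.1.1 x = 1 := fun x hx => by simp [hb, incMatrix, hx]
  have hbx' : ∀ x, ¬ D.inc x B → b.1.1 x = 0 := fun x hx => by simp [hb, incMatrix, hx]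
  have hb0 : b ≠ 0 := fun h => by
    have := hbx x₀ hx₀
    rw [h] at this
    simp at this
  rw [finrank_eq_one_iff_of_nonzero' b hb0]
  constructor
  · intro h w hw hw0 x y hx hy
    obtain ⟨c, hc⟩ := h ⟨⟨w, hw⟩, by ext x; simp [hρ, LinearMap.funLeft_apply, hw0 x.1 x.2]⟩
    have hcx : ∀ x, c * b.1.1 x = w x := fun x => congrFun (congrArg (fun u => u.1.1) hc) x
    rw [← hcx x, ← hcx y, hbx x hx, hbx y hy]
  · intro h w
    have hw0 : ∀ x, ¬ D.inc x B → w.1.1 x = 0 := fun x hx => by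
      exact congrFun (LinearMap.mem_ker.1 w.2) ⟨x, hx⟩
    refine ⟨w.1.1 x₀, ?_⟩
    ext x
    change w.1.1 x₀ * b.1.1 x = w.1.1 x
    by_cases hx : D.inc x B
    · rw [hbx x hx, mul_one]
      exact h _ w.1.2 hw0 _ _ hx₀ hx
    · rw [hbx' x hx, hw0 x hx, mul_zero]

/-! ### Resolutions given by a class function -/

/-- A map to an `r`-element set whose fibres consist of `q` pairwise disjoint blocks is a
resolution. -/
theorem isResolution_of_fibers {ι : Type*} (f : β → ι) (hf : Function.Surjective f) {q r : ℕ}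
    (hr : Nat.card ι = r) (hq : ∀ i, {b | f b = i}.ncard = q)
    (hd : ∀ a b, f a = f b → a ≠ b → ∀ x, D.inc x a → ¬ D.inc x b) :
    D.IsResolution q r (Set.range fun i => {b | f b = i}) where
  partition := by
    refine ⟨?_, fun a => ⟨{b | f b = f a}, ⟨⟨f a, rfl⟩, rfl⟩, ?_⟩⟩
    · rintro ⟨i, hi⟩
      obtain ⟨b, hb⟩ := hf i
      have : b ∈ {b | f b = i} := hb
      simp only at hi
      rw [hi] at this
      exact this
    · rintro _ ⟨⟨i, rfl⟩, hi⟩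
      have : f a = i := hi
      rw [this]
  card_classes := by
    rw [← hr, ← Set.image_univ, Set.ncard_image_of_injective, Set.ncard_univ]
    intro i j hij
    obtain ⟨b, hb⟩ := hf i
    have : b ∈ {b | f b = i} := hb
    simp only at hij
    rw [hij] at this
    exact hb.symm.trans this
  class_size := by
    rintro _ ⟨i, rfl⟩
    exact hq i
  class_disjoint := by
    rintro _ ⟨i, rfl⟩ a ha b hb hab
    exact Set.disjoint_left.2 fun x hx => hd a b (Eq.trans ha (Eq.symm hb)) hab x hx

end IncStruct

/-! ### The field with four elements -/

/-- The field with four elements `0, 1, ω, ω²`; a concrete type makes finite checks cheap. -/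
inductive GF4
  | zero | one | om | om2
deriving DecidableEq

namespace GF4

instance : Fintype GF4 := ⟨{zero, one, om, om2}, fun x => by cases x <;> decide⟩

/-- The position of an element in the list `0, 1, ω, ω²`. -/
def toNat : GF4 → ℕ
  | zero => 0 | one => 1 | om => 2 | om2 => 3

/-- Addition. -/
protected def add : GF4 → GF4 → GF4
  | zero, b => b
  | one, zero => one | one, one => zero | one, om => om2 | one, om2 => om
  | om, zero => om | om, one => om2 | om, om => zero | om, om2 => one
  | om2, zero => om2 | om2, one => om | om2, om => one | om2, om2 => zero

/-- Multiplication. -/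
protected def mul : GF4 → GF4 → GF4
  | zero, _ => zero
  | one, b => b
  | om, zero => zero | om, one => om | om, om => om2 | om, om2 => one
  | om2, zero => zero | om2, one => om2 | om2, om => one | om2, om2 => om

/-- Inversion, with `0⁻¹ = 0`. -/
protected def inv : GF4 → GF4
  | zero => zero | one => one | om => om2 | om2 => om

instance : Zero GF4 := ⟨zero⟩
instance : One GF4 := ⟨one⟩
instance : Add GF4 := ⟨GF4.add⟩
instance : Mul GF4 := ⟨GF4.mul⟩
instance : Neg GF4 := ⟨id⟩
instance : Inv GF4 := ⟨GF4.inv⟩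

instance : Field GF4 where
  add_assoc := by decide
  zero_add := by decide
  add_zero := by decide
  nsmul := nsmulRec
  add_comm := by decide
  left_distrib := by decide
  right_distrib := by decide
  zero_mul := by decide
  mul_zero := by decide
  mul_assoc := by decide
  one_mul := by decide
  mul_one := by decide
  zsmul := zsmulRec
  neg_add_cancel := by decide
  mul_comm := by decide
  exists_pair_ne := ⟨zero, one, by decide⟩
  mul_inv_cancel := by decide
  inv_zero := rfl
  nnqsmul := _
  nnqsmul_def := fun _ _ => rfl
  qsmul := _
  qsmul_def := fun _ _ => rfl

theorem card : Fintype.card GF4 = 4 := rfl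

theorem natCard : Nat.card GF4 = 4 := by rw [Nat.card_eq_fintype_card, card]

theorem add_self : ∀ a : GF4, a + a = 0 := by decide

theorem two_eq_zero : (2 : GF4) = 0 := by
  rw [← one_add_one_eq_two]; rfl

theorem add_eq_zero_iff {a b : GF4} : a + b = 0 ↔ a = b := by
  revert a b; decide

theorem add_eq_iff {a b c : GF4} : a + b = c ↔ a = c + b := by
  revert a b c; decide

theorem cube_eq_one : ∀ a : GF4, a ≠ 0 → a * a * a = 1 := by decide

theorem sum_univ {M : Type*} [AddCommMonoid M] (g : GF4 → M) :
    ∑ c, g c = g 0 + (g 1 + (g om + g om2)) := by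
  rw [show (Finset.univ : Finset GF4) = {zero, one, om, om2} from rfl,
    Finset.sum_insert (by decide), Finset.sum_insert (by decide), Finset.sum_insert (by decide),
    Finset.sum_singleton]
  rfl

theorem sum_univ_option {M : Type*} [AddCommMonoid M] (g : Option GF4 → M) :
    ∑ c, g c = g none + (g (some 0) + (g (some 1) + (g (some om) + g (some om2)))) := by
  rw [Fintype.sum_option, sum_univ]

/-- The trace to the prime field. -/
def tr : GF4 → ZMod 2
  | zero => 0 | one => 0 | om => 1 | om2 => 1

/-- The norm to the prime field. -/
def nm : GF4 → ZMod 2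
  | zero => 0 | one => 1 | om => 1 | om2 => 1

theorem tr_add : ∀ a b : GF4, tr (a + b) = tr a + tr b := by decide

/-- The trace form is nondegenerate. -/
theorem eq_of_tr_mul : ∀ a b : GF4, (∀ k, tr (k * a) = tr (k * b)) → a = b := by decide

end GF4

open GF4

/-! ### The designs of functions on the field with four elements -/

/-- The `64` points, the affine space over the field with four elements. -/
abbrev Pt := GF4 × GF4 × GF4

/-- The `84` blocks: `vert t` is the plane `z = t`, and the blocks `pl g a c`, with
`g` a point `m` or `∞ = none` of the projective line, are the deformed planes `x + m y + a z = c` and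
`y + a z = c`. -/
inductive Bl
  | vert (t : GF4)
  | pl (g : Option GF4) (a c : GF4)
deriving DecidableEq

namespace Bl

/-- The blocks as a sum type. -/
def equivSum : Bl ≃ GF4 ⊕ (Option GF4 × GF4 × GF4) where
  toFun | vert t => .inl t | pl g a c => .inr (g, a, c)
  invFun | .inl t => vert t | .inr (g, a, c) => pl g a c
  left_inv b := by cases b <;> rfl
  right_inv b := by rcases b with _ | ⟨_, _, _⟩ <;> rfl

instance : Fintype Bl := Fintype.ofEquiv _ equivSum.symm

theorem natCard : Nat.card Bl = 84 := by
  rw [Nat.card_congr equivSum, Nat.card_eq_fintype_card]; rfl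

end Bl

/-- The value at `p` of the linear form attached to `g`, deformed by `f`. The multiples of
`(m²)_m` represent the Hermitian dual of the code of all `(x + m y)_m`, modulo that code. -/
def val (f : GF4 → GF4) (g : Option GF4) (p : Pt) : GF4 :=
  match g with
  | none => p.2.1
  | some m => p.1 + m * p.2.1 + f p.2.2 * (m * m)

/-- The affine resolvable design of a function `f`: a deformation of the design of points and
planes of the affine space. Up to isomorphism, `f` matters only modulo affine functions. -/
def planeDesign (f : GF4 → GF4) : IncStruct Pt Bl :=
  ⟨fun p b => match b with
    | .vert t => p.2.2 = t
    | .pl g a c => val f g p + a * p.2.2 = c⟩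

namespace planeDesign

open IncStruct Bl

variable {f f' : GF4 → GF4}

theorem inc_vert {p : Pt} {t : GF4} : (planeDesign f).inc p (vert t) ↔ p.2.2 = t := Iff.rfl

theorem inc_pl {p : Pt} {g : Option GF4} {a c : GF4} :
    (planeDesign f).inc p (pl g a c) ↔ val f g p + a * p.2.2 = c := Iff.rfl

instance (f : GF4 → GF4) (p : Pt) (b : Bl) : Decidable ((planeDesign f).inc p b) :=
  match b with
  | .vert t => inferInstanceAs (Decidable (p.2.2 = t))
  | .pl g a c => inferInstanceAs (Decidable (val f g p + a * p.2.2 = c))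

/-- The point with third coordinate `z` at which the form of `g` has the value `v`; the
remaining coordinate is `s`. -/
def sol (f : GF4 → GF4) (g : Option GF4) (v s z : GF4) : Pt :=
  match g with
  | none => (s, v, z)
  | some m => (v + m * s + f z * (m * m), s, z)

/-- The coordinate left free by the form of `g`. -/
def free (g : Option GF4) (p : Pt) : GF4 :=
  match g with
  | none => p.1
  | some _ => p.2.1

theorem sol_z (f g v s z) : (sol f g v s z).2.2 = z := by cases g <;> rfl

theorem free_sol (f g v s z) : free g (sol f g v s z) = s := by cases g <;> rfl

theorem val_sol (f g v s z) : val f g (sol f g v s z) = v := by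
  cases g with
  | none => rfl
  | some m =>
    simp only [val, sol]
    linear_combination (m * s + f z * (m * m)) * two_eq_zero

theorem sol_val (g : Option GF4) (p : Pt) : sol f g (val f g p) (free g p) p.2.2 = p := by
  obtain ⟨x, y, z⟩ := p
  cases g with
  | none => rfl
  | some m =>
    simp only [val, sol, free, Prod.mk.injEq, and_true]
    linear_combination (m * y + f z * (m * m)) * two_eq_zero

theorem sol_injective {g : Option GF4} {v s z v' s' z' : GF4}
    (h : sol f g v s z = sol f g v' s' z') : v = v' ∧ s = s' ∧ z = z' := by
  refine ⟨?_, ?_, ?_⟩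
  · rw [← val_sol f g v s z, h, val_sol]
  · rw [← free_sol f g v s z, h, free_sol]
  · rw [← sol_z f g v s z, h, sol_z]

theorem exists_unique_form : ∀ x y : GF4, (x ≠ 0 ∨ y ≠ 0) →
    ∃ g, val 0 g (x, y, 0) = 0 ∧ ∀ g', val 0 g' (x, y, 0) = 0 → g' = g := by
  decide

theorem val_eq_val_iff {g : Option GF4} {p q : Pt} (h : p.2.2 = q.2.2) :
    val f g p = val f g q ↔ val 0 g (p.1 + q.1, p.2.1 + q.2.1, 0) = 0 := by
  obtain ⟨x, y, z⟩ := p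
  obtain ⟨x', y', z'⟩ := q
  obtain rfl : z = z' := h
  cases g with
  | none => exact add_eq_zero_iff.symm
  | some m =>
    simp only [val, Pi.zero_apply, zero_mul, add_zero, ← add_eq_zero_iff (a := _ + _ + _)]
    refine Eq.congr_left ?_
    linear_combination (f z * (m * m)) * two_eq_zero

/-- Two points with the same third coordinate have the same value under exactly one form. -/
theorem exists_unique_val_eq {p q : Pt} (h : p.2.2 = q.2.2) (hpq : p ≠ q) :
    ∃ g, val f g p = val f g q ∧ ∀ g', val f g' p = val f g' q → g' = g := by
  simp only [val_eq_val_iff h]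
  apply exists_unique_form
  by_contra! hc
  apply hpq
  simp only [add_eq_zero_iff] at hc
  exact Prod.ext hc.1 (Prod.ext hc.2 h)

theorem setOf_inc_inc_of_ne {p q : Pt} (h : p.2.2 ≠ q.2.2) :
    {b | (planeDesign f).inc p b ∧ (planeDesign f).inc q b} =
      Set.range fun g => pl g ((val f g p + val f g q) * (p.2.2 + q.2.2)⁻¹)
        (val f g p + (val f g p + val f g q) * (p.2.2 + q.2.2)⁻¹ * p.2.2) := by
  have h0 : p.2.2 + q.2.2 ≠ 0 := fun h' => h (add_eq_zero_iff.1 h')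
  ext b
  cases b with
  | vert t =>
    simp only [Set.mem_ofPred_eq, inc_vert, Set.mem_range, reduceCtorEq, exists_false, iff_false]
    rintro ⟨h1, h2⟩
    exact h (h1.trans h2.symm)
  | pl g a c =>
    simp only [Set.mem_ofPred_eq, inc_pl, Set.mem_range, pl.injEq]
    constructor
    · rintro ⟨h1, h2⟩
      have ha : (val f g p + val f g q) * (p.2.2 + q.2.2)⁻¹ = a := by
        rw [mul_inv_eq_iff_eq_mul₀ h0]
        linear_combination h1 - h2 + (val f g q - a * p.2.2) * two_eq_zero
      exact ⟨g, rfl, ha, by rw [ha]; exact h1⟩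
    · rintro ⟨g, rfl, rfl, rfl⟩
      refine ⟨rfl, ?_⟩
      linear_combination (val f g p + val f g q) * mul_inv_cancel₀ h0 +
        (val f g q - (val f g p + val f g q) * (p.2.2 + q.2.2)⁻¹ * p.2.2) * two_eq_zero

theorem setOf_inc_inc_of_eq {p q : Pt} {g : Option GF4} (h : p.2.2 = q.2.2)
    (hg : val f g p = val f g q) (hu : ∀ g', val f g' p = val f g' q → g' = g) :
    {b | (planeDesign f).inc p b ∧ (planeDesign f).inc q b} =
      insert (vert p.2.2) (Set.range fun a => pl g a (val f g p + a * p.2.2)) := by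
  ext b
  cases b with
  | vert t => simp [inc_vert, ← h, eq_comm]
  | pl g' a c =>
    simp only [Set.mem_ofPred_eq, inc_pl, Set.mem_insert_iff, reduceCtorEq, Set.mem_range,
      pl.injEq, false_or]
    constructor
    · rintro ⟨h1, h2⟩
      have : val f g' p = val f g' q := by
        rw [← h] at h2
        exact add_right_cancel (h1.trans h2.symm)
      obtain rfl := hu g' this
      exact ⟨a, rfl, rfl, h1⟩
    · rintro ⟨a, rfl, rfl, rfl⟩
      exact ⟨rfl, by rw [← h, hg]⟩

theorem ncard_range_pl (g : Option GF4) (v z : GF4) :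
    (Set.range fun a => pl g a (v + a * z)).ncard = 4 := by
  rw [← Set.image_univ, Set.ncard_image_of_injective _ fun a b h => (pl.inj h).2.1,
    Set.ncard_univ, GF4.natCard]

theorem ncard_pts (b : Bl) : ((planeDesign f).pts b).ncard = 16 := by
  have h16 : (Set.univ : Set (GF4 × GF4)).ncard = 16 := by
    rw [Set.ncard_univ, Nat.card_prod, GF4.natCard]
  rw [← h16]
  cases b with
  | vert t =>
    rw [← Set.ncard_image_of_injective (f := fun s : GF4 × GF4 => ((s.1, s.2, t) : Pt)) Set.univ
      (by rintro ⟨a, b⟩ ⟨c, d⟩ h; simpa using h)]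
    congr 1
    ext ⟨x, y, z⟩
    simp [pts, planeDesign, eq_comm]
  | pl g a c =>
    rw [← Set.ncard_image_of_injective
      (f := fun s : GF4 × GF4 => sol f g (c + a * s.2) s.1 s.2) Set.univ
      (by rintro ⟨a, b⟩ ⟨c, d⟩ h; exact Prod.ext (sol_injective h).2.1 (sol_injective h).2.2)]
    congr 1
    ext p
    simp only [pts, Set.mem_ofPred_eq, inc_pl, Set.image_univ, Set.mem_range, Prod.exists]
    constructor
    · intro h
      refine ⟨free g p, p.2.2, ?_⟩
      rw [← add_eq_iff.1 h, sol_val]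
    · rintro ⟨s, z, rfl⟩
      rw [val_sol, sol_z]
      linear_combination a * z * two_eq_zero

theorem ncard_blocks (p : Pt) : {b | (planeDesign f).inc p b}.ncard = 21 := by
  have : {b | (planeDesign f).inc p b} = insert (vert p.2.2)
      ((fun s : Option GF4 × GF4 => pl s.1 s.2 (val f s.1 p + s.2 * p.2.2)) '' Set.univ) := by
    ext b
    cases b with
    | vert t => simp [inc_vert, eq_comm]
    | pl g a c => simp [inc_pl]
  rw [this, Set.ncard_insert_of_notMem (by simp), Set.ncard_image_of_injective, Set.ncard_univ,
    Nat.card_prod, Nat.card_eq_fintype_card, Nat.card_eq_fintype_card, Fintype.card_option, card]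
  rintro ⟨a, b⟩ ⟨c, d⟩ h
  exact Prod.ext (pl.inj h).1 (pl.inj h).2.1

theorem isDesign (f : GF4 → GF4) : (planeDesign f).IsDesign 2 64 16 5 where
  t_le := by norm_num
  k_le := by norm_num
  card_points := by simp only [Nat.card_prod, GF4.natCard]
  block_size := ncard_pts
  balanced s hs := by
    obtain ⟨p, q, hpq, rfl⟩ := Finset.card_eq_two.1 hs
    simp only [Finset.mem_insert, Finset.mem_singleton, forall_eq_or_imp, forall_eq]
    by_cases h : p.2.2 = q.2.2
    · obtain ⟨g, hg, hu⟩ := exists_unique_val_eq (f := f) h hpq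
      rw [setOf_inc_inc_of_eq h hg hu, Set.ncard_insert_of_notMem (by simp), ncard_range_pl]
    · rw [setOf_inc_inc_of_ne h, ← Set.image_univ,
        Set.ncard_image_of_injective _ fun a b h => (pl.inj h).1, Set.ncard_univ,
        Nat.card_eq_fintype_card, Fintype.card_option, card]

/-- The parallel class of a block. -/
def parallelClass : Bl → Option (Option GF4 × GF4)
  | .vert _ => none
  | .pl g a _ => some (g, a)

theorem isResolution (f : GF4 → GF4) : ∃ c, (planeDesign f).IsResolution 4 21 c := by
  refine ⟨_, isResolution_of_fibers parallelClass ?_ ?_ ?_ ?_⟩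
  · rintro (_ | ⟨g, a⟩)
    · exact ⟨vert 0, rfl⟩
    · exact ⟨pl g a 0, rfl⟩
  · rw [Nat.card_eq_fintype_card]; rfl
  · rintro (_ | ⟨g, a⟩)
    · have : {b | parallelClass b = none} = Set.range vert := by
        ext b; cases b <;> simp [parallelClass]
      rw [this, ← Set.image_univ, Set.ncard_image_of_injective _ fun a b h => vert.inj h,
        Set.ncard_univ, GF4.natCard]
    · have : {b | parallelClass b = some (g, a)} = Set.range (pl g a) := by
        ext b; cases b <;> simp [parallelClass, eq_comm]
      rw [this, ← Set.image_univ, Set.ncard_image_of_injective _ fun a b h => (pl.inj h).2.2,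
        Set.ncard_univ, GF4.natCard]
  · rintro (t | ⟨g, a, c⟩) (t' | ⟨g', a', c'⟩) h hne x h1 h2
    · exact hne (by rw [← inc_vert.1 h1, ← inc_vert.1 h2])
    · simp [parallelClass] at h
    · simp [parallelClass] at h
    · simp only [parallelClass, Option.some.injEq, Prod.mk.injEq] at h
      obtain ⟨rfl, rfl⟩ := h
      exact hne (by rw [← inc_pl.1 h1, ← inc_pl.1 h2])

theorem isAffineResolvable (f : GF4 → GF4) : (planeDesign f).IsAffineResolvable 4 16 5 :=
  ⟨by norm_num, by norm_num, isDesign f, 21, ncard_blocks, isResolution f, by rw [Bl.natCard]⟩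

end planeDesign

namespace planeDesign

open IncStruct Bl

variable {f f' : GF4 → GF4}

/-! ### Isomorphisms between the designs of functions -/

theorem pts_injective (f : GF4 → GF4) : Function.Injective (planeDesign f).pts := by
  have hmem : ∀ g a c s z, (planeDesign f).inc (sol f g (c + a * z) s z) (pl g a c) := by
    intro g a c s z
    rw [inc_pl, val_sol, sol_z]
    linear_combination a * z * two_eq_zero
  have hvert : ∀ g a c t, (planeDesign f).pts (vert t) ≠ (planeDesign f).pts (pl g a c) := by
    intro g a c t h
    have h1 : sol f g (c + a * (t + 1)) 0 (t + 1) ∈ (planeDesign f).pts (vert t) := by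
      rw [h]; exact hmem g a c 0 (t + 1)
    have h2 : t + 1 = t := by rw [← sol_z f g (c + a * (t + 1)) 0 (t + 1)]; exact h1
    exact one_ne_zero (add_eq_left.1 h2)
  rintro (t | ⟨g, a, c⟩) (t' | ⟨g', a', c'⟩) h
  · have : (0, 0, t) ∈ (planeDesign f).pts (vert t') := by rw [← h]; exact rfl
    exact congrArg vert this
  · exact (hvert _ _ _ _ h).elim
  · exact (hvert _ _ _ _ h.symm).elim
  · have hval : ∀ s z, val f g' (sol f g (c + a * z) s z) + a' * z = c' := by
      intro s z
      have : sol f g (c + a * z) s z ∈ (planeDesign f).pts (pl g' a' c') := by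
        rw [← h]; exact hmem g a c s z
      have := inc_pl.1 this
      rwa [sol_z] at this
    have hne : sol f g (c + a * 0) 0 0 ≠ sol f g (c + a * 0) 1 0 :=
      fun e => zero_ne_one (sol_injective e).2.1
    obtain ⟨g₀, -, hu⟩ := exists_unique_val_eq (f := f) (by rw [sol_z, sol_z]) hne
    have h1 := hu g (by rw [val_sol, val_sol])
    have h2 := hu g' (add_right_cancel ((hval 0 0).trans (hval 1 0).symm))
    obtain rfl : g = g' := h1.trans h2.symm
    simp only [val_sol] at hval
    have hc : c = c' := by simpa using hval 0 0
    subst hc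
    have ha : a = a' := by
      have := hval 0 1
      rw [mul_one, mul_one, add_assoc, add_eq_left] at this
      exact add_eq_zero_iff.1 this
    rw [ha]

theorem eq_of_inc_iff {p q : Pt} (h : ∀ b, (planeDesign f).inc p b ↔ (planeDesign f).inc q b) :
    p = q := by
  have hz : q.2.2 = p.2.2 := inc_vert.1 ((h (vert p.2.2)).1 rfl)
  have hy := inc_pl.1 ((h (pl none 0 p.2.1)).1 (by simp [inc_pl, val]))
  have hx := inc_pl.1 ((h (pl (some 0) 0 p.1)).1 (by simp [inc_pl, val]))
  simp only [val, zero_mul, add_zero, mul_zero] at hx hy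
  exact (Prod.ext hx (Prod.ext hy hz)).symm

/-- A map of points and a map of blocks that preserve and reflect incidence are automatically
bijective. -/
noncomputable def isoOfMaps (σ : Pt → Pt) (τ : Bl → Bl)
    (h : ∀ p b, (planeDesign f).inc p b ↔ (planeDesign f').inc (σ p) (τ b)) :
    Iso (planeDesign f) (planeDesign f') where
  onPoints := Equiv.ofBijective σ <| Finite.injective_iff_bijective.1 fun p q hpq =>
    eq_of_inc_iff (f := f) fun b => by rw [h, h, hpq]
  onBlocks := Equiv.ofBijective τ <| Finite.injective_iff_bijective.1 fun b c hbc =>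
    pts_injective f <| Set.ext fun p => by
      change (planeDesign f).inc p b ↔ (planeDesign f).inc p c
      rw [h, h, hbc]
  inc_iff := h

theorem eq_iff_eq_of_sub_eq {k a b c d : GF4} (hk : k ≠ 0) (h : c - d = k * (a - b)) :
    a = b ↔ c = d := by
  rw [← sub_eq_zero, ← sub_eq_zero (a := c), h, mul_eq_zero, or_iff_right hk]

/-- Functions which differ by a shift of the argument and an affine function give isomorphic
designs. -/
noncomputable def shiftIso (τ μ ν : GF4) (h : ∀ z, f' (z + τ) = f z + μ + ν * z) :
    Iso (planeDesign f) (planeDesign f') :=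
  isoOfMaps (fun p => (p.1, p.2.1, p.2.2 + τ))
    (fun b => match b with
      | vert t => vert (t + τ)
      | pl none a c => pl none a (c + a * τ)
      | pl (some m) a c => pl (some m) (a + ν * (m * m))
          (c + (a + ν * (m * m)) * τ + μ * (m * m)))
    (by
      rintro ⟨x, y, z⟩ (t | ⟨_ | m, a, c⟩)
      · simp [inc_vert]
      · simp only [inc_pl, val]
        exact eq_iff_eq_of_sub_eq one_ne_zero (by ring)
      · simp only [inc_pl, val, h]
        refine eq_iff_eq_of_sub_eq one_ne_zero ?_
        linear_combination (ν * z * (m * m)) * two_eq_zero)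

/-- Functions which differ by nonzero factors of the argument and of the value give isomorphic
designs. -/
noncomputable def scaleIso {κ l : GF4} (hκ : κ ≠ 0) (hl : l ≠ 0) (h : ∀ z, f' (l * z) = κ * f z) :
    Iso (planeDesign f) (planeDesign f') :=
  isoOfMaps (fun p => (κ * p.1, κ * p.2.1, l * p.2.2))
    (fun b => match b with
      | vert t => vert (l * t)
      | pl g a c => pl g (κ * a * l⁻¹) (κ * c))
    (by
      rintro ⟨x, y, z⟩ (t | ⟨_ | m, a, c⟩)
      · simp [inc_vert, hl]
      · simp only [inc_pl, val]
        refine eq_iff_eq_of_sub_eq hκ ?_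
        linear_combination κ * a * z * inv_mul_cancel₀ hl
      · simp only [inc_pl, val, h]
        refine eq_iff_eq_of_sub_eq hκ ?_
        linear_combination κ * a * z * inv_mul_cancel₀ hl)

/-- The translation by `(s, t, 0)`. -/
noncomputable def translationIso (f : GF4 → GF4) (s t : GF4) :
    Iso (planeDesign f) (planeDesign f) :=
  isoOfMaps (fun p => (p.1 + s, p.2.1 + t, p.2.2))
    (fun b => match b with
      | vert t => vert t
      | pl none a c => pl none a (c + t)
      | pl (some m) a c => pl (some m) a (c + s + m * t))
    (by
      rintro ⟨x, y, z⟩ (t | ⟨_ | m, a, c⟩)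
      · rfl
      · simp only [inc_pl, val]
        exact eq_iff_eq_of_sub_eq one_ne_zero (by ring)
      · simp only [inc_pl, val]
        exact eq_iff_eq_of_sub_eq one_ne_zero (by ring))

/-- The shear `(x, y, z) ↦ (x + s z, y + t z, z)`. -/
noncomputable def shearIso (f : GF4 → GF4) (s t : GF4) : Iso (planeDesign f) (planeDesign f) :=
  isoOfMaps (fun p => (p.1 + s * p.2.2, p.2.1 + t * p.2.2, p.2.2))
    (fun b => match b with
      | vert t => vert t
      | pl none a c => pl none (a + t) c
      | pl (some m) a c => pl (some m) (a + s + m * t) c)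
    (by
      rintro ⟨x, y, z⟩ (t | ⟨_ | m, a, c⟩)
      · rfl
      · simp only [inc_pl, val]
        refine eq_iff_eq_of_sub_eq one_ne_zero ?_
        linear_combination t * z * two_eq_zero
      · simp only [inc_pl, val]
        refine eq_iff_eq_of_sub_eq one_ne_zero ?_
        linear_combination (s * z + m * t * z) * two_eq_zero)

/-- The transvection `(x, y) ↦ (x + l y, y)` of the first two coordinates; the deformation is
compensated by a multiple of `f`, which may be changed by an affine function. -/
noncomputable def transvectionIso (f : GF4 → GF4) (l μ ν : GF4) :
    Iso (planeDesign f) (planeDesign f) :=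
  isoOfMaps (fun p => (p.1 + l * p.2.1 + l * l * (f p.2.2 + μ + ν * p.2.2), p.2.1, p.2.2))
    (fun b => match b with
      | vert t => vert t
      | pl none a c => pl none a c
      | pl (some m) a c => pl (some (m + l)) (a + l * l * ν) (c + l * l * μ))
    (by
      rintro ⟨x, y, z⟩ (t | ⟨_ | m, a, c⟩)
      · rfl
      · rfl
      · simp only [inc_pl, val]
        refine eq_iff_eq_of_sub_eq one_ne_zero ?_
        linear_combination (l * y + l * l * f z + m * l * f z + l * l * ν * z) * two_eq_zero)

/-- The Frobenius automorphism of the coordinates. -/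
noncomputable def frobeniusIso (h : ∀ z, f (z * z) = f z * f z) :
    Iso (planeDesign f) (planeDesign f) :=
  isoOfMaps (fun p => (p.1 * p.1, p.2.1 * p.2.1, p.2.2 * p.2.2))
    (fun b => match b with
      | vert t => vert (t * t)
      | pl g a c => pl (g.map fun m => m * m) (a * a) (c * c))
    (by
      have hsq : ∀ a b : GF4, a = b ↔ a * a = b * b := by decide
      rintro ⟨x, y, z⟩ (t | ⟨_ | m, a, c⟩)
      · exact hsq _ _
      · simp only [inc_pl, val, Option.map_none]
        rw [hsq]
        refine eq_iff_eq_of_sub_eq one_ne_zero ?_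
        linear_combination (-(y * a * z)) * two_eq_zero
      · simp only [inc_pl, val, Option.map_some, h]
        rw [hsq]
        refine eq_iff_eq_of_sub_eq one_ne_zero ?_
        linear_combination (-(x * (m * y) + x * (f z * (m * m)) + x * (a * z) +
          (m * y) * (f z * (m * m)) + (m * y) * (a * z) + (f z * (m * m)) * (a * z))) *
          two_eq_zero)

/-- The exchange of the first two coordinates. -/
noncomputable def swapIso (f : GF4 → GF4) : Iso (planeDesign f) (planeDesign f) :=
  isoOfMaps (fun p => (p.2.1, p.1, p.2.2))
    (fun b => match b with
      | vert t => vert t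
      | pl none a c => pl (some 0) a c
      | pl (some m) a c =>
        if m = 0 then pl none a c else pl (some m⁻¹) (m⁻¹ * a) (m⁻¹ * c))
    (by
      rintro ⟨x, y, z⟩ (t | ⟨_ | m, a, c⟩)
      · rfl
      · simp [inc_pl, val]
      · by_cases hm : m = 0
        · subst hm
          simp [inc_pl, val]
        · simp only [inc_pl, val, if_neg hm]
          refine eq_iff_eq_of_sub_eq (inv_ne_zero hm) ?_
          have h1 : m⁻¹ * m⁻¹ = m := by revert m; decide
          linear_combination f z * h1 - (y + f z * m) * inv_mul_cancel₀ hm)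

/-- The diagonal map `(x, y, z) ↦ (k x, k² y, z)`. -/
noncomputable def diagonalIso (f : GF4 → GF4) {k : GF4} (hk : k ≠ 0) :
    Iso (planeDesign f) (planeDesign f) :=
  isoOfMaps (fun p => (k * p.1, k * k * p.2.1, p.2.2))
    (fun b => match b with
      | vert t => vert t
      | pl none a c => pl none (k * k * a) (k * k * c)
      | pl (some m) a c => pl (some (m * k⁻¹)) (k * a) (k * c))
    (by
      rintro ⟨x, y, z⟩ (t | ⟨_ | m, a, c⟩)
      · rfl
      · simp only [inc_pl, val]
        exact eq_iff_eq_of_sub_eq (mul_ne_zero hk hk) (by ring)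
      · simp only [inc_pl, val]
        refine eq_iff_eq_of_sub_eq hk ?_
        have h1 : k⁻¹ * k⁻¹ = k := by revert k; decide
        linear_combination f z * m * m * h1 + m * k * y * inv_mul_cancel₀ hk)

/-! ### The planes `z = t` are good blocks -/

/-- The line `val f g = c` of the plane `z = t`. -/
def line (f : GF4 → GF4) (t : GF4) (g : Option GF4) (c : GF4) :
    Set {x // (planeDesign f).inc x (vert t)} := {x | val f g x.1 = c}

theorem ncard_line (t : GF4) (g : Option GF4) (c : GF4) : (line f t g c).ncard = 4 := by
  rw [← Set.ncard_image_of_injective _ Subtype.val_injective, ← GF4.natCard, ← Set.ncard_univ,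
    ← Set.ncard_image_of_injective (f := fun s => sol f g c s t) Set.univ
      (fun a b h => (sol_injective h).2.1)]
  congr 1
  ext p
  simp only [line, Set.mem_image, Set.mem_ofPred_eq, Subtype.exists, exists_and_right,
    exists_eq_right, Set.mem_univ, true_and, inc_vert]
  constructor
  · rintro ⟨h, h'⟩
    exact ⟨free g p, by rw [← h, ← h', sol_val]⟩
  · rintro ⟨s, rfl⟩
    exact ⟨sol_z .., val_sol ..⟩

theorem form_eq_of_line_eq {t : GF4} {g g' : Option GF4} {c c' : GF4}
    (h : line f t g c = line f t g' c') : g = g' ∧ c = c' := by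
  have hm : ∀ s, val f g' (sol f g c s t) = c' := fun s => by
    have : (⟨sol f g c s t, sol_z ..⟩ : {x // (planeDesign f).inc x (vert t)}) ∈
        line f t g' c' := by
      rw [← h]; exact val_sol ..
    exact this
  obtain ⟨g₀, -, hu⟩ := exists_unique_val_eq (f := f) (p := sol f g c 0 t) (q := sol f g c 1 t)
    (by rw [sol_z, sol_z]) fun e => zero_ne_one (sol_injective e).2.1
  obtain rfl : g = g' :=
    (hu g (by rw [val_sol, val_sol])).trans (hu g' (by rw [hm, hm])).symm
  exact ⟨rfl, by rw [← hm 0, val_sol]⟩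

theorem isGood (f : GF4 → GF4) (t : GF4) : (planeDesign f).IsGood 4 3 (vert t) := by
  have hmeet : ∀ g a c, ∃ x, (planeDesign f).inc x (pl g a c) ∧ (planeDesign f).inc x (vert t) :=
    fun g a c => ⟨sol f g (c + a * t) 0 t, by
      rw [inc_pl, val_sol, sol_z]
      linear_combination a * t * two_eq_zero, sol_z ..⟩
  set mk : Option GF4 → GF4 → GF4 → (planeDesign f).Meeting (vert t) := fun g a c =>
    ⟨pl g a c, by simp, hmeet g a c⟩ with hmk
  have hinj : ∀ {g a c g' a' c'}, mk g a c = mk g' a' c' → g = g' ∧ a = a' ∧ c = c' :=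
    fun h => pl.inj (congrArg Subtype.val h)
  have hsurj : ∀ C, ∃ g a c, C = mk g a c := by
    rintro ⟨b, h, x, h1, h2⟩
    cases b with
    | vert t' => exact (h (by rw [← inc_vert.1 h1, ← inc_vert.1 h2])).elim
    | pl g a c => exact ⟨g, a, c, rfl⟩
  have hpts : ∀ g a c, ((planeDesign f).derived (vert t)).pts (mk g a c) = line f t g (c + a * t) := by
    intro g a c
    ext ⟨x, hx⟩
    have hx' := inc_vert.1 hx
    change val f g x + a * x.2.2 = c ↔ val f g x = c + a * t
    rw [hx', add_eq_iff]
  have hcard : Nat.card {x // (planeDesign f).inc x (vert t)} = 16 := by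
    rw [← ncard_pts (f := f) (vert t)]
    exact Nat.card_coe_set_eq ((planeDesign f).pts (vert t))
  have h4 : ∀ g (v : GF4 → GF4), (Set.range fun a => mk g a (v a)).ncard = 4 := by
    intro g v
    rw [← Set.image_univ, Set.ncard_image_of_injective _ fun a b h => (hinj h).2.1,
      Set.ncard_univ, GF4.natCard]
  refine ⟨⟨by norm_num, by norm_num, hcard, fun C => ?_, fun s hs => ?_⟩,
    {l | ∃ g c, l = line f t g c}, ⟨by norm_num, by norm_num, hcard, ?_, fun s hs => ?_⟩,
    fun C => ?_, ?_⟩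
  · obtain ⟨g, a, c, rfl⟩ := hsurj C
    rw [hpts, ncard_line]; norm_num
  · obtain ⟨⟨p, hp⟩, ⟨q, hq⟩, hpq, rfl⟩ := Finset.card_eq_two.1 hs
    obtain ⟨g, hg, hu⟩ := exists_unique_val_eq (f := f) (hp.trans (Eq.symm hq))
      (fun h => hpq (Subtype.ext h))
    rw [show 4 * ((4 ^ (3 - 2) - 1) / (4 - 1)) = 4 by norm_num, ← h4 g fun a => val f g p + a * t]
    congr 1
    ext C
    obtain ⟨g', a, c, rfl⟩ := hsurj C
    simp only [Finset.mem_insert, Finset.mem_singleton, forall_eq_or_imp, forall_eq,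
      Set.mem_ofPred_eq, Set.mem_range]
    change (val f g' p + a * p.2.2 = c ∧ val f g' q + a * q.2.2 = c) ↔ _
    rw [inc_vert.1 hp, inc_vert.1 hq]
    constructor
    · rintro ⟨h1, h2⟩
      obtain rfl := hu g' (add_right_cancel (h1.trans h2.symm))
      exact ⟨a, by rw [h1]⟩
    · rintro ⟨a', h⟩
      obtain ⟨rfl, rfl, rfl⟩ := hinj h
      exact ⟨rfl, by rw [hg]⟩
  · rintro ⟨_, g, c, rfl⟩
    exact (ncard_line t g c).trans (by norm_num)
  · obtain ⟨⟨p, hp⟩, ⟨q, hq⟩, hpq, rfl⟩ := Finset.card_eq_two.1 hs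
    obtain ⟨g, hg, hu⟩ := exists_unique_val_eq (f := f) (hp.trans (Eq.symm hq))
      (fun h => hpq (Subtype.ext h))
    rw [show (4 ^ (3 - 2) - 1) / (4 - 1) = 1 by norm_num, Set.ncard_eq_one]
    refine ⟨⟨line f t g (val f g p), g, _, rfl⟩, ?_⟩
    ext ⟨_, g', c, rfl⟩
    simp only [Finset.mem_insert, Finset.mem_singleton, forall_eq_or_imp, forall_eq,
      Set.mem_ofPred_eq, Set.mem_singleton_iff, Subtype.mk.injEq]
    change (val f g' p = c ∧ val f g' q = c) ↔ _
    constructor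
    · rintro ⟨rfl, h2⟩
      obtain rfl := hu g' h2.symm
      rfl
    · intro h
      obtain ⟨rfl, rfl⟩ := form_eq_of_line_eq h
      exact ⟨rfl, hg.symm⟩
  · obtain ⟨g, a, c, rfl⟩ := hsurj C
    exact ⟨g, _, hpts g a c⟩
  · rintro _ ⟨g, c, rfl⟩
    rw [← h4 g fun a => c + a * t]
    congr 1
    ext C
    obtain ⟨g', a, c', rfl⟩ := hsurj C
    simp only [Set.mem_ofPred_eq, hpts, Set.mem_range]
    constructor
    · intro h
      obtain ⟨rfl, rfl⟩ := form_eq_of_line_eq h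
      exact ⟨a, by rw [add_assoc, add_self, add_zero]⟩
    · rintro ⟨a', h⟩
      obtain ⟨rfl, rfl, rfl⟩ := hinj h
      rw [add_assoc, add_self, add_zero]

end planeDesign

namespace IncStruct

/-! ### Intersection numbers of affine resolvable designs -/

section Bose

theorem ncard_setOf_eq_card_filter {α : Type*} [Fintype α] (p : α → Prop) [DecidablePred p] :
    {x | p x}.ncard = (Finset.univ.filter p).card := by
  rw [← Set.ncard_coe_finset]
  congr 1
  ext x
  simp

variable {P β : Type*} [Finite P] [Finite β] {F : IncStruct P β}

theorem IsAffineResolvable.ncard_blocks (h : F.IsAffineResolvable 4 16 5) (x : P) :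
    {b | F.inc x b}.ncard = 21 := by
  classical
  have := Fintype.ofFinite P
  have := Fintype.ofFinite β
  obtain ⟨-, -, hd, r, hr, -, -⟩ := h
  have hcol : ∀ C, ∑ y, (if F.inc y C then 1 else 0) = 16 := fun C => by
    rw [← hd.block_size C, pts, ncard_setOf_eq_card_filter, Finset.sum_boole]
    simp
  have hrow : ∀ x, ∑ C, (if F.inc x C then 1 else 0) = r := fun x => by
    rw [← hr x, ncard_setOf_eq_card_filter, Finset.sum_boole]
    simp
  have hpair : ∀ y, ∑ C, (if F.inc x C ∧ F.inc y C then 1 else 0) =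
      if y = x then r else 5 := fun y => by
    split_ifs with hxy
    · subst hxy
      simpa using hrow y
    · have := hd.balanced {x, y} (Finset.card_pair (Ne.symm hxy))
      rw [← this, ncard_setOf_eq_card_filter, Finset.sum_boole]
      simp
  have h1 : ∑ C, ∑ y, (if F.inc x C ∧ F.inc y C then 1 else 0) = 16 * r := by
    rw [← hrow x, Finset.mul_sum]
    refine Finset.sum_congr rfl fun C _ => ?_
    by_cases hx : F.inc x C
    · simp only [hx, true_and, hcol]; simp
    · simp [hx]
  rw [Finset.sum_comm] at h1
  simp only [hpair] at h1
  rw [← Finset.add_sum_erase _ _ (Finset.mem_univ x), if_pos rfl,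
    Finset.sum_congr rfl (g := fun _ => 5) fun y hy => if_neg (Finset.ne_of_mem_erase hy),
    Finset.sum_const, Finset.card_erase_of_mem (Finset.mem_univ x), Finset.card_univ,
    ← Nat.card_eq_fintype_card, hd.card_points] at h1
  rw [hr]
  simp only [smul_eq_mul] at h1
  omega

/-- Two distinct blocks of an affine resolvable design are disjoint or meet in `k² / v = 4`
points: the sum of the `(|C ∩ C₀| - 4)²` over all blocks `C` is already attained on the parallel
class of `C₀`. -/
theorem IsAffineResolvable.ncard_inter (h : F.IsAffineResolvable 4 16 5) {C₀ C : β} (hC : C₀ ≠ C) :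
    (F.pts C₀ ∩ F.pts C).ncard = 0 ∨ (F.pts C₀ ∩ F.pts C).ncard = 4 := by
  classical
  have := Fintype.ofFinite P
  have := Fintype.ofFinite β
  have h21 := h.ncard_blocks
  obtain ⟨-, -, hd, r, hr, ⟨c, hc⟩, hcard⟩ := h
  set I : P → β → ℤ := fun x b => if F.inc x b then 1 else 0 with hI
  have hI2 : ∀ x b, I x b * I x b = I x b := fun x b => by simp [hI]
  have hcol : ∀ b, ∑ y, I y b = 16 := fun b => by
    have := hd.block_size b
    rw [pts, ncard_setOf_eq_card_filter] at this
    rw [Finset.sum_boole]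
    exact_mod_cast this
  have hrow : ∀ x, ∑ b, I x b = 21 := fun x => by
    have := h21 x
    rw [ncard_setOf_eq_card_filter] at this
    rw [Finset.sum_boole]
    exact_mod_cast this
  have hpair : ∀ x y, ∑ b, I x b * I y b = 5 + if x = y then 16 else 0 := fun x y => by
    split_ifs with hxy
    · subst hxy
      simp only [hI2, hrow]; norm_num
    · have := hd.balanced {x, y} (Finset.card_pair hxy)
      rw [ncard_setOf_eq_card_filter] at this
      simp only [hI, ← ite_and, mul_ite, mul_one, mul_zero]
      rw [Finset.sum_boole, add_zero]
      have h' : ({b | F.inc y b ∧ F.inc x b} : Finset β).card = 5 := by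
        rw [← this]; congr 1; ext b; simp [and_comm]
      exact_mod_cast h'
  have hβ : Fintype.card β = 84 := by
    have hx : Nonempty P := by
      rw [← Finite.card_pos_iff, hd.card_points]; norm_num
    obtain ⟨x⟩ := hx
    have := (hr x).symm.trans (h21 x)
    rw [← Nat.card_eq_fintype_card]; omega
  set n : β → ℤ := fun b => ∑ x, I x C₀ * I x b with hn
  have hsum : ∑ b, n b = 336 := by
    simp only [hn]
    rw [Finset.sum_comm]
    simp only [← Finset.mul_sum, hrow, ← Finset.sum_mul, hcol]; norm_num
  have hsq : ∑ b, n b * n b = 1536 := by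
    have : ∀ b, n b * n b = ∑ x, ∑ y, (I x C₀ * I y C₀) * (I x b * I y b) := fun b => by
      simp only [hn, Finset.sum_mul_sum]
      exact Finset.sum_congr rfl fun x _ => Finset.sum_congr rfl fun y _ => by ring
    simp only [this]
    rw [Finset.sum_comm]
    have h2 : ∀ x, ∑ b, ∑ y, (I x C₀ * I y C₀) * (I x b * I y b) = 96 * I x C₀ := fun x => by
      rw [Finset.sum_comm]
      simp only [← Finset.mul_sum, hpair, mul_add, Finset.sum_add_distrib, ← Finset.sum_mul, hcol,
        mul_ite, mul_zero, Finset.sum_ite_eq, Finset.mem_univ, if_true, hI2]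
      ring
    simp only [h2, ← Finset.mul_sum, hcol]; norm_num
  obtain ⟨S, ⟨hS, hCS⟩, -⟩ := hc.partition.2 C₀
  have hdisj : ∀ b ∈ S, C₀ ≠ b → n b = 0 := fun b hb hne => by
    refine Finset.sum_eq_zero fun x _ => ?_
    have := Set.disjoint_left.1 (hc.class_disjoint S hS hCS hb hne)
    by_cases hx : F.inc x C₀
    · have : ¬ F.inc x b := this hx
      simp [hI, this]
    · simp [hI, hx]
  have hself : n C₀ = 16 := by simp only [hn, hI2, hcol]
  have hncard : ∀ b, n b = (F.pts C₀ ∩ F.pts b).ncard := fun b => by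
    simp only [hn, hI, ← ite_and, mul_ite, mul_one, mul_zero]
    rw [Finset.sum_boole, show F.pts C₀ ∩ F.pts b = {x | F.inc x b ∧ F.inc x C₀} from
      Set.inter_comm _ _, ncard_setOf_eq_card_filter]
  by_cases hCm : C ∈ S
  · left
    have := hncard C
    rw [hdisj C hCm hC] at this
    exact_mod_cast this.symm
  · right
    have hall : ∑ b, (n b - 4) * (n b - 4) = 192 := by
      have : ∀ b, (n b - 4) * (n b - 4) = n b * n b - 8 * n b + 16 := fun b => by ring
      simp only [this, Finset.sum_add_distrib, Finset.sum_sub_distrib, ← Finset.mul_sum, hsum, hsq,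
        Finset.sum_const, Finset.card_univ, hβ]
      norm_num
    have hclass : ∑ b ∈ S.toFinset, (n b - 4) * (n b - 4) = 192 := by
      have hSc : S.toFinset.card = 4 := by
        rw [← Set.ncard_eq_toFinset_card', hc.class_size S hS]
      have hCS' : C₀ ∈ S.toFinset := Set.mem_toFinset.2 hCS
      rw [← Finset.add_sum_erase _ _ hCS', hself,
        Finset.sum_congr rfl (g := fun _ => 16) fun b hb => by
          rw [hdisj b (Set.mem_toFinset.1 (Finset.mem_of_mem_erase hb))
            (Finset.ne_of_mem_erase hb).symm]
          norm_num,
        Finset.sum_const, Finset.card_erase_of_mem hCS', hSc]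
      norm_num
    have hrest : ∑ b ∈ S.toFinsetᶜ, (n b - 4) * (n b - 4) = 0 := by
      have := Finset.sum_add_sum_compl S.toFinset fun b => (n b - 4) * (n b - 4)
      rw [hall, hclass] at this
      linarith
    have := (Finset.sum_eq_zero_iff_of_nonneg fun b _ => mul_self_nonneg _).1 hrest C (by simpa)
    have := hncard C ▸ (mul_self_eq_zero.1 this)
    have h4 : ((F.pts C₀ ∩ F.pts C).ncard : ℤ) = 4 := by linarith
    exact_mod_cast h4

end Bose

end IncStruct

open GF4 IncStruct planeDesign Bl

/-! ### Reconstruction of a design from its residual -/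

/-- A set of cells of a `4 × 4` grid any two of which share a row or a column has at most four
cells, and is a row or a column if it has four. -/
theorem card_le_four_of_rook (S : Finset (GF4 × GF4))
    (hS : ∀ p ∈ S, ∀ q ∈ S, p.1 = q.1 ∨ p.2 = q.2) :
    S.card ≤ 4 ∧ (S.card = 4 →
      (∃ h, ∀ a c, (a, c) ∈ S ↔ c = h) ∨ ∃ h, ∀ a c, (a, c) ∈ S ↔ a = h) := by
  have hcol : ∀ h, (∀ p ∈ S, p.2 = h) → S.card ≤ 4 ∧ (S.card = 4 → ∀ a c, (a, c) ∈ S ↔ c = h) := by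
    intro h hh
    set T : Finset (GF4 × GF4) := Finset.univ.map ⟨fun a => (a, h), fun a b e => (Prod.mk.inj e).1⟩
    have hST : S ⊆ T := fun p hp => by simp [T, ← hh p hp]
    have hT : T.card = 4 := by simp [T, GF4.card]
    refine ⟨hT ▸ Finset.card_le_card hST, fun h4 a c => ?_⟩
    rw [Finset.eq_of_subset_of_card_le hST (by rw [hT, h4])]
    simp only [T, Finset.mem_map, Finset.mem_univ, true_and]
    exact ⟨fun ⟨_, e⟩ => (congrArg Prod.snd e).symm, fun e => ⟨_, Prod.ext rfl e.symm⟩⟩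
  have hrow : ∀ h, (∀ p ∈ S, p.1 = h) → S.card ≤ 4 ∧ (S.card = 4 → ∀ a c, (a, c) ∈ S ↔ a = h) := by
    intro h hh
    set T : Finset (GF4 × GF4) := Finset.univ.map ⟨fun a => (h, a), fun a b e => (Prod.mk.inj e).2⟩
    have hST : S ⊆ T := fun p hp => by simp [T, ← hh p hp]
    have hT : T.card = 4 := by simp [T, GF4.card]
    refine ⟨hT ▸ Finset.card_le_card hST, fun h4 a c => ?_⟩
    rw [Finset.eq_of_subset_of_card_le hST (by rw [hT, h4])]
    simp only [T, Finset.mem_map, Finset.mem_univ, true_and]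
    exact ⟨fun ⟨_, e⟩ => (congrArg Prod.fst e).symm, fun e => ⟨_, Prod.ext e.symm rfl⟩⟩
  by_cases h : ∃ p ∈ S, ∃ q ∈ S, p.1 ≠ q.1
  · obtain ⟨p, hp, q, hq, hpq⟩ := h
    have h2 : p.2 = q.2 := (hS p hp q hq).resolve_left hpq
    have := hcol p.2 fun r hr => by
      by_contra hne
      have h1 := (hS r hr p hp).resolve_right hne
      have h3 := (hS r hr q hq).resolve_right (h2 ▸ hne)
      exact hpq (h1.symm.trans h3)
    exact ⟨this.1, fun h4 => .inl ⟨_, this.2 h4⟩⟩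
  · push Not at h
    rcases S.eq_empty_or_nonempty with rfl | ⟨p, hp⟩
    · simp
    · have := hrow p.1 fun r hr => h r hr p hp
      exact ⟨this.1, fun h4 => .inr ⟨_, this.2 h4⟩⟩

section Embedding

variable {f : GF4 → GF4} {P β : Type*} {F : IncStruct P β} {B : β}

/-- The block of `F` which corresponds to a block of `planeDesign f`, given an isomorphism of the
residuals at `vert 0` and `B`. -/
def extBlock (i : Iso ((planeDesign f).residual (vert 0)) (F.residual B)) (b : Bl) : β :=
  if h : b = vert 0 then B else (i.onBlocks ⟨b, h⟩).1

variable (i : Iso ((planeDesign f).residual (vert 0)) (F.residual B))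

theorem extBlock_vert_zero : extBlock i (vert 0) = B := dif_pos rfl

theorem extBlock_of_ne {b : Bl} (h : b ≠ vert 0) : extBlock i b = (i.onBlocks ⟨b, h⟩).1 :=
  dif_neg h

theorem extBlock_ne {b : Bl} (h : b ≠ vert 0) : extBlock i b ≠ B := by
  rw [extBlock_of_ne i h]; exact (i.onBlocks ⟨b, h⟩).2

theorem extBlock_injective : Function.Injective (extBlock i) := by
  intro b c hbc
  by_cases hb : b = vert 0
  · by_cases hc : c = vert 0
    · rw [hb, hc]
    · rw [hb, extBlock_vert_zero] at hbc
      exact (extBlock_ne i hc hbc.symm).elim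
  · by_cases hc : c = vert 0
    · rw [hc, extBlock_vert_zero] at hbc
      exact (extBlock_ne i hb hbc).elim
    · rw [extBlock_of_ne i hb, extBlock_of_ne i hc] at hbc
      exact congrArg Subtype.val (i.onBlocks.injective (Subtype.ext hbc))

theorem extBlock_surjective : Function.Surjective (extBlock i) := by
  intro C
  by_cases hC : C = B
  · exact ⟨vert 0, by rw [extBlock_vert_zero, hC]⟩
  · obtain ⟨⟨b, hb⟩, h⟩ := i.onBlocks.surjective ⟨C, hC⟩
    exact ⟨b, by rw [extBlock_of_ne i hb, h]⟩

theorem pl_ne_vert {g a c t} : pl g a c ≠ vert t := by simp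

/-- The points off the block `z = 0`, as points of `F` off `B`. -/
def offPoint {p : Pt} (h : p.2.2 ≠ 0) : P := (i.onPoints ⟨p, h⟩).1

theorem offPoint_not_inc {p : Pt} (h : p.2.2 ≠ 0) : ¬ F.inc (offPoint i h) B :=
  (i.onPoints ⟨p, h⟩).2

theorem offPoint_injective {p q : Pt} (hp : p.2.2 ≠ 0) (hq : q.2.2 ≠ 0)
    (h : offPoint i hp = offPoint i hq) : p = q :=
  congrArg Subtype.val (i.onPoints.injective (Subtype.ext h))

theorem exists_offPoint {x : P} (hx : ¬ F.inc x B) :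
    ∃ (p : Pt) (h : p.2.2 ≠ 0), offPoint i h = x := by
  obtain ⟨⟨p, hp⟩, h⟩ := i.onPoints.surjective ⟨x, hx⟩
  exact ⟨p, hp, congrArg Subtype.val h⟩

theorem inc_offPoint {p : Pt} (h : p.2.2 ≠ 0) (b : Bl) :
    F.inc (offPoint i h) (extBlock i b) ↔ (planeDesign f).inc p b := by
  by_cases hb : b = vert 0
  · subst hb
    rw [extBlock_vert_zero]
    exact ⟨fun h' => (offPoint_not_inc i h h').elim, fun h' => (h h').elim⟩
  · rw [extBlock_of_ne i hb]
    exact (i.inc_iff ⟨p, h⟩ ⟨b, hb⟩).symm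

variable [Finite P] [Finite β] (hF : F.IsAffineResolvable 4 16 5)
include hF

omit [Finite β] in
/-- The blocks parallel to `B` are those which correspond to the planes `z = t`. -/
theorem not_inc_vert {x : P} (hx : F.inc x B) {t : GF4} (ht : t ≠ 0) :
    ¬ F.inc x (extBlock i (vert t)) := by
  intro h
  set u : GF4 × GF4 → P := fun s => offPoint i (p := (s.1, s.2, t)) ht
  have hu : Function.Injective u := fun s s' e => by
    have := offPoint_injective i _ _ e
    exact Prod.ext (congrArg (fun q : Pt => q.1) this) (congrArg (fun q : Pt => q.2.1) this)
  have hsub : Set.range u ⊆ F.pts (extBlock i (vert t)) := by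
    rintro _ ⟨s, rfl⟩
    exact (inc_offPoint i ht _).2 rfl
  have heq := Set.eq_of_subset_of_ncard_le hsub (by
    rw [hF.2.2.1.block_size, ← Set.image_univ, Set.ncard_image_of_injective _ hu, Set.ncard_univ,
      Nat.card_prod, GF4.natCard]) (Set.toFinite _)
  have : x ∈ Set.range u := by rw [heq]; exact h
  obtain ⟨s, rfl⟩ := this
  exact offPoint_not_inc i ht hx

/-- Two blocks of one group which are not in a common row or column meet in four points off
`B`, hence do not meet on `B`. -/
theorem eq_or_eq_of_inc_inc {x : P} (hx : F.inc x B) {g : Option GF4} {a c a' c' : GF4}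
    (h : F.inc x (extBlock i (pl g a c))) (h' : F.inc x (extBlock i (pl g a' c'))) :
    a = a' ∨ c = c' := by
  by_contra! hne
  have h0 : a + a' ≠ 0 := fun e => hne.1 (add_eq_zero_iff.1 e)
  have h1 : c + c' ≠ 0 := fun e => hne.2 (add_eq_zero_iff.1 e)
  set z := (c + c') * (a + a')⁻¹ with hz
  have hz0 : z ≠ 0 := mul_ne_zero h1 (inv_ne_zero h0)
  have hzeq : (a + a') * z = c + c' := by rw [hz, mul_comm, inv_mul_cancel_right₀ h0]
  have hsz : ∀ s, (sol f g (c + a * z) s z).2.2 ≠ 0 := fun s => by rwa [sol_z]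
  set u : GF4 → P := fun s => offPoint i (hsz s)
  have hu : Function.Injective u := fun s s' e => (sol_injective (offPoint_injective i _ _ e)).2.1
  have hsub : insert x (Set.range u) ⊆ F.pts (extBlock i (pl g a c)) ∩
      F.pts (extBlock i (pl g a' c')) := by
    rintro _ (rfl | ⟨s, rfl⟩)
    · exact ⟨h, h'⟩
    · refine ⟨(inc_offPoint i _ _).2 ?_, (inc_offPoint i _ _).2 ?_⟩
      · rw [inc_pl, val_sol, sol_z]
        linear_combination a * z * two_eq_zero
      · rw [inc_pl, val_sol, sol_z]
        linear_combination hzeq + c * two_eq_zero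
  have hxr : x ∉ Set.range u := by
    rintro ⟨s, rfl⟩
    exact offPoint_not_inc i _ hx
  have hle := Set.ncard_le_ncard hsub (Set.toFinite _)
  rw [Set.ncard_insert_of_notMem hxr (Set.toFinite _), ← Set.image_univ,
    Set.ncard_image_of_injective _ hu, Set.ncard_univ, GF4.natCard] at hle
  have hb : extBlock i (pl g a c) ≠ extBlock i (pl g a' c') := fun e =>
    hne.1 (pl.inj (extBlock_injective i e)).2.1
  rcases hF.ncard_inter hb with h | h <;> omega

/-- Two blocks in a common row or column of a group are disjoint off `B`, hence disjoint or equal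
on `B`. -/
theorem inc_of_common_point {x y : P} (hy : F.inc y B) {g : Option GF4}
    {a c a' c' : GF4} (hac : a = a' ∨ c = c') (h : F.inc x (extBlock i (pl g a c)))
    (h' : F.inc x (extBlock i (pl g a' c'))) (hy' : F.inc y (extBlock i (pl g a c))) :
    F.inc y (extBlock i (pl g a' c')) := by
  by_cases heq : pl g a c = pl g a' c'
  · rwa [← heq]
  have hne : extBlock i (pl g a c) ≠ extBlock i (pl g a' c') := fun e =>
    heq (extBlock_injective i e)
  have h4 := (hF.ncard_inter hne).resolve_left fun h0 => by
    rw [Set.ncard_eq_zero (Set.toFinite _)] at h0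
    exact Set.notMem_empty x (h0 ▸ ⟨h, h'⟩)
  have hsub : F.pts (extBlock i (pl g a c)) ∩ F.pts (extBlock i (pl g a' c')) ⊆
      F.pts (extBlock i (pl g a c)) ∩ F.pts B := by
    rintro w ⟨h1, h2⟩
    refine ⟨h1, ?_⟩
    by_contra hw
    obtain ⟨p, hp, rfl⟩ := exists_offPoint i hw
    have e1 := inc_pl.1 ((inc_offPoint i hp _).1 h1)
    have e2 := inc_pl.1 ((inc_offPoint i hp _).1 h2)
    apply heq
    rcases hac with rfl | rfl
    · rw [← e1, ← e2]
    · have := add_left_cancel (e1.trans e2.symm)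
      rw [mul_right_cancel₀ hp this]
  have hle : (F.pts (extBlock i (pl g a c)) ∩ F.pts B).ncard ≤ 4 := by
    rcases hF.ncard_inter (extBlock_ne i (b := pl g a c) pl_ne_vert) with h | h <;> omega
  have := Set.eq_of_subset_of_ncard_le hsub (by rw [h4]; exact hle) (Set.toFinite _)
  have hmem : y ∈ F.pts (extBlock i (pl g a c)) ∩ F.pts (extBlock i (pl g a' c')) := by
    rw [this]; exact ⟨hy', hy⟩
  exact hmem.2

/-- For every group, the blocks of the group through a point of `B` form a row or a column. -/
theorem column_or_row {x : P} (hx : F.inc x B) (g : Option GF4) :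
    (∃ h, ∀ a c, F.inc x (extBlock i (pl g a c)) ↔ c = h) ∨
      ∃ h, ∀ a c, F.inc x (extBlock i (pl g a c)) ↔ a = h := by
  classical
  set S : Option GF4 → Finset (GF4 × GF4) := fun g =>
    Finset.univ.filter fun s => F.inc x (extBlock i (pl g s.1 s.2)) with hS
  have hmem : ∀ g a c, (a, c) ∈ S g ↔ F.inc x (extBlock i (pl g a c)) := fun g a c => by simp [hS]
  have hrook : ∀ g, ∀ p ∈ S g, ∀ q ∈ S g, p.1 = q.1 ∨ p.2 = q.2 := fun g p hp q hq =>
    eq_or_eq_of_inc_inc i hF hx ((hmem g _ _).1 hp) ((hmem g _ _).1 hq)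
  have hle : ∀ g, (S g).card ≤ 4 := fun g => (card_le_four_of_rook _ (hrook g)).1
  have hset : {b | F.inc x b} = insert B (((Finset.univ.sigma S).image
      fun s => extBlock i (pl s.1 s.2.1 s.2.2) : Finset β) : Set β) := by
    ext b
    obtain ⟨b, rfl⟩ := extBlock_surjective i b
    simp only [Set.mem_ofPred_eq, Finset.coe_image, Set.mem_insert_iff, Set.mem_image,
      Finset.mem_coe, Finset.mem_sigma, Finset.mem_univ, true_and, Sigma.exists, Prod.exists, hmem]
    cases b with
    | vert t =>
      by_cases ht : t = 0
      · subst ht; simp [extBlock_vert_zero, hx]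
      · refine iff_of_false (not_inc_vert i hF hx ht) ?_
        rintro (h | ⟨g, a, c, -, h⟩)
        · exact extBlock_ne i (fun e => ht (vert.inj e)) h
        · simpa using extBlock_injective i h
    | pl g a c =>
      constructor
      · exact fun h => .inr ⟨g, a, c, h, rfl⟩
      · rintro (h | ⟨g', a', c', h, e⟩)
        · exact (extBlock_ne i pl_ne_vert h).elim
        · rwa [e] at h
  have hcard := hF.ncard_blocks x
  rw [hset, Set.ncard_insert_of_notMem, Set.ncard_coe_finset, Finset.card_image_of_injective,
    Finset.card_sigma] at hcard
  rotate_left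
  · rintro ⟨g, a, c⟩ ⟨g', a', c'⟩ e
    obtain ⟨rfl, rfl, rfl⟩ := pl.inj (extBlock_injective i e)
    rfl
  · simp only [Finset.coe_image, Set.mem_image, not_exists, not_and]
    exact fun s _ e => extBlock_ne i pl_ne_vert e
  have h4 : (S g).card = 4 := by
    by_contra hlt
    have := Finset.sum_lt_sum (s := Finset.univ) (f := fun g => (S g).card) (g := fun _ => 4)
      (fun g _ => hle g) ⟨g, Finset.mem_univ g, lt_of_le_of_ne (hle g) hlt⟩
    rw [Finset.sum_const, Finset.card_univ, Fintype.card_option, GF4.card] at this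
    simp only [smul_eq_mul] at this
    omega
  have := (card_le_four_of_rook _ (hrook g)).2 h4
  simpa only [hmem] using this

/-- Whether the blocks of a group through a point of `B` form a row or a column does not depend on
the point. -/
theorem columns_or_rows (g : Option GF4) :
    (∀ x, F.inc x B → ∃ h, ∀ a c, F.inc x (extBlock i (pl g a c)) ↔ c = h) ∨
      ∀ x, F.inc x B → ∃ h, ∀ a c, F.inc x (extBlock i (pl g a c)) ↔ a = h := by
  by_contra! hcon
  obtain ⟨⟨x, hx, hx'⟩, y, hy, hy'⟩ := hcon
  obtain ⟨h, hrow⟩ := (column_or_row i hF hx g).resolve_left fun ⟨h, hh⟩ => by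
    obtain ⟨a, c, h1⟩ := hx' h
    have := hh a c
    tauto
  obtain ⟨k, hcol⟩ := (column_or_row i hF hy g).resolve_right fun ⟨h, hh⟩ => by
    obtain ⟨a, c, h1⟩ := hy' h
    have := hh a c
    tauto
  -- the point `x` lies on row `h` and `y` on column `k`; compare the blocks `(h, k)`, `(h, k + 1)`
  have := inc_of_common_point i hF hy (a := h) (c := k) (a' := h) (c' := k + 1) (.inl rfl)
    ((hrow _ _).2 rfl) ((hrow _ _).2 rfl) ((hcol _ _).2 rfl)
  exact one_ne_zero (add_eq_left.1 ((hcol _ _).1 this))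

/-- In each group the points of `B` are labelled by their columns, or by their rows. -/
theorem exists_line_labels :
    ∃ h : Option GF4 → P → GF4, ∀ g,
      (∀ x, F.inc x B → ∀ a c, F.inc x (extBlock i (pl g a c)) ↔ c = h g x) ∨
        ∀ x, F.inc x B → ∀ a c, F.inc x (extBlock i (pl g a c)) ↔ a = h g x := by
  have : ∀ g, ∃ h : P → GF4,
      (∀ x, F.inc x B → ∀ a c, F.inc x (extBlock i (pl g a c)) ↔ c = h x) ∨
        ∀ x, F.inc x B → ∀ a c, F.inc x (extBlock i (pl g a c)) ↔ a = h x := by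
    classical
    intro g
    rcases columns_or_rows i hF g with h | h
    · choose h hh using h
      exact ⟨fun x => if hx : F.inc x B then h x hx else 0,
        .inl fun x hx a c => by simp only [dif_pos hx, hh x hx]⟩
    · choose h hh using h
      exact ⟨fun x => if hx : F.inc x B then h x hx else 0,
        .inr fun x hx a c => by simp only [dif_pos hx, hh x hx]⟩
  exact Classical.axiom_of_choice this

omit [Finite P] in
/-- Two distinct points of `B` are on a common line of at most one group, since each common line
lies on four further blocks. -/
theorem label_pair_injective {h : Option GF4 → P → GF4}
    (hh : ∀ g, (∀ x, F.inc x B → ∀ a c, F.inc x (extBlock i (pl g a c)) ↔ c = h g x) ∨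
      ∀ x, F.inc x B → ∀ a c, F.inc x (extBlock i (pl g a c)) ↔ a = h g x)
    {g g' : Option GF4} (hg : g ≠ g') {x y : P} (hx : F.inc x B) (hy : F.inc y B)
    (h1 : h g x = h g y) (h2 : h g' x = h g' y) : x = y := by
  by_contra hxy
  have key : ∀ g, h g x = h g y → ∃ u : GF4 → Bl, Function.Injective u ∧
      (∀ s, ∃ a c, u s = pl g a c) ∧
      ∀ s, F.inc x (extBlock i (u s)) ∧ F.inc y (extBlock i (u s)) := by
    intro g hxy
    rcases hh g with hg | hg
    · exact ⟨fun a => pl g a (h g x), fun a b e => (pl.inj e).2.1, fun a => ⟨_, _, rfl⟩,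
        fun a => ⟨(hg x hx _ _).2 rfl, (hg y hy _ _).2 hxy⟩⟩
    · exact ⟨fun a => pl g (h g x) a, fun a b e => (pl.inj e).2.2, fun a => ⟨_, _, rfl⟩,
        fun a => ⟨(hg x hx _ _).2 rfl, (hg y hy _ _).2 hxy⟩⟩
  obtain ⟨u, hu, hug, hux⟩ := key g h1
  obtain ⟨u', hu', hug', hux'⟩ := key g' h2
  have hinj : Function.Injective fun s : GF4 ⊕ GF4 => extBlock i (Sum.elim u u' s) := by
    refine (extBlock_injective i).comp (hu.sumElim hu' fun a b e => ?_)
    obtain ⟨_, _, e1⟩ := hug a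
    obtain ⟨_, _, e2⟩ := hug' b
    rw [e1, e2] at e
    exact hg (pl.inj e).1
  have hle := Set.ncard_le_ncard (s := Set.range fun s : GF4 ⊕ GF4 => extBlock i (Sum.elim u u' s))
    (t := {b | F.inc x b ∧ F.inc y b}) (by
      rintro _ ⟨s | s, rfl⟩
      · exact hux s
      · exact hux' s) (Set.toFinite _)
  classical
  have h5 := hF.2.2.1.balanced {x, y} (Finset.card_pair hxy)
  simp only [Finset.mem_insert, Finset.mem_singleton, forall_eq_or_imp, forall_eq] at h5
  rw [← Set.image_univ, Set.ncard_image_of_injective _ hinj, Set.ncard_univ, Nat.card_sum,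
    GF4.natCard, h5] at hle
  omega

/-- The labels of two groups are coordinates on `B`. -/
theorem exists_of_labels {h : Option GF4 → P → GF4}
    (hh : ∀ g, (∀ x, F.inc x B → ∀ a c, F.inc x (extBlock i (pl g a c)) ↔ c = h g x) ∨
      ∀ x, F.inc x B → ∀ a c, F.inc x (extBlock i (pl g a c)) ↔ a = h g x)
    {g g' : Option GF4} (hg : g ≠ g') (u v : GF4) :
    ∃ x, F.inc x B ∧ h g x = u ∧ h g' x = v := by
  have hfin := Fintype.ofFinite {x // F.inc x B}
  have hbij := (Fintype.bijective_iff_injective_and_card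
    (fun x : {x // F.inc x B} => (h g x.1, h g' x.1))).2 ⟨fun x y e =>
      Subtype.ext (label_pair_injective i hF hh hg x.2 y.2 (Prod.mk.inj e).1 (Prod.mk.inj e).2), by
      rw [← Nat.card_eq_fintype_card, Fintype.card_prod, GF4.card]
      exact (Nat.card_coe_set_eq (F.pts B)).trans (hF.2.2.1.block_size B)⟩
  obtain ⟨x, hx⟩ := hbij.2 (u, v)
  exact ⟨x.1, x.2, (Prod.mk.inj hx).1, (Prod.mk.inj hx).2⟩

end Embedding

/-! ### Linear relations between blocks and the classification of linear embeddings -/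

section Embedding

variable {f : GF4 → GF4} {P β : Type*} {F : IncStruct P β} {B : β}

theorem incMatrix_of_inc {D : IncStruct P β} {x : P} {b : β} (h : D.inc x b) :
    D.incMatrix (ZMod 2) x b = 1 := by simp [incMatrix, h]

theorem incMatrix_of_not_inc {D : IncStruct P β} {x : P} {b : β} (h : ¬ D.inc x b) :
    D.incMatrix (ZMod 2) x b = 0 := by simp [incMatrix, h]

/-- The sum of `φ c` over the block of a parallel class through a point. -/
theorem sum_mul_incMatrix {D : IncStruct P β} {x : P} {b : GF4 → β} {v : GF4}
    (h : ∀ c, D.inc x (b c) ↔ c = v) (φ : GF4 → ZMod 2) :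
    ∑ c, φ c * D.incMatrix (ZMod 2) x (b c) = φ v := by
  rw [Finset.sum_eq_single v]
  · rw [incMatrix_of_inc ((h v).2 rfl), mul_one]
  · intro c _ hc
    rw [incMatrix_of_not_inc fun h' => hc ((h c).1 h'), mul_zero]
  · simp

theorem sum_tr_mul_incMatrix_of_const {D : IncStruct P β} {x : P} {b : GF4 → β}
    (h : ∀ c, D.inc x (b c) ↔ D.inc x (b 0)) (μ : GF4) :
    ∑ c, tr (μ * c) * D.incMatrix (ZMod 2) x (b c) = 0 := by
  have h0 : ∀ μ, ∑ c, tr (μ * c) = 0 := by decide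
  by_cases h1 : D.inc x (b 0)
  · rw [← h0 μ]
    exact Finset.sum_congr rfl fun c _ => by rw [incMatrix_of_inc ((h c).2 h1), mul_one]
  · exact Finset.sum_eq_zero fun c _ => by
      rw [incMatrix_of_not_inc fun h' => h1 ((h c).1 h'), mul_zero]

variable (i : Iso ((planeDesign f).residual (vert 0)) (F.residual B))
variable [Finite P] [Finite β] (hF : F.IsAffineResolvable 4 16 5)
  (hrank : F.pRank 2 = (F.residual B).pRank 2 + 1)
include hF hrank

omit hF in
/-- Linearity of the embedding: a linear relation between blocks of the residual turns
into a function on `B` which is constant. -/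
theorem sum_const_of_sum_eq_zero {ι : Type*} [Fintype ι] (b : ι → Bl) (w : ι → ZMod 2)
    (h0 : ∀ p : Pt, p.2.2 ≠ 0 → ∑ j, w j * (planeDesign f).incMatrix (ZMod 2) p (b j) = 0)
    {x y : P} (hx : F.inc x B) (hy : F.inc y B) :
    ∑ j, w j * F.incMatrix (ZMod 2) x (extBlock i (b j)) =
      ∑ j, w j * F.incMatrix (ZMod 2) y (extBlock i (b j)) := by
  have key := (pRank_eq_residual_add_one_iff F ⟨x, hx⟩).1 hrank
    (∑ j, w j • fun x => F.incMatrix (ZMod 2) x (extBlock i (b j)))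
    (Submodule.sum_mem _ fun j _ => Submodule.smul_mem _ _ (F.col_mem_code 2 _))
  simp only [Finset.sum_apply, Pi.smul_apply, smul_eq_mul] at key
  refine key (fun u hu => ?_) x y hx hy
  obtain ⟨p, hp, rfl⟩ := exists_offPoint i hu
  rw [← h0 p hp]
  refine Finset.sum_congr rfl fun j _ => ?_
  by_cases h : (planeDesign f).inc p (b j)
  · rw [incMatrix_of_inc h, incMatrix_of_inc ((inc_offPoint i hp _).2 h)]
  · rw [incMatrix_of_not_inc h, incMatrix_of_not_inc fun h' => h ((inc_offPoint i hp _).1 h')]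

variable {α : GF4} (hf : ∀ z, z ≠ 0 → f z = α * (z * z))
include hf

omit hF in
/-- The relation with three groups. The term `a z` of the third block makes up for the
deformation: `tr (k α m² z²) = tr (k² α² m z)`. -/
theorem three_term_relation (k m : GF4) {x y : P} (hx : F.inc x B) (hy : F.inc y B) :
    ∑ c, tr (k * c) * F.incMatrix (ZMod 2) x (extBlock i (pl (some 0) 0 c)) +
      (∑ c, tr (k * m * c) * F.incMatrix (ZMod 2) x (extBlock i (pl none 0 c)) +
        ∑ c, tr (k * c) * F.incMatrix (ZMod 2) x (extBlock i (pl (some m) (k * α * α * m) c))) =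
    ∑ c, tr (k * c) * F.incMatrix (ZMod 2) y (extBlock i (pl (some 0) 0 c)) +
      (∑ c, tr (k * m * c) * F.incMatrix (ZMod 2) y (extBlock i (pl none 0 c)) +
        ∑ c, tr (k * c) * F.incMatrix (ZMod 2) y
          (extBlock i (pl (some m) (k * α * α * m) c))) := by
  have htr : ∀ k m α z : GF4, tr (k * (α * (z * z) * (m * m)) + k * (k * α * α * m * z)) = 0 := by
    decide
  have := sum_const_of_sum_eq_zero i hrank (ι := GF4 ⊕ GF4 ⊕ GF4)
    (Sum.elim (pl (some 0) 0) (Sum.elim (pl none 0) (pl (some m) (k * α * α * m))))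
    (Sum.elim (fun c => tr (k * c)) (Sum.elim (fun c => tr (k * m * c)) (fun c => tr (k * c))))
    (fun p hp => by
      simp only [Fintype.sum_sum_type, Sum.elim_inl, Sum.elim_inr]
      rw [sum_mul_incMatrix fun c => inc_pl.trans eq_comm,
        sum_mul_incMatrix fun c => inc_pl.trans eq_comm,
        sum_mul_incMatrix fun c => inc_pl.trans eq_comm, ← tr_add, ← tr_add]
      rw [← htr k m α p.2.2]
      congr 1
      simp only [val, hf _ hp]
      linear_combination (k * p.1 + k * m * p.2.1) * two_eq_zero) hx hy
  simpa only [Fintype.sum_sum_type, Sum.elim_inl, Sum.elim_inr] using this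

/-- The relation given by the norm. -/
theorem norm_relation {x y : P} (hx : F.inc x B) (hy : F.inc y B) :
    ∑ g, ∑ c, nm c * F.incMatrix (ZMod 2) x (extBlock i (pl g 0 c)) =
      ∑ g, ∑ c, nm c * F.incMatrix (ZMod 2) y (extBlock i (pl g 0 c)) := by
  have hnm : ∀ α x y z : GF4, z ≠ 0 →
      nm α + (nm y + (nm (x + 0 * y + α * (z * z) * (0 * 0)) +
        (nm (x + 1 * y + α * (z * z) * (1 * 1)) +
          (nm (x + om * y + α * (z * z) * (om * om)) +
            nm (x + om2 * y + α * (z * z) * (om2 * om2)))))) = 0 := by decide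
  have := sum_const_of_sum_eq_zero i hrank (ι := GF4 ⊕ Option GF4 × GF4)
    (Sum.elim vert fun s => pl s.1 0 s.2)
    (Sum.elim (fun t => if t = 0 then 0 else nm α) fun s => nm s.2)
    (fun p hp => by
      simp only [Fintype.sum_sum_type, Sum.elim_inl, Sum.elim_inr, Fintype.sum_prod_type]
      rw [sum_mul_incMatrix (fun c => inc_vert.trans eq_comm) fun t => if t = 0 then 0 else nm α,
        if_neg hp]
      simp only [sum_mul_incMatrix (D := planeDesign f) fun c => inc_pl.trans eq_comm]
      rw [sum_univ_option]
      simp only [val, hf _ hp, zero_mul, add_zero]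
      simpa using hnm α p.1 p.2.1 p.2.2 hp) hx hy
  simp only [Fintype.sum_sum_type, Sum.elim_inl, Sum.elim_inr, Fintype.sum_prod_type] at this
  have hv : ∀ x, F.inc x B → ∑ t, (if t = 0 then 0 else nm α) *
      F.incMatrix (ZMod 2) x (extBlock i (vert t)) = 0 := fun x hx => by
    refine Finset.sum_eq_zero fun t _ => ?_
    split_ifs with ht
    · rw [zero_mul]
    · rw [incMatrix_of_not_inc (not_inc_vert i hF hx ht), mul_zero]
  rwa [hv x hx, hv y hy, zero_add, zero_add] at this

/-- In all groups the blocks through a point of `B` are in a common column, or in all groups they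
are in a common row: with both kinds, a relation with three groups would be a nonconstant function
on `B`. -/
theorem all_columns_or_all_rows {h : Option GF4 → P → GF4}
    (hh : ∀ g, (∀ x, F.inc x B → ∀ a c, F.inc x (extBlock i (pl g a c)) ↔ c = h g x) ∨
      ∀ x, F.inc x B → ∀ a c, F.inc x (extBlock i (pl g a c)) ↔ a = h g x) :
    (∀ g x, F.inc x B → ∀ a c, F.inc x (extBlock i (pl g a c)) ↔ c = h g x) ∨
      ∀ g x, F.inc x B → ∀ a c, F.inc x (extBlock i (pl g a c)) ↔ a = h g x := by
  classical
  set col : Option GF4 → Prop := fun g =>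
    ∀ x, F.inc x B → ∀ a c, F.inc x (extBlock i (pl g a c)) ↔ c = h g x with hcol
  have hT : ∀ g μ a x, F.inc x B →
      ∑ c, tr (μ * c) * F.incMatrix (ZMod 2) x (extBlock i (pl g a c)) =
        if col g then tr (μ * h g x) else 0 := fun g μ a x hx => by
    split_ifs with hg
    · exact sum_mul_incMatrix (fun c => hg x hx a c) _
    · have := (hh g).resolve_left hg
      exact sum_tr_mul_incMatrix_of_const (fun c => by rw [this x hx, this x hx]) _
  have htr : ∀ μ : GF4, μ ≠ 0 → ∃ v, tr (μ * v) = 1 := by decide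
  have key : ∀ g₁ g₂ g₃ μ₁ μ₂ μ₃, g₁ ≠ g₃ → μ₁ ≠ 0 →
      (∀ x y, F.inc x B → F.inc y B →
        (if col g₁ then tr (μ₁ * h g₁ x) else 0) + ((if col g₂ then tr (μ₂ * h g₂ x) else 0) +
          (if col g₃ then tr (μ₃ * h g₃ x) else 0)) =
        (if col g₁ then tr (μ₁ * h g₁ y) else 0) + ((if col g₂ then tr (μ₂ * h g₂ y) else 0) +
          (if col g₃ then tr (μ₃ * h g₃ y) else 0))) → col g₁ → col g₂ := by
    intro g₁ g₂ g₃ μ₁ μ₂ μ₃ hg hμ hrel h1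
    by_contra h2
    obtain ⟨v, hv⟩ : ∃ v, tr (μ₁ * v) = 1 := htr μ₁ hμ
    obtain ⟨x, hx, hx1, hx3⟩ := exists_of_labels i hF hh hg 0 0
    obtain ⟨y, hy, hy1, hy3⟩ := exists_of_labels i hF hh hg v 0
    have := hrel x y hx hy
    rw [if_pos h1, if_pos h1, if_neg h2, if_neg h2, hx1, hy1, hx3, hy3] at this
    have := add_right_cancel this
    rw [hv, mul_zero] at this
    exact absurd this (by decide)
  have hrel : ∀ m, m ≠ 0 → ∀ x y, F.inc x B → F.inc y B →
        (if col (some 0) then tr (1 * h (some 0) x) else 0) +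
          ((if col none then tr (1 * m * h none x) else 0) +
          (if col (some m) then tr (1 * h (some m) x) else 0)) =
        (if col (some 0) then tr (1 * h (some 0) y) else 0) +
          ((if col none then tr (1 * m * h none y) else 0) +
          (if col (some m) then tr (1 * h (some m) y) else 0)) := by
    intro m _ x y hx hy
    have := three_term_relation i hrank hf 1 m hx hy
    rwa [hT _ _ _ _ hx, hT _ _ _ _ hx, hT _ _ _ _ hx, hT _ _ _ _ hy, hT _ _ _ _ hy,
      hT _ _ _ _ hy] at this
  have hall : ∀ g, col g ↔ col none := by
    rintro (_ | m)
    · rfl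
    by_cases hm : m = 0
    · subst hm
      refine ⟨key _ _ (some 1) _ _ _ (by simp) one_ne_zero (hrel 1 one_ne_zero),
        key _ _ (some 1) (1 * 1) 1 1 (by simp) one_ne_zero fun x y hx hy => ?_⟩
      have := hrel 1 one_ne_zero x y hx hy
      rwa [add_left_comm, add_left_comm (if col (some 0) then _ else (0 : ZMod 2))] at this
    · refine ⟨key _ _ (some 0) 1 (1 * m) 1 (by simpa using hm) one_ne_zero fun x y hx hy => ?_,
        key _ _ (some 0) (1 * m) 1 1 (by simp) (by rwa [one_mul]) fun x y hx hy => ?_⟩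
      · have := hrel m hm x y hx hy
        rw [add_comm, add_comm (if col (some 0) then _ else (0 : ZMod 2)), add_comm (ite _ _ _),
          add_comm (ite (col none) _ _)] at this
        simpa only [add_assoc] using this
      · have := hrel m hm x y hx hy
        rw [add_comm, add_comm (if col (some 0) then _ else (0 : ZMod 2))] at this
        simpa only [add_assoc] using this
  by_cases hn : col none
  · exact .inl fun g => (hall g).2 hn
  · exact .inr fun g => (hh g).resolve_left fun hg => hn ((hall g).1 hg)

/-- If the blocks through a point of `B` form columns, then `F` is the design of a function which
agrees with `f` off `0`. -/
theorem exists_iso_of_columns {h : Option GF4 → P → GF4}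
    (hh : ∀ g x, F.inc x B → ∀ a c, F.inc x (extBlock i (pl g a c)) ↔ c = h g x) :
    ∃ (κ : GF4) (j : Iso (planeDesign fun z => if z = 0 then κ else f z) F),
      j.onBlocks (vert 0) = B := by
  have hh' := fun g => Or.inl (b := ∀ x, F.inc x B → ∀ a c,
    F.inc x (extBlock i (pl g a c)) ↔ a = h g x) (hh g)
  -- the linear relations: the labels are affine functions of the first two labels
  obtain ⟨x₀, hx₀, h00, h0n⟩ := exists_of_labels i hF hh' (g := some 0) (g' := none) (by simp) 0 0
  set κ : GF4 → GF4 := fun m => h (some m) x₀ with hκ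
  have hlin : ∀ m x, F.inc x B → h (some m) x = h (some 0) x + m * h none x + κ m := by
    intro m x hx
    have : h (some 0) x + m * h none x + h (some m) x = κ m := by
      apply eq_of_tr_mul
      intro k
      have := three_term_relation i hrank hf k m hx hx₀
      simp only [sum_mul_incMatrix (fun c => hh _ _ hx _ c),
        sum_mul_incMatrix (fun c => hh _ _ hx₀ _ c), h00, h0n, ← tr_add] at this
      simp only [mul_zero, zero_add] at this
      rw [← this]
      congr 1
      ring
    rw [← this]
    linear_combination (-h (some 0) x - m * h none x) * two_eq_zero
  have hκ0 : κ 0 = 0 := h00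
  -- the norm relation: the translation vector is in the Hermitian dual code
  have hherm : ∀ k₁ k₂ k₃ : GF4, (∀ u v : GF4,
      nm v + (nm u + (nm (u + 1 * v + k₁) + (nm (u + om * v + k₂) + nm (u + om2 * v + k₃)))) =
        nm 0 + (nm 0 + (nm k₁ + (nm k₂ + nm k₃)))) →
      k₂ = k₁ * (om * om) ∧ k₃ = k₁ * (om2 * om2) := by decide
  have hκm : ∀ m, κ m = κ 1 * (m * m) := by
    have := hherm (κ 1) (κ om) (κ om2) fun u v => by
      obtain ⟨x, hx, hxu, hxv⟩ := exists_of_labels i hF hh' (g := some 0) (g' := none) (by simp) u v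
      have := norm_relation i hF hrank hf hx hx₀
      simp only [sum_mul_incMatrix (fun c => hh _ _ hx _ c),
        sum_mul_incMatrix (fun c => hh _ _ hx₀ _ c)] at this
      rw [sum_univ_option, sum_univ_option, h00, h0n, hlin 1 x hx, hlin om x hx, hlin om2 x hx,
        hxu, hxv] at this
      exact this
    rintro (_ | _ | _ | _)
    · exact hκ0.trans (mul_zero _).symm
    · exact (mul_one _).symm
    · exact this.1
    · exact this.2
  choose X hX hX0 hXn using exists_of_labels i hF hh' (g := some 0) (g' := none) (by simp)
  set Q : Pt → P := fun p => if hp : p.2.2 ≠ 0 then offPoint i hp else X p.1 p.2.1 with hQ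
  have hQ1 : ∀ {p : Pt} (hp : p.2.2 ≠ 0), Q p = offPoint i hp := fun hp => dif_pos hp
  have hQ0 : ∀ {p : Pt}, p.2.2 = 0 → Q p = X p.1 p.2.1 := fun hp => dif_neg (not_not.2 hp)
  have hinc : ∀ p b, (planeDesign fun z => if z = 0 then κ 1 else f z).inc p b ↔
      F.inc (Q p) (extBlock i b) := by
    intro p b
    by_cases hp : p.2.2 ≠ 0
    · rw [hQ1 hp, inc_offPoint]
      rcases b with t | ⟨_ | m, a, c⟩
      · rfl
      · rfl
      · simp only [inc_pl, val, if_neg hp]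
    · push Not at hp
      rw [hQ0 hp]
      cases b with
      | vert t =>
        rw [inc_vert, hp]
        by_cases ht : t = 0
        · subst ht
          simp [extBlock_vert_zero, hX]
        · exact iff_of_false (Ne.symm ht) (not_inc_vert i hF (hX _ _) ht)
      | pl g a c =>
        rw [hh g _ (hX _ _), inc_pl, hp, mul_zero, add_zero, eq_comm]
        cases g with
        | none => rw [hXn]; rfl
        | some m => rw [hlin m _ (hX _ _), hX0, hXn, hκm m]; simp only [val, hp, if_true]
  have hbij : Function.Bijective Q := by
    refine ⟨fun p q hpq => ?_, fun x => ?_⟩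
    · exact eq_of_inc_iff fun b => by rw [hinc, hinc, hpq]
    · by_cases hx : F.inc x B
      · refine ⟨(h (some 0) x, h none x, 0), ?_⟩
        rw [hQ0 rfl]
        exact label_pair_injective i hF hh' (g := some 0) (g' := none) (by simp) (hX _ _) hx
          (hX0 _ _) (hXn _ _)
      · obtain ⟨p, hp, rfl⟩ := exists_offPoint i hx
        exact ⟨p, hQ1 hp⟩
  exact ⟨κ 1, ⟨Equiv.ofBijective Q hbij,
    Equiv.ofBijective _ ⟨extBlock_injective i, extBlock_surjective i⟩, hinc⟩,
    extBlock_vert_zero i⟩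

omit hF hrank [Finite P] [Finite β] in
theorem val_inv_smul {p : Pt} (hp : p.2.2 ≠ 0) (g : Option GF4) :
    val f g (p.1 * p.2.2⁻¹, p.2.1 * p.2.2⁻¹, p.2.2⁻¹) = val f g p * p.2.2⁻¹ := by
  have h1 : p.2.2⁻¹ * p.2.2⁻¹ = p.2.2 := by
    generalize p.2.2 = z at *; revert z; decide
  cases g with
  | none => rfl
  | some m =>
    simp only [val, hf _ hp, hf _ (inv_ne_zero hp)]
    linear_combination α * m * m * h1 - α * m * m * p.2.2 * mul_inv_cancel₀ hp

/-- The automorphism of the residual which exchanges rows and columns in each group. -/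
def residualSwap : Iso ((planeDesign f).residual (vert 0)) ((planeDesign f).residual (vert 0)) where
  onPoints := Function.Involutive.toPerm
    (fun p => ⟨(p.1.1 * p.1.2.2⁻¹, p.1.2.1 * p.1.2.2⁻¹, p.1.2.2⁻¹),
      fun h => inv_ne_zero p.2 h⟩) (fun ⟨⟨x, y, z⟩, hz⟩ => Subtype.ext (by
        have hz' : z ≠ 0 := hz
        simp [hz']))
  onBlocks := Function.Involutive.toPerm
    (fun b => ⟨match b.1 with | vert t => vert t⁻¹ | pl g a c => pl g c a, by
      obtain ⟨t | ⟨g, a, c⟩, h⟩ := b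
      · simpa using h
      · simp⟩)
    (fun ⟨b, h⟩ => Subtype.ext (by cases b <;> simp))
  inc_iff := by
    rintro ⟨p, hp⟩ ⟨t | ⟨g, a, c⟩, hb⟩
    · change p.2.2 = t ↔ p.2.2⁻¹ = t⁻¹
      rw [inv_inj]
    · change val f g p + a * p.2.2 = c ↔
        val f g (p.1 * p.2.2⁻¹, p.2.1 * p.2.2⁻¹, p.2.2⁻¹) + c * p.2.2⁻¹ = a
      have hp' : p.2.2 ≠ 0 := hp
      rw [val_inv_smul hf hp']
      refine eq_iff_eq_of_sub_eq (inv_ne_zero hp') ?_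
      linear_combination (-a) * mul_inv_cancel₀ hp' + (c * p.2.2⁻¹ - a) * two_eq_zero

include i in
/-- The designs in which the residual of `planeDesign f` at `z = 0` is linearly embeddable: the
function `f` can only be changed at `0`. -/
theorem exists_iso_of_linear_embedding :
    ∃ (κ : GF4) (j : Iso (planeDesign fun z => if z = 0 then κ else f z) F),
      j.onBlocks (vert 0) = B := by
  obtain ⟨h, hh⟩ := exists_line_labels i hF
  rcases all_columns_or_all_rows i hF hrank hf hh with hcol | hrow
  · exact exists_iso_of_columns i hF hrank hf hcol
  · refine exists_iso_of_columns ((residualSwap hf).trans i) hF hrank hf (h := h)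
      fun g x hx a c => ?_
    rw [← hrow g x hx c a, extBlock_of_ne _ pl_ne_vert, extBlock_of_ne _ pl_ne_vert]
    rfl

end Embedding

/-! ### Sets of points as binary numbers -/

/-- The elements of the field as a list. -/
def gf4List : List GF4 := [0, 1, om, om2]

/-- The points as a list. -/
def ptList : List Pt := gf4List.flatMap fun z => gf4List.flatMap fun y => gf4List.map fun x => (x, y, z)

/-- The position of a point in `ptList`. -/
def ptIndex (p : Pt) : ℕ := p.1.toNat + 4 * p.2.1.toNat + 16 * p.2.2.toNat

theorem getElem?_ptIndex : ∀ p : Pt, ptList[ptIndex p]? = some p := by decide +kernel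

theorem ptIndex_lt : ∀ p : Pt, ptIndex p < 64 := by decide +kernel

theorem ptIndex_injective : Function.Injective ptIndex := fun p q h => by
  have := getElem?_ptIndex p
  rw [h, getElem?_ptIndex] at this
  exact (Option.some.inj this).symm

/-- The number with binary digits `s p`. -/
def mask (s : Pt → Bool) : ℕ := ptList.foldr (fun p n => 2 * n + (s p).toNat) 0

theorem testBit_mask (s : Pt → Bool) (p : Pt) : (mask s).testBit (ptIndex p) = s p := by
  have key : ∀ (l : List Pt) (j : ℕ) (p : Pt), l[j]? = some p →
      (l.foldr (fun p n => 2 * n + (s p).toNat) 0).testBit j = s p := by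
    intro l
    induction l with
    | nil => simp
    | cons q l ih =>
      intro j p h
      rw [List.foldr_cons]
      cases j with
      | zero =>
        obtain rfl : q = p := by simpa using h
        rw [Nat.testBit_zero]
        cases s q <;> simp
      | succ j =>
        rw [Nat.testBit_succ, ← ih j p (by simpa using h)]
        congr 1
        cases s q
        · simp
        · simp; omega
  exact key _ _ _ (getElem?_ptIndex p)

/-- The binary word of a number. -/
def wd (n : ℕ) : Pt → ZMod 2 := fun p => if n.testBit (ptIndex p) then 1 else 0

theorem wd_zero : wd 0 = 0 := by
  funext p; simp [wd]

theorem wd_xor (a b : ℕ) : wd (a ^^^ b) = wd a + wd b := by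
  funext p
  simp only [wd, Nat.testBit_xor, Pi.add_apply]
  cases a.testBit (ptIndex p) <;> cases b.testBit (ptIndex p) <;> decide

/-! ### Binary codes by exhaustion -/

/-- The span of the words of a list of numbers. -/
def wdSpan (bs : List ℕ) : Submodule (ZMod 2) (Pt → ZMod 2) :=
  Submodule.span (ZMod 2) {w | ∃ b ∈ bs, w = wd b}

theorem wdSpan_cons (b : ℕ) (bs : List ℕ) :
    wdSpan (b :: bs) = Submodule.span (ZMod 2) (insert (wd b) {w | ∃ b ∈ bs, w = wd b}) := by
  rw [wdSpan]
  congr 1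
  ext w
  simp

/-- The sum of the words of a list selected by the binary digits of `t`, the first word by the
leading digit. -/
def wordAt : List ℕ → ℕ → ℕ
  | [], _ => 0
  | b :: bs, t => bif Nat.ble (2 ^ bs.length) t then Nat.xor b (wordAt bs (t - 2 ^ bs.length))
      else wordAt bs t

theorem wordAt_of_lt {b t : ℕ} {bs : List ℕ} (h : t < 2 ^ bs.length) :
    wordAt (b :: bs) t = wordAt bs t := by
  have : Nat.ble (2 ^ bs.length) t = false := by
    rw [Bool.eq_false_iff]
    exact fun h' => absurd (Nat.le_of_ble_eq_true h') (not_le.2 h)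
  simp [wordAt, this]

theorem wordAt_of_le {b t : ℕ} {bs : List ℕ} (h : 2 ^ bs.length ≤ t) :
    wordAt (b :: bs) t = b ^^^ wordAt bs (t - 2 ^ bs.length) := by
  have : Nat.ble (2 ^ bs.length) t = true := Nat.ble_eq_true_of_le h
  simp only [wordAt, this, cond_true]
  rfl

theorem wd_wordAt_mem : ∀ (bs : List ℕ) (t : ℕ), wd (wordAt bs t) ∈ wdSpan bs := by
  intro bs
  induction bs with
  | nil => intro t; rw [wordAt, wd_zero]; exact Submodule.zero_mem _
  | cons b bs ih =>
    intro t
    have hle : wdSpan bs ≤ wdSpan (b :: bs) :=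
      Submodule.span_mono fun w ⟨b, hb, hw⟩ => ⟨b, List.mem_cons_of_mem _ hb, hw⟩
    rcases lt_or_ge t (2 ^ bs.length) with h | h
    · rw [wordAt_of_lt h]
      exact hle (ih t)
    · rw [wordAt_of_le h, wd_xor]
      exact Submodule.add_mem _ (Submodule.subset_span ⟨b, List.mem_cons_self, rfl⟩) (hle (ih _))

theorem exists_wordAt : ∀ (bs : List ℕ), ∀ v ∈ wdSpan bs,
    ∃ t < 2 ^ bs.length, v = wd (wordAt bs t) := by
  have hc2 : ∀ c : ZMod 2, c = 0 ∨ c = 1 := by decide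
  intro bs
  induction bs with
  | nil =>
    intro v hv
    have hv0 : v = 0 := by simpa [wdSpan] using hv
    exact ⟨0, by simp, by rw [hv0, wordAt, wd_zero]⟩
  | cons b bs ih =>
    intro v hv
    rw [wdSpan_cons] at hv
    obtain ⟨c, u, hu, rfl⟩ := Submodule.mem_span_insert.1 hv
    obtain ⟨t, ht, rfl⟩ := ih u hu
    rw [List.length_cons, pow_succ]
    rcases hc2 c with rfl | rfl
    · exact ⟨t, by omega, by rw [zero_smul, zero_add, wordAt_of_lt ht]⟩
    · refine ⟨t + 2 ^ bs.length, by omega, ?_⟩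
      rw [one_smul, wordAt_of_le (Nat.le_add_left _ _), wd_xor, Nat.add_sub_cancel]

/-- The digits at the point `p` of all sums of words of a list, as the binary digits of one
number: digit `t` belongs to the sum selected by `t`. -/
def slice (p : Pt) : List ℕ → ℕ
  | [] => 0
  | b :: bs =>
    Nat.lor (slice p bs) (Nat.shiftLeft
      (bif b.testBit (ptIndex p) then Nat.xor (slice p bs) (2 ^ 2 ^ bs.length - 1) else slice p bs)
      (2 ^ bs.length))

theorem testBit_slice (p : Pt) : ∀ (bs : List ℕ) (t : ℕ),
    (slice p bs).testBit t = (decide (t < 2 ^ bs.length) && (wordAt bs t).testBit (ptIndex p)) := by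
  intro bs
  induction bs with
  | nil => intro t; simp [slice, wordAt]
  | cons b bs ih =>
    intro t
    have h1 : slice p (b :: bs) = slice p bs ||| ((bif b.testBit (ptIndex p) then
      slice p bs ^^^ (2 ^ 2 ^ bs.length - 1) else slice p bs) <<< 2 ^ bs.length) := rfl
    rw [h1, Nat.testBit_or, Nat.testBit_shiftLeft, ih, List.length_cons, pow_succ]
    rcases lt_or_ge t (2 ^ bs.length) with h | h
    · have h2 : t < 2 ^ bs.length * 2 := by omega
      simp [h, h2, wordAt_of_lt h]
    · have h3 : t < 2 ^ bs.length * 2 ↔ t - 2 ^ bs.length < 2 ^ bs.length := by omega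
      rw [wordAt_of_le h, Nat.testBit_xor]
      cases b.testBit (ptIndex p)
      · simp [h, not_lt.2 h, ih, h3]
      · simp only [cond_true, Nat.testBit_xor, Nat.testBit_two_pow_sub_one, ih, h3, h, not_lt.2 h]
        by_cases h4 : t - 2 ^ bs.length < 2 ^ bs.length <;> simp [h4]

/-- Addition of the digits of `c` to counters, the binary digits of which are stored in the numbers
of a list. -/
def addDigit : List ℕ → ℕ → List ℕ
  | [], c => bif Nat.beq c 0 then [] else [c]
  | a :: as, c => Nat.xor a c :: addDigit as (Nat.land a c)

/-- The value of the counter at `t`. -/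
def counter (t : ℕ) : List ℕ → ℕ
  | [] => 0
  | a :: as => (a.testBit t).toNat + 2 * counter t as

theorem counter_addDigit (t : ℕ) : ∀ (as : List ℕ) (c : ℕ),
    counter t (addDigit as c) = counter t as + (c.testBit t).toNat := by
  intro as
  induction as with
  | nil =>
    intro c
    rw [addDigit]
    cases h : Nat.beq c 0
    · simp [counter]
    · rw [Nat.eq_of_beq_eq_true h]; simp [counter]
  | cons a as ih =>
    intro c
    have h1 : addDigit (a :: as) c = (a ^^^ c) :: addDigit as (a &&& c) := rfl
    rw [h1, counter, ih, counter, Nat.testBit_xor, Nat.testBit_and]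
    cases a.testBit t <;> cases c.testBit t <;> simp <;> omega

/-- The weights of all sums of words of a list. -/
def weights (bs : List ℕ) : List ℕ := ptList.foldl (fun cs p => addDigit cs (slice p bs)) []

theorem ncard_support_wd (n : ℕ) :
    (Function.support (wd n)).ncard = (ptList.map fun p => (n.testBit (ptIndex p)).toNat).sum := by
  have h1 : Function.support (wd n) = {p | n.testBit (ptIndex p) = true} := by
    ext p; simp [wd]
  have h2 : (Finset.univ : Finset Pt) = ptList.toFinset := by decide +kernel
  rw [h1, ncard_setOf_eq_card_filter, Finset.card_filter, h2,
    List.sum_toFinset _ (by decide +kernel)]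
  congr 2
  funext p
  cases n.testBit (ptIndex p) <;> simp

theorem counter_weights (bs : List ℕ) {t : ℕ} (ht : t < 2 ^ bs.length) :
    counter t (weights bs) = (Function.support (wd (wordAt bs t))).ncard := by
  have key : ∀ (l : List Pt) (cs : List ℕ),
      counter t (l.foldl (fun cs p => addDigit cs (slice p bs)) cs) =
        counter t cs + (l.map fun p => ((wordAt bs t).testBit (ptIndex p)).toNat).sum := by
    intro l
    induction l with
    | nil => simp
    | cons p l ih =>
      intro cs
      rw [List.foldl_cons, ih, counter_addDigit, testBit_slice, decide_eq_true ht, Bool.true_and,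
        List.map_cons, List.sum_cons, add_assoc]
  rw [weights, key, ncard_support_wd, counter, zero_add]

/-- The positions at which counters of seven digits exceed `16`. -/
def heavy : List ℕ → ℕ
  | [c₀, c₁, c₂, c₃, c₄, c₅, c₆] =>
    Nat.lor c₆ (Nat.lor c₅ (Nat.land c₄ (Nat.lor c₀ (Nat.lor c₁ (Nat.lor c₂ c₃)))))
  | _ => 0

theorem lt_counter_of_heavy {cs : List ℕ} {t : ℕ} (h : (heavy cs).testBit t = true) :
    16 < counter t cs := by
  rcases cs with _ | ⟨c₀, _ | ⟨c₁, _ | ⟨c₂, _ | ⟨c₃, _ | ⟨c₄, _ | ⟨c₅, _ | ⟨c₆, _ | ⟨_, _⟩⟩⟩⟩⟩⟩⟩⟩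
  case cons.cons.cons.cons.cons.cons.cons.nil =>
    have h1 : heavy [c₀, c₁, c₂, c₃, c₄, c₅, c₆] =
      c₆ ||| (c₅ ||| (c₄ &&& (c₀ ||| (c₁ ||| (c₂ ||| c₃))))) := rfl
    rw [h1] at h
    simp only [Nat.testBit_or, Nat.testBit_and] at h
    simp only [counter]
    revert h
    generalize c₀.testBit t = a₀; generalize c₁.testBit t = a₁; generalize c₂.testBit t = a₂
    generalize c₃.testBit t = a₃; generalize c₄.testBit t = a₄; generalize c₅.testBit t = a₅
    generalize c₆.testBit t = a₆
    revert a₀ a₁ a₂ a₃ a₄ a₅ a₆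
    decide
  all_goals simp [heavy] at h

/-- The selection of a word of the span by elimination, for a list in triangular form. -/
def selector : List (ℕ × Pt) → ℕ → ℕ
  | [], _ => 0
  | (b, p) :: l, n =>
    bif n.testBit (ptIndex p) then 2 ^ l.length + selector l (Nat.xor n b) else selector l n

/-- Whether all words of a list are sums of words of a triangular list, and all the other nonzero
sums have weight more than `16`. -/
def lightCheck (l : List (ℕ × Pt)) (ms : List ℕ) : Bool :=
  (ms.all fun m => Nat.beq (wordAt (l.map Prod.fst) (selector l m)) m) &&
    Nat.beq (Nat.lor (heavy (weights (l.map Prod.fst)))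
      (ms.foldr (fun m n => Nat.lor (2 ^ selector l m) n) 1)) (2 ^ 2 ^ l.length - 1)

theorem wd_mem_of_lightCheck {l : List (ℕ × Pt)} {ms : List ℕ} (h : lightCheck l ms = true) {m : ℕ}
    (hm : m ∈ ms) : wd m ∈ wdSpan (l.map Prod.fst) := by
  simp only [lightCheck, Bool.and_eq_true, List.all_eq_true] at h
  rw [← Nat.eq_of_beq_eq_true (h.1 m hm)]
  exact wd_wordAt_mem _ _

theorem light_of_lightCheck {l : List (ℕ × Pt)} {ms : List ℕ} (h : lightCheck l ms = true)
    {v : Pt → ZMod 2} (hv : v ∈ wdSpan (l.map Prod.fst)) :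
    16 < (Function.support v).ncard ∨ v = 0 ∨ ∃ m ∈ ms, v = wd m := by
  simp only [lightCheck, Bool.and_eq_true, List.all_eq_true] at h
  obtain ⟨t, ht, rfl⟩ := exists_wordAt _ v hv
  have hlen : (l.map Prod.fst).length = l.length := List.length_map _
  have hbit := congrArg (fun n => n.testBit t) (Nat.eq_of_beq_eq_true h.2)
  rw [hlen] at ht
  have hor : ∀ a b, Nat.lor a b = a ||| b := fun _ _ => rfl
  simp only [Nat.testBit_two_pow_sub_one, decide_eq_true ht, hor, Nat.testBit_or,
    Bool.or_eq_true] at hbit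
  rcases hbit with hbit | hbit
  · left
    rw [← counter_weights _ (by rwa [hlen])]
    exact lt_counter_of_heavy hbit
  · right
    have key : ∀ ms' : List ℕ, (ms'.foldr (fun m n => 2 ^ selector l m ||| n) 1).testBit t = true →
        t = 0 ∨ ∃ m ∈ ms', t = selector l m := by
      intro ms'
      induction ms' with
      | nil =>
        intro h
        left
        simpa [Nat.testBit_one_eq_true_iff_self_eq_zero] using h
      | cons m ms' ih =>
        intro h
        rw [List.foldr_cons, Nat.testBit_or, Bool.or_eq_true, Nat.testBit_two_pow] at h
        rcases h with h | h
        · exact .inr ⟨m, List.mem_cons_self, (of_decide_eq_true h).symm⟩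
        · rcases ih h with h | ⟨m', hm', h⟩
          · exact .inl h
          · exact .inr ⟨m', List.mem_cons_of_mem _ hm', h⟩
    rcases key ms hbit with rfl | ⟨m, hm, rfl⟩
    · left
      have : ∀ bs, wordAt bs 0 = 0 := by
        intro bs
        induction bs with
        | nil => rfl
        | cons b bs ih => rw [wordAt_of_lt (by positivity), ih]
      rw [this, wd_zero]
    · exact .inr ⟨m, hm, by rw [Nat.eq_of_beq_eq_true (h.1 m hm)]⟩

/-- Each number of the list has the digit `1` at its position, and the later ones have
the digit `0` there. -/
def triangular : List (ℕ × Pt) → Bool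
  | [] => true
  | (b, p) :: l => b.testBit (ptIndex p) && (l.all fun s => !s.1.testBit (ptIndex p)) && triangular l

theorem finrank_of_triangular : ∀ {l : List (ℕ × Pt)}, triangular l = true →
    Module.finrank (ZMod 2) (wdSpan (l.map Prod.fst)) = l.length := by
  intro l
  induction l with
  | nil =>
    intro _
    have : wdSpan (([] : List (ℕ × Pt)).map Prod.fst) = ⊥ := by simp [wdSpan]
    rw [this, finrank_bot]; rfl
  | cons s l ih =>
    obtain ⟨b, p⟩ := s
    intro h
    simp only [triangular, Bool.and_eq_true, List.all_eq_true, Bool.not_eq_true'] at h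
    have hnot : wd b ∉ wdSpan (l.map Prod.fst) := by
      intro hb
      have hle : wdSpan (l.map Prod.fst) ≤ LinearMap.ker (LinearMap.proj p : (Pt → ZMod 2) →ₗ[ZMod 2] _) := by
        refine Submodule.span_le.2 ?_
        rintro _ ⟨b', hb', rfl⟩
        obtain ⟨s, hs, rfl⟩ := List.mem_map.1 hb'
        simp [wd, h.1.2 s hs]
      have := hle hb
      simp [wd, h.1.1] at this
    rw [List.map_cons, wdSpan_cons, Submodule.span_insert]
    have h1 := Submodule.finrank_sup_add_finrank_inf_eq (Submodule.span (ZMod 2) {wd b})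
      (wdSpan (l.map Prod.fst))
    have hb0 : wd b ≠ 0 := fun h0 => hnot (by rw [h0]; exact Submodule.zero_mem _)
    have hdisj : Submodule.span (ZMod 2) {wd b} ⊓ wdSpan (l.map Prod.fst) = ⊥ := by
      rw [inf_comm, ← disjoint_iff, Submodule.disjoint_span_singleton' hb0]
      exact hnot
    rw [hdisj, finrank_bot, add_zero, finrank_span_singleton hb0, ih h.2] at h1
    rw [List.length_cons, add_comm, ← h1]
    rfl

/-! ### Structures whose blocks are the lightest codewords -/

namespace IncStruct

variable {P β Q γ : Type*} {D : IncStruct P β} {E : IncStruct Q γ}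

/-- The binary code of `D` has dimension `16`, its blocks have `16` points, and all the nonzero
codewords of weight at most `16` are incidence vectors of blocks. -/
structure HasLightCode (D : IncStruct P β) : Prop where
  finrank_code : Module.finrank (ZMod 2) (D.code 2) = 16
  ncard_pts : ∀ b, (D.pts b).ncard = 16
  light : ∀ w ∈ D.code 2, (Function.support w).ncard ≤ 16 → w ≠ 0 →
    ∃ b, w = fun x => D.incMatrix (ZMod 2) x b

theorem support_incMatrix (D : IncStruct P β) (b : β) :
    (Function.support fun x => D.incMatrix (ZMod 2) x b) = D.pts b := by
  classical
  ext x
  by_cases h : D.inc x b <;> simp [incMatrix, pts, h]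

theorem Iso.hasLightCode (i : Iso D E) (h : D.HasLightCode) : E.HasLightCode where
  finrank_code := by rw [i.code_eq, LinearEquiv.finrank_map_eq, h.finrank_code]
  ncard_pts b := by
    obtain ⟨b, rfl⟩ := i.onBlocks.surjective b
    rw [i.pts_onBlocks, Set.ncard_image_of_injective _ i.onPoints.injective, h.ncard_pts]
  light w hw hle hw0 := by
    rw [i.code_eq] at hw
    obtain ⟨u, hu, rfl⟩ := hw
    have hsupp : (Function.support ((LinearEquiv.funCongrLeft (ZMod 2) (ZMod 2)
        i.onPoints.symm).toLinearMap u)) = i.onPoints '' Function.support u := by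
      ext x
      obtain ⟨x, rfl⟩ := i.onPoints.surjective x
      simp [LinearEquiv.funCongrLeft_apply, LinearMap.funLeft_apply]
    rw [hsupp, Set.ncard_image_of_injective _ i.onPoints.injective] at hle
    obtain ⟨b, rfl⟩ := h.light u hu hle (by rintro rfl; exact hw0 (map_zero _))
    refine ⟨i.onBlocks b, ?_⟩
    funext x
    obtain ⟨x, rfl⟩ := i.onPoints.surjective x
    change D.incMatrix (ZMod 2) (i.onPoints.symm (i.onPoints x)) b = _
    rw [Equiv.symm_apply_apply]
    by_cases hx : D.inc x b <;> simp [incMatrix, ← i.inc_iff, hx]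

namespace HasLightCode

theorem pRank [Finite β] (h : D.HasLightCode) : D.pRank 2 = 16 := by
  rw [pRank_eq_finrank_code, h.finrank_code]

/-- The residual structures are linearly embedded: a codeword which vanishes off a block is
light. -/
theorem pRank_residual [Finite P] [Finite β] (h : D.HasLightCode) (B : β) :
    D.pRank 2 = (D.residual B).pRank 2 + 1 := by
  have hB : ∃ x, D.inc x B := by
    have : (D.pts B).ncard ≠ 0 := by rw [h.ncard_pts]; norm_num
    exact Set.nonempty_of_ncard_ne_zero this
  rw [pRank_eq_residual_add_one_iff D hB]
  intro w hw hw0 x y hx hy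
  by_cases hz : w = 0
  · rw [hz]; rfl
  have hsub : Function.support w ⊆ D.pts B := fun x hx => by
    by_contra hxB
    exact hx (hw0 x hxB)
  obtain ⟨b, hb⟩ := h.light w hw ((Set.ncard_le_ncard hsub).trans_eq (h.ncard_pts B)) hz
  have hbB : D.pts b = D.pts B := by
    rw [hb, support_incMatrix] at hsub
    exact Set.eq_of_subset_of_ncard_le hsub (by rw [h.ncard_pts, h.ncard_pts])
  have hinc : ∀ x, D.inc x B → w x = 1 := fun x hx => by
    have : D.inc x b := (Set.ext_iff.1 hbB x).2 hx
    simp [hb, incMatrix, this]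
  rw [hinc x hx, hinc y hy]

theorem minSupports_eq (h : D.HasLightCode) [Finite P] [Nonempty β] :
    minSupports (D.code 2) = Set.range D.pts := by
  have hmin : ∀ c ∈ D.code 2, c ≠ 0 → 16 ≤ (Function.support c).ncard := fun c hc hc0 => by
    by_contra! hlt
    obtain ⟨b, hb⟩ := h.light c hc hlt.le hc0
    rw [hb, support_incMatrix, h.ncard_pts] at hlt
    exact lt_irrefl _ hlt
  have hcol : ∀ b, (fun x => D.incMatrix (ZMod 2) x b) ≠ 0 := fun b hb => by
    have := support_incMatrix D b
    rw [hb, Function.support_zero] at this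
    have h16 := h.ncard_pts b
    rw [← this, Set.ncard_empty] at h16
    norm_num at h16
  ext s
  constructor
  · rintro ⟨w, hw, hw0, rfl, hle⟩
    obtain ⟨b₀⟩ := ‹Nonempty β›
    have h16 := hle _ (col_mem_code D 2 b₀) (hcol b₀)
    rw [support_incMatrix, h.ncard_pts] at h16
    obtain ⟨b, rfl⟩ := h.light w hw h16 hw0
    exact ⟨b, (support_incMatrix D b).symm⟩
  · rintro ⟨b, rfl⟩
    refine ⟨_, col_mem_code D 2 b, hcol b, support_incMatrix D b, fun c hc hc0 => ?_⟩
    rw [support_incMatrix, h.ncard_pts]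
    exact hmin c hc hc0

theorem isomorphic_minWordDesign (h : D.HasLightCode) [Finite P] [Nonempty β]
    (hinj : Function.Injective D.pts) : D.Isomorphic (minWordDesign (D.code 2)) := by
  refine isomorphic_of_simple hinj (E := ofSets _) (fun s t hst => Subtype.ext hst)
    (Equiv.refl P) (fun b => ?_) fun s => ?_
  · refine ⟨⟨D.pts b, ?_⟩, by simp; rfl⟩
    rw [h.minSupports_eq]
    exact ⟨b, rfl⟩
  · obtain ⟨b, hb⟩ := h.minSupports_eq.subset s.2
    exact ⟨b, by simp [hb]; rfl⟩

end HasLightCode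

end IncStruct

/-! ### The three designs -/

/-- The functions `α z²`, with the value at `0` changed to `κ`. -/
def bump (κ α : GF4) : GF4 → GF4 := fun z => if z = 0 then κ else α * (z * z)

/-- The number with the incidence vector of a block as its binary digits. -/
def blockMask (f : GF4 → GF4) (b : Bl) : ℕ := mask fun p => decide ((planeDesign f).inc p b)

theorem wd_blockMask (f : GF4 → GF4) (b : Bl) :
    wd (blockMask f b) = fun x => (planeDesign f).incMatrix (ZMod 2) x b := by
  funext p
  by_cases h : (planeDesign f).inc p b <;> simp [wd, blockMask, testBit_mask, incMatrix, h]

/-- The blocks as a list. -/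
def blList : List Bl := gf4List.map vert ++
  [none, some 0, some 1, some om, some om2].flatMap fun g =>
    gf4List.flatMap fun a => gf4List.map (pl g a)

theorem mem_blList : ∀ b, b ∈ blList := by decide +kernel

/-- The subset of the blocks of a design of a function that forms a symmetric net. -/
def planeNet (f : GF4 → GF4) : IncStruct Pt (GF4 × GF4 × GF4) :=
  ⟨fun p b => (planeDesign f).inc p (pl (some b.1) b.2.1 b.2.2)⟩

theorem code_planeNet_le (f : GF4 → GF4) : (planeNet f).code 2 ≤ (planeDesign f).code 2 := by
  refine Submodule.span_le.2 ?_
  rintro _ ⟨b, rfl⟩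
  exact col_mem_code (planeDesign f) 2 (pl (some b.1) b.2.1 b.2.2)

section Basis

variable {f : GF4 → GF4} {l : List ((GF4 × GF4 × GF4) × Pt)}

/-- The words of a list of blocks of the net, with a point on each of them. -/
def netWords (f : GF4 → GF4) (l : List ((GF4 × GF4 × GF4) × Pt)) : List (ℕ × Pt) :=
  l.map fun s => (blockMask f (pl (some s.1.1) s.1.2.1 s.1.2.2), s.2)

theorem code_eq_of_lightCheck (h : lightCheck (netWords f l) (blList.map (blockMask f)) = true) :
    (planeNet f).code 2 = (planeDesign f).code 2 ∧
      (planeDesign f).code 2 = wdSpan ((netWords f l).map Prod.fst) := by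
  have h1 : (planeDesign f).code 2 ≤ wdSpan ((netWords f l).map Prod.fst) := by
    refine Submodule.span_le.2 ?_
    rintro _ ⟨b, rfl⟩
    have := wd_mem_of_lightCheck h (List.mem_map_of_mem (f := blockMask f) (mem_blList b))
    rwa [wd_blockMask] at this
  have h2 : wdSpan ((netWords f l).map Prod.fst) ≤ (planeNet f).code 2 := by
    refine Submodule.span_le.2 ?_
    rintro _ ⟨n, hn, rfl⟩
    simp only [netWords, List.map_map, List.mem_map, Function.comp_apply] at hn
    obtain ⟨s, -, rfl⟩ := hn
    rw [wd_blockMask]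
    exact col_mem_code (planeNet f) 2 s.1
  have h3 := code_planeNet_le f
  exact ⟨le_antisymm h3 (h1.trans h2), le_antisymm h1 (h2.trans h3)⟩

theorem hasLightCode_of_lightCheck
    (h : lightCheck (netWords f l) (blList.map (blockMask f)) = true)
    (ht : triangular (netWords f l) = true) (hl : l.length = 16) :
    (planeDesign f).HasLightCode where
  finrank_code := by
    rw [(code_eq_of_lightCheck h).2, finrank_of_triangular ht, netWords, List.length_map, hl]
  ncard_pts := planeDesign.ncard_pts
  light w hw hle hw0 := by
    rw [(code_eq_of_lightCheck h).2] at hw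
    rcases light_of_lightCheck h hw with h1 | h1 | ⟨m, hm, rfl⟩
    · exact absurd hle (not_le.2 h1)
    · exact (hw0 h1).elim
    · obtain ⟨b, -, rfl⟩ := List.mem_map.1 hm
      exact ⟨b, wd_blockMask f b⟩

end Basis

/-- Blocks of the net which form a basis of the code of the design of `0`, in triangular form. -/
def basis00 : List ((GF4 × GF4 × GF4) × Pt) :=
  [((1, om2, 1), (om2, om, 0)), ((1, om, 0), (om2, 0, om)), ((om, 1, om2), (1, om2, om2)),
    ((om2, om2, om2), (0, om2, om)), ((om2, 0, 1), (1, 0, 0)), ((0, 1, 0), (1, om2, 1)),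
    ((om, om, om2), (1, 0, 1)), ((1, om2, om2), (om2, 0, 0)), ((om, 1, om), (om2, om, om)),
    ((0, om2, 0), (0, om2, 0)), ((0, om, om), (0, om, 1)), ((1, 1, om), (0, om, 0)),
    ((1, 0, 0), (1, 1, 0)), ((om2, 0, 0), (0, 0, 0)), ((0, 0, om), (om, 1, 0)),
    ((om, 0, om), (om, 0, 0))]

/-- Blocks of the net which form a basis of the code of the design of the function `δ₀`. -/
def basis10 : List ((GF4 × GF4 × GF4) × Pt) :=
  [((0, om, om2), (om, 1, om2)), ((om2, om, om), (om2, 0, om2)), ((0, 1, om), (om, 1, 0)),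
    ((om2, 0, om), (om2, om, 1)), ((om, 0, 1), (om2, om2, 0)), ((0, om, 0), (om, 1, 1)),
    ((0, 0, 1), (1, om, 0)), ((om2, 0, 0), (1, om, 1)), ((1, om, 0), (om2, 0, om)),
    ((1, 1, om2), (om, 0, 1)), ((om2, om, 1), (1, om2, 0)), ((om, 1, om), (om2, 1, 0)),
    ((0, 0, 0), (0, 0, 0)), ((om, om2, 0), (om2, 0, 0)), ((om2, om2, 0), (om, 0, 0)),
    ((1, 0, 0), (1, 0, 0))]

/-- Blocks of the net which form a basis of the code of the design of the function `z²`. -/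
def basis01 : List ((GF4 × GF4 × GF4) × Pt) :=
  [((om2, om, 0), (om, 0, om)), ((1, om, 0), (om, 1, om2)), ((1, 0, om2), (0, om, 1)),
    ((0, 1, om2), (0, om, om2)), ((om2, om2, 1), (om, om2, 1)), ((0, 0, 1), (1, 0, 1)),
    ((0, 0, om2), (om2, om2, om)), ((1, 0, om), (1, om2, 0)), ((om2, om, om), (om2, om, 0)),
    ((om, om2, om), (0, 1, 0)), ((1, om, om2), (0, om2, 0)), ((om2, 1, 0), (om2, 1, 0)),
    ((1, 1, 0), (0, 0, 0)), ((om, 0, om2), (om2, 0, 0)), ((om2, 0, 1), (1, 0, 0)),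
    ((0, 1, om), (om, 0, 0))]

theorem lightCheck_basis00 :
    lightCheck (netWords (bump 0 0) basis00) (blList.map (blockMask (bump 0 0))) = true := by
  decide +kernel

theorem lightCheck_basis10 :
    lightCheck (netWords (bump 1 0) basis10) (blList.map (blockMask (bump 1 0))) = true := by
  decide +kernel

theorem lightCheck_basis01 :
    lightCheck (netWords (bump 0 1) basis01) (blList.map (blockMask (bump 0 1))) = true := by
  decide +kernel

theorem hasLightCode_bump00 : (planeDesign (bump 0 0)).HasLightCode :=
  hasLightCode_of_lightCheck lightCheck_basis00 (by decide +kernel) rfl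

theorem hasLightCode_bump10 : (planeDesign (bump 1 0)).HasLightCode :=
  hasLightCode_of_lightCheck lightCheck_basis10 (by decide +kernel) rfl

theorem hasLightCode_bump01 : (planeDesign (bump 0 1)).HasLightCode :=
  hasLightCode_of_lightCheck lightCheck_basis01 (by decide +kernel) rfl

/-! ### The nets -/

namespace planeNet

variable {f : GF4 → GF4}

theorem inc_iff {p : Pt} {b : GF4 × GF4 × GF4} :
    (planeNet f).inc p b ↔ p.1 + b.1 * p.2.1 + f p.2.2 * (b.1 * b.1) + b.2.1 * p.2.2 = b.2.2 :=
  Iff.rfl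

theorem ncard_blocks (p : Pt) : {b | (planeNet f).inc p b}.ncard = 16 := by
  have : {b | (planeNet f).inc p b} = Set.range fun q : GF4 × GF4 =>
      (q.1, q.2, p.1 + q.1 * p.2.1 + f p.2.2 * (q.1 * q.1) + q.2 * p.2.2) := by
    ext ⟨m, a, c⟩
    simp only [Set.mem_ofPred_eq, inc_iff, Set.mem_range, Prod.mk.injEq, Prod.exists]
    constructor
    · intro h; exact ⟨m, a, rfl, rfl, h⟩
    · rintro ⟨_, _, rfl, rfl, h⟩; exact h
  rw [this, ← Set.image_univ, Set.ncard_image_of_injective, Set.ncard_univ, Nat.card_prod,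
    GF4.natCard]
  rintro ⟨m, a⟩ ⟨m', a'⟩ h
  simp only [Prod.mk.injEq] at h
  exact Prod.ext h.1 h.2.1

theorem ncard_setOf_eq_one_of_balanced {P β : Type*} {D : IncStruct P β} {k : ℕ}
    (h : ∀ x, {b | D.inc x b}.ncard = k) (s : Finset P) (hs : s.card = 1) :
    {b | ∀ x ∈ s, D.inc x b}.ncard = k := by
  obtain ⟨x, rfl⟩ := Finset.card_eq_one.1 hs
  simpa using h x

/-- Nonparallel blocks of the net meet in four points. -/
theorem ncard_inter {m a c m' a' c' : GF4} (h : (m, a) ≠ (m', a')) :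
    ((planeNet f).pts (m, a, c) ∩ (planeNet f).pts (m', a', c')).ncard = 4 := by
  -- On each plane `z = t` the two equations are solved for the two coordinates if `m ≠ m'`; if
  -- `m = m'`, they determine `t`.
  by_cases hm : m = m'
  · subst hm
    have ha : a + a' ≠ 0 := fun h0 => h (by rw [add_eq_zero_iff.1 h0])
    have : (planeNet f).pts (m, a, c) ∩ (planeNet f).pts (m, a', c') = Set.range fun y =>
        (c + m * y + f ((c + c') * (a + a')⁻¹) * (m * m) + a * ((c + c') * (a + a')⁻¹), y,
          (c + c') * (a + a')⁻¹) := by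
      ext ⟨x, y, z⟩
      simp only [pts, Set.mem_inter_iff, Set.mem_ofPred_eq, inc_iff, Set.mem_range, Prod.mk.injEq]
      constructor
      · rintro ⟨h1, h2⟩
        have hz : z = (c + c') * (a + a')⁻¹ := by
          rw [eq_mul_inv_iff_mul_eq₀ ha]
          linear_combination h1 + h2 - (x + m * y + f z * (m * m)) * two_eq_zero
        refine ⟨y, ?_, rfl, hz.symm⟩
        rw [← hz]
        linear_combination -h1 + (m * y + f z * (m * m) + a * z) * two_eq_zero
      · rintro ⟨y, hx, rfl, hz⟩
        rw [hz] at hx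
        have hz' : z * (a + a') = c + c' := by rw [← hz, inv_mul_cancel_right₀ ha]
        constructor
        · linear_combination -hx + (m * y + f z * (m * m) + a * z) * two_eq_zero
        · linear_combination -hx + hz' + (m * y + f z * (m * m) + c) * two_eq_zero
    rw [this, ← Set.image_univ, Set.ncard_image_of_injective _ fun y y' h =>
      (Prod.mk.inj (Prod.mk.inj h).2).1, Set.ncard_univ, GF4.natCard]
  · have hm' : m + m' ≠ 0 := fun h0 => hm (add_eq_zero_iff.1 h0)
    have : ∀ t, ∃ x y, ∀ x' y', ((planeNet f).inc (x', y', t) (m, a, c) ∧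
        (planeNet f).inc (x', y', t) (m', a', c')) ↔ x' = x ∧ y' = y := by
      intro t
      obtain ⟨y, hy'⟩ : ∃ y, y * (m + m') = c + c' + f t * (m * m + m' * m') + (a + a') * t :=
        ⟨_, inv_mul_cancel_right₀ hm' _⟩
      refine ⟨c + m * y + f t * (m * m) + a * t, y, fun x' y' => ?_⟩
      simp only [inc_iff]
      constructor
      · rintro ⟨h1, h2⟩
        have hyy : y' = y := by
          apply mul_right_cancel₀ hm'
          rw [hy']
          linear_combination h1 + h2 - (x' + f t * (m * m + m' * m') + (a + a') * t) * two_eq_zero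
        subst hyy
        refine ⟨?_, rfl⟩
        linear_combination h1 - (m * y' + f t * (m * m) + a * t) * two_eq_zero
      · rintro ⟨hx, hy⟩
        rw [hx, hy]
        constructor
        · linear_combination (m * y + f t * (m * m) + a * t) * two_eq_zero
        · linear_combination hy' + (f t * (m * m + m' * m') + (a + a') * t + c) * two_eq_zero
    choose X Y hXY using this
    have : (planeNet f).pts (m, a, c) ∩ (planeNet f).pts (m', a', c') =
        Set.range fun t => (X t, Y t, t) := by
      ext ⟨x, y, z⟩
      have := hXY z x y
      simp only [pts, Set.mem_inter_iff, Set.mem_ofPred_eq, Set.mem_range, Prod.mk.injEq]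
      rw [this]
      constructor
      · rintro ⟨rfl, rfl⟩; exact ⟨z, rfl, rfl, rfl⟩
      · rintro ⟨z', h1, h2, rfl⟩; exact ⟨h1.symm, h2.symm⟩
    rw [this, ← Set.image_univ, Set.ncard_image_of_injective _ fun y y' h =>
      (Prod.mk.inj (Prod.mk.inj h).2).2, Set.ncard_univ, GF4.natCard]

/-- Points of different dual classes are joined by four blocks. -/
theorem ncard_joining {x y z x' y' z' : GF4} (h : (y, z) ≠ (y', z')) :
    ((planeNet f).dual.pts (x, y, z) ∩ (planeNet f).dual.pts (x', y', z')).ncard = 4 := by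
  by_cases hz : z = z'
  · subst hz
    have hy : y + y' ≠ 0 := fun h0 => h (by rw [add_eq_zero_iff.1 h0])
    have : (planeNet f).dual.pts (x, y, z) ∩ (planeNet f).dual.pts (x', y', z) =
        Set.range fun a => ((x + x') * (y + y')⁻¹, a, x + (x + x') * (y + y')⁻¹ * y +
          f z * ((x + x') * (y + y')⁻¹ * ((x + x') * (y + y')⁻¹)) + a * z) := by
      ext ⟨m, a, c⟩
      simp only [pts, dual, Set.mem_inter_iff, Set.mem_ofPred_eq, inc_iff, Set.mem_range,
        Prod.mk.injEq]
      constructor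
      · rintro ⟨h1, h2⟩
        have hm : m = (x + x') * (y + y')⁻¹ := by
          rw [eq_mul_inv_iff_mul_eq₀ hy]
          linear_combination h1 + h2 + (c - x - x' - f z * (m * m) - a * z) * two_eq_zero
        refine ⟨a, hm.symm, rfl, ?_⟩
        rw [← hm, h1]
      · rintro ⟨a, hm, rfl, hc⟩
        rw [hm] at hc
        have hm' : m * (y + y') = x + x' := by rw [← hm, inv_mul_cancel_right₀ hy]
        refine ⟨hc, ?_⟩
        linear_combination hc + hm' + (x' - m * y) * two_eq_zero
    rw [this, ← Set.image_univ, Set.ncard_image_of_injective _ fun y y' h =>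
      (Prod.mk.inj (Prod.mk.inj h).2).1, Set.ncard_univ, GF4.natCard]
  · have hz' : z + z' ≠ 0 := fun h0 => hz (add_eq_zero_iff.1 h0)
    have : ∀ m, ∃ a c, ∀ a' c', ((planeNet f).inc (x, y, z) (m, a', c') ∧
        (planeNet f).inc (x', y', z') (m, a', c')) ↔ a' = a ∧ c' = c := by
      intro m
      obtain ⟨a, ha'⟩ : ∃ a, a * (z + z') = x + x' + m * (y + y') + (f z + f z') * (m * m) :=
        ⟨_, inv_mul_cancel_right₀ hz' _⟩
      refine ⟨a, x + m * y + f z * (m * m) + a * z, fun a' c' => ?_⟩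
      simp only [inc_iff]
      constructor
      · rintro ⟨h1, h2⟩
        have haa : a' = a := by
          apply mul_right_cancel₀ hz'
          rw [ha']
          linear_combination h1 + h2 + (c' - x - x' - m * (y + y') -
            (f z + f z') * (m * m)) * two_eq_zero
        subst haa
        exact ⟨rfl, h1.symm⟩
      · rintro ⟨ha, hc⟩
        rw [ha, hc]
        refine ⟨rfl, ?_⟩
        linear_combination ha' + (x' + m * y' + f z' * (m * m) - a * z) * two_eq_zero
    choose A C hAC using this
    have : (planeNet f).dual.pts (x, y, z) ∩ (planeNet f).dual.pts (x', y', z') =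
        Set.range fun m => (m, A m, C m) := by
      ext ⟨m, a, c⟩
      have := hAC m a c
      simp only [pts, dual, Set.mem_inter_iff, Set.mem_ofPred_eq, Set.mem_range, Prod.mk.injEq]
      rw [this]
      constructor
      · rintro ⟨rfl, rfl⟩; exact ⟨m, rfl, rfl, rfl⟩
      · rintro ⟨z', rfl, h1, h2⟩; exact ⟨h1.symm, h2.symm⟩
    rw [this, ← Set.image_univ, Set.ncard_image_of_injective _ fun y y' h =>
      (Prod.mk.inj h).1, Set.ncard_univ, GF4.natCard]

theorem ncard_pts (b : GF4 × GF4 × GF4) : ((planeNet f).pts b).ncard = 16 :=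
  planeDesign.ncard_pts (f := f) (pl (some b.1) b.2.1 b.2.2)

theorem isSymmetricNet (f : GF4 → GF4) : (planeNet f).IsSymmetricNet 4 4 := by
  have h64 : Nat.card (GF4 × GF4 × GF4) = 64 := by simp only [Nat.card_prod, GF4.natCard]
  have h16 : Nat.card (GF4 × GF4) = 16 := by simp only [Nat.card_prod, GF4.natCard]
  constructor
  · refine ⟨⟨by norm_num, by norm_num, h64, ncard_pts,
      ncard_setOf_eq_one_of_balanced ncard_blocks⟩, _,
      isResolution_of_fibers (fun b : GF4 × GF4 × GF4 => (b.1, b.2.1)) (fun q => ⟨(q.1, q.2, 0), rfl⟩)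
        h16 (fun q => ?_) ?_, ?_⟩
    · have : {b : GF4 × GF4 × GF4 | (b.1, b.2.1) = q} = Set.range fun c => (q.1, q.2, c) := by
        ext ⟨m, a, c⟩
        simp [Prod.ext_iff, eq_comm]
      rw [this, ← Set.image_univ, Set.ncard_image_of_injective _ fun y y' h =>
        (Prod.mk.inj (Prod.mk.inj h).2).2, Set.ncard_univ, GF4.natCard]
    · rintro ⟨m, a, c⟩ ⟨m', a', c'⟩ h hne p h1 h2
      obtain ⟨rfl, rfl⟩ := Prod.mk.inj h
      simp only [inc_iff] at h1 h2
      exact hne (by rw [← h1, ← h2])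
    · rintro _ ⟨q, rfl⟩ _ ⟨q', rfl⟩ hne ⟨m, a, c⟩ h ⟨m', a', c'⟩ h'
      exact ncard_inter fun hq => hne (by
        have h1 : (m, a) = q := h
        have h2 : (m', a') = q' := h'
        rw [← h1, ← h2, hq])
  · refine ⟨⟨by norm_num, by norm_num, h64, ncard_blocks,
      ncard_setOf_eq_one_of_balanced ncard_pts⟩, _,
      isResolution_of_fibers (fun p : Pt => (p.2.1, p.2.2)) (fun q => ⟨(0, q.1, q.2), rfl⟩)
        h16 (fun q => ?_) ?_, ?_⟩
    · have : {p : Pt | (p.2.1, p.2.2) = q} = Set.range fun x => (x, q.1, q.2) := by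
        ext ⟨m, a, c⟩
        simp [Prod.ext_iff, eq_comm]
      rw [this, ← Set.image_univ, Set.ncard_image_of_injective _ fun y y' h =>
        (Prod.mk.inj h).1, Set.ncard_univ, GF4.natCard]
    · rintro ⟨x, y, z⟩ ⟨x', y', z'⟩ h hne b h1 h2
      obtain ⟨rfl, rfl⟩ := Prod.mk.inj h
      have h1 := inc_iff.1 h1
      have h2 := inc_iff.1 h2
      refine hne (Prod.ext ?_ rfl)
      linear_combination h1 - h2
    · rintro _ ⟨q, rfl⟩ _ ⟨q', rfl⟩ hne ⟨x, y, z⟩ h ⟨x', y', z'⟩ h'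
      exact ncard_joining fun hq => hne (by
        have h1 : (y, z) = q := h
        have h2 : (y', z') = q' := h'
        rw [← h1, ← h2, hq])

end planeNet

/-! ### The isomorphism types among the designs of the functions `bump κ α` -/

namespace planeDesign

/-- The nonzero multiples of `δ₀` give isomorphic designs. -/
theorem exists_iso_bump_zero {κ : GF4} (hκ : κ ≠ 0) :
    ∃ j : Iso (planeDesign (bump κ 0)) (planeDesign (bump 1 0)), j.onBlocks (vert 0) = vert 0 :=
  ⟨scaleIso (κ := κ⁻¹) (l := 1) (inv_ne_zero hκ) one_ne_zero (by revert κ; decide +kernel),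
    congrArg vert (mul_zero _)⟩

/-- Up to an affine function, `z² + κ δ₀` is the function `κ δ_τ` with `τ = κ⁻¹`. -/
theorem exists_iso_bump_one {κ : GF4} (hκ : κ ≠ 0) :
    ∃ j : Iso (planeDesign (bump κ 1)) (planeDesign (bump 1 0)),
      j.onBlocks (vert 0) = vert κ⁻¹ :=
  ⟨(shiftIso (f' := bump κ 0) κ⁻¹ κ κ⁻¹ (by revert κ; decide +kernel)).trans
      (scaleIso (κ := κ⁻¹) (l := 1) (inv_ne_zero hκ) one_ne_zero (by revert κ; decide +kernel)),
    congrArg vert ((one_mul _).trans (zero_add _))⟩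

/-- The planes `z = t` are equivalent in the design of `z²`. -/
theorem exists_iso_bump01_vert (t : GF4) :
    ∃ j : Iso (planeDesign (bump 0 1)) (planeDesign (bump 0 1)), j.onBlocks (vert 0) = vert t :=
  ⟨shiftIso t (t * t) 0 (by revert t; decide +kernel), congrArg vert (zero_add _)⟩

/-- The planes `z = t` are equivalent in the design of the zero function. -/
theorem exists_iso_bump00_vert (t : GF4) :
    ∃ j : Iso (planeDesign (bump 0 0)) (planeDesign (bump 0 0)), j.onBlocks (vert 0) = vert t :=
  ⟨shiftIso t 0 0 (by revert t; decide +kernel), congrArg vert (zero_add _)⟩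

/-- The planes `z = t` with `t ≠ 0` are equivalent in the design of `δ₀`. -/
theorem exists_iso_bump10_vert {t : GF4} (ht : t ≠ 0) :
    ∃ j : Iso (planeDesign (bump 1 0)) (planeDesign (bump 1 0)), j.onBlocks (vert 1) = vert t :=
  ⟨scaleIso (κ := 1) one_ne_zero ht (by revert t; decide +kernel), congrArg vert (mul_one _)⟩

/-- The blocks other than the planes `z = t` are equivalent in the design of any function. -/
theorem exists_iso_pl (f : GF4 → GF4) (g : Option GF4) (a c : GF4) :
    ∃ j : Iso (planeDesign f) (planeDesign f), j.onBlocks (pl g a c) = pl none 0 0 := by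
  have hnone : ∀ a c, ∃ j : Iso (planeDesign f) (planeDesign f),
      j.onBlocks (pl none a c) = pl none 0 0 := fun a c =>
    ⟨(shearIso f 0 a).trans (translationIso f 0 c), by
      change pl none (a + a) (c + c) = _
      rw [GF4.add_self, GF4.add_self]⟩
  cases g with
  | none => exact hnone a c
  | some m =>
    obtain ⟨j, hj⟩ := hnone (a + m * m * 0) (c + m * m * 0)
    refine ⟨((transvectionIso f m 0 0).trans (swapIso f)).trans j, ?_⟩
    rw [← hj]
    change j.onBlocks (if m + m = 0 then _ else _) = _
    rw [if_pos (GF4.add_self m)]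

/-- The exchange of the last two coordinates of the affine space. -/
noncomputable def flipIso : Iso (planeDesign (bump 0 0)) (planeDesign (bump 0 0)) :=
  isoOfMaps (fun p => (p.1, p.2.2, p.2.1))
    (fun b => match b with
      | vert t => pl none 0 t
      | pl none a c => if a = 0 then vert c else pl none a⁻¹ (a⁻¹ * c)
      | pl (some m) a c => pl (some a) m c)
    (by
      have h0 : ∀ z, bump 0 0 z = 0 := by decide +kernel
      rintro ⟨x, y, z⟩ (t | ⟨_ | m, a, c⟩)
      · simp [inc_vert, inc_pl, val]
      · by_cases ha : a = 0
        · subst ha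
          simp [inc_vert, inc_pl, val]
        · simp only [inc_pl, val, if_neg ha]
          refine eq_iff_eq_of_sub_eq (inv_ne_zero ha) ?_
          linear_combination -z * inv_mul_cancel₀ ha
      · simp only [inc_pl, val, h0]
        exact eq_iff_eq_of_sub_eq one_ne_zero (by ring))

/-- All blocks are equivalent in the design of the zero function. -/
theorem exists_iso_bump00 (b : Bl) :
    ∃ j : Iso (planeDesign (bump 0 0)) (planeDesign (bump 0 0)), j.onBlocks (vert 0) = b := by
  cases b with
  | vert t => exact exists_iso_bump00_vert t
  | pl g a c =>
    obtain ⟨j, hj⟩ := exists_iso_pl (bump 0 0) g a c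
    exact ⟨flipIso.trans j.symm, (Equiv.symm_apply_eq _).2 hj.symm⟩

/-! ### Blocks which are not good -/

/-- A block is not good if one of its nonempty intersections occurs only once. -/
theorem not_isGood_of_unique_inter {P β : Type*} {D : IncStruct P β} {B C : β} (hC : C ≠ B)
    (hmeet : ∃ x, D.inc x C ∧ D.inc x B)
    (h : ∀ C', C' ≠ C → C' ≠ B → ∃ x, D.inc x B ∧ ¬ (D.inc x C' ↔ D.inc x C)) :
    ¬ D.IsGood 4 3 B := by
  rintro ⟨-, S, -, hmem, hcard⟩
  let M : D.Meeting B := ⟨C, hC, hmeet⟩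
  have h4 := hcard _ (hmem M)
  have : {C' | (D.derived B).pts C' = (D.derived B).pts M} = {M} := by
    refine Set.eq_singleton_iff_unique_mem.2 ⟨rfl, fun C' hC' => ?_⟩
    by_contra hne
    obtain ⟨x, hx, hxC⟩ := h C'.1 (fun h => hne (Subtype.ext h)) C'.2.1
    exact hxC (Set.ext_iff.1 hC' ⟨x, hx⟩)
  rw [this, Set.ncard_singleton] at h4
  norm_num at h4

theorem not_isGood_bump10_none : ¬ (planeDesign (bump 1 0)).IsGood 4 3 (pl none 0 0) :=
  not_isGood_of_unique_inter (C := pl (some 1) 1 0) (by decide) (by decide +kernel)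
    (by decide +kernel)

theorem not_isGood_bump01_none : ¬ (planeDesign (bump 0 1)).IsGood 4 3 (pl none 0 0) :=
  not_isGood_of_unique_inter (C := pl (some 1) 1 0) (by decide) (by decide +kernel)
    (by decide +kernel)

theorem exists_vert_of_isGood {f : GF4 → GF4} (hf : ¬ (planeDesign f).IsGood 4 3 (pl none 0 0))
    {b : Bl} (hb : (planeDesign f).IsGood 4 3 b) : ∃ t, b = vert t := by
  cases b with
  | vert t => exact ⟨t, rfl⟩
  | pl g a c =>
    obtain ⟨j, hj⟩ := exists_iso_pl f g a c
    exact (hf (hj ▸ j.isGood hb)).elim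

theorem isGood_bump00 (b : Bl) : (planeDesign (bump 0 0)).IsGood 4 3 b := by
  obtain ⟨j, rfl⟩ := exists_iso_bump00 b
  exact j.isGood (planeDesign.isGood _ 0)

theorem not_isomorphic_bump00 {f : GF4 → GF4}
    (hf : ¬ (planeDesign f).IsGood 4 3 (pl none 0 0)) :
    ¬ (planeDesign (bump 0 0)).Isomorphic (planeDesign f) := by
  rintro ⟨j⟩
  have := j.isGood (isGood_bump00 (j.onBlocks.symm (pl none 0 0)))
  rw [Equiv.apply_symm_apply] at this
  exact hf this

/-! ### Linear embeddings -/

/-- The residual structure at `z = 0` does not depend on the value of the function at `0`. -/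
def residualIso (κ κ' α : GF4) :
    Iso ((planeDesign (bump κ α)).residual (vert 0)) ((planeDesign (bump κ' α)).residual (vert 0))
    where
  onPoints := Equiv.refl _
  onBlocks := Equiv.refl _
  inc_iff := by
    rintro ⟨⟨x, y, z⟩, hz⟩ ⟨t | ⟨_ | m, a, c⟩, hb⟩
    · rfl
    · rfl
    · have hz' : z ≠ 0 := hz
      change (planeDesign (bump κ α)).inc (x, y, z) (pl (some m) a c) ↔
        (planeDesign (bump κ' α)).inc (x, y, z) (pl (some m) a c)
      simp [inc_pl, val, bump, hz']

variable {P β P' β' Q γ : Type*} {R : IncStruct Q γ} {E : IncStruct P β} {E' : IncStruct P' β'}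

/-- The designs in which the residual structure at `z = 0` is linearly embedded, up to isomorphism,
if they are among two designs whose blocks are the lightest codewords. -/
theorem embedsExactlyIn {α : GF4} [Finite P] [Finite β] [Finite P'] [Finite β']
    (hR : R.Isomorphic ((planeDesign (bump 0 α)).residual (vert 0)))
    (hE : E.HasLightCode) (hE' : E'.HasLightCode) (hres : ∃ B, R.Isomorphic (E.residual B))
    (hres' : ∃ B, R.Isomorphic (E'.residual B))
    (hcl : ∀ κ, (planeDesign (bump κ α)).Isomorphic E ∨ (planeDesign (bump κ α)).Isomorphic E') :
    R.EmbedsExactlyIn E E' := by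
  intro P₀ β₀ _ _ F hF
  have key : ∀ B, IsLinearEmbedding 2 R F B → ∃ κ, ∃ j : Iso (planeDesign (bump κ α)) F,
      j.onBlocks (vert 0) = B := by
    rintro B ⟨hRB, hrank⟩
    obtain ⟨i⟩ := hR.symm.trans hRB
    obtain ⟨κ, j, hj⟩ := exists_iso_of_linear_embedding i hF hrank (α := α)
      (fun z hz => by simp [bump, hz])
    have : (fun z => if z = 0 then κ else bump 0 α z) = bump κ α := by
      funext z
      by_cases hz : z = 0 <;> simp [bump, hz]
    refine ⟨κ, ?_⟩
    rw [← this]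
    exact ⟨j, hj⟩
  refine ⟨⟨?_, ?_⟩, fun B hB => ?_⟩
  · rintro ⟨B, hB⟩
    obtain ⟨κ, j, -⟩ := key B hB
    have hj : F.Isomorphic (planeDesign (bump κ α)) := ⟨j.symm⟩
    exact (hcl κ).imp hj.trans hj.trans
  · rintro (h | h)
    · obtain ⟨B, hB⟩ := hres
      obtain ⟨i⟩ := h
      exact ⟨i.symm.onBlocks B, hB.trans ⟨i.symm.residual B⟩,
        (i.symm.hasLightCode hE).pRank_residual _⟩
    · obtain ⟨B, hB⟩ := hres'
      obtain ⟨i⟩ := h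
      exact ⟨i.symm.onBlocks B, hB.trans ⟨i.symm.residual B⟩,
        (i.symm.hasLightCode hE').pRank_residual _⟩
  · obtain ⟨κ, j, rfl⟩ := key B hB
    exact j.isGood (planeDesign.isGood _ 0)

/-- The order of the two designs is irrelevant. -/
theorem _root_.IncStruct.EmbedsExactlyIn.symm (h : R.EmbedsExactlyIn E E') :
    R.EmbedsExactlyIn E' E := fun P₀ β₀ _ _ F hF =>
  ⟨(h P₀ β₀ F hF).1.trans or_comm, (h P₀ β₀ F hF).2⟩

theorem residual_bump10_vert {t : GF4} (ht : t ≠ 0) :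
    ((planeDesign (bump 1 0)).residual (vert t)).Isomorphic
      ((planeDesign (bump 0 1)).residual (vert 0)) := by
  obtain ⟨j, hj⟩ := exists_iso_bump_one (inv_ne_zero ht)
  rw [inv_inv] at hj
  rw [← hj]
  exact ⟨(j.residual (vert 0)).symm.trans (residualIso _ _ _)⟩

section

variable {P₁ β₁ P₂ β₂ : Type*} {E₁ : IncStruct P₁ β₁} {E₂ : IncStruct P₂ β₂} [Finite P₁]
  [Finite β₁] [Finite P₂] [Finite β₂]

/-- The residual structure of the design of planes is linearly embedded in the designs of
the zero function and of `δ₀`. -/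
theorem embedsExactlyIn_zero (i₀ : Iso (planeDesign (bump 0 0)) E₁)
    (i₁ : Iso (planeDesign (bump 1 0)) E₂)
    (hR : R.Isomorphic ((planeDesign (bump 0 0)).residual (vert 0))) :
    R.EmbedsExactlyIn E₁ E₂ := by
  refine embedsExactlyIn hR (i₀.hasLightCode hasLightCode_bump00)
    (i₁.hasLightCode hasLightCode_bump10) ⟨_, hR.trans ⟨i₀.residual _⟩⟩
    ⟨_, hR.trans ⟨(residualIso 0 1 0).trans (i₁.residual _)⟩⟩ fun κ => ?_
  rcases eq_or_ne κ 0 with rfl | hκ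
  · exact .inl ⟨i₀⟩
  · obtain ⟨j, -⟩ := exists_iso_bump_zero hκ
    exact .inr ⟨j.trans i₁⟩

/-- The residual structure of the design of `z²` at `z = 0` is linearly embedded in the designs of `δ₀`
and of `z²`. -/
theorem embedsExactlyIn_one (i₁ : Iso (planeDesign (bump 1 0)) E₁)
    (i₂ : Iso (planeDesign (bump 0 1)) E₂)
    (hR : R.Isomorphic ((planeDesign (bump 0 1)).residual (vert 0))) :
    R.EmbedsExactlyIn E₁ E₂ := by
  refine embedsExactlyIn hR (i₁.hasLightCode hasLightCode_bump10)
    (i₂.hasLightCode hasLightCode_bump01)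
    ⟨_, hR.trans ((residual_bump10_vert one_ne_zero).symm.trans ⟨i₁.residual _⟩)⟩
    ⟨_, hR.trans ⟨i₂.residual _⟩⟩ fun κ => ?_
  rcases eq_or_ne κ 0 with rfl | hκ
  · exact .inr ⟨i₂⟩
  · obtain ⟨j, -⟩ := exists_iso_bump_one hκ
    exact .inl ⟨j.trans i₁⟩

end

/-- The planes `z = 0` and `z = 1` are not equivalent in the design of `δ₀`: otherwise the residual
structures of the zero function and of `z²` would be isomorphic, and the design of planes would
be a linear embedding of the latter. -/
theorem not_sameOrbit_bump10 : ¬ (planeDesign (bump 1 0)).SameOrbit (vert 0) (vert 1) := by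
  rintro ⟨g, hg, h⟩
  have h1 := (Iso.ofAut hg).residual (vert 0)
  have h2 : (Iso.ofAut hg).onBlocks (vert 0) = vert 1 := h
  rw [h2] at h1
  have h3 : ((planeDesign (bump 0 0)).residual (vert 0)).Isomorphic
      ((planeDesign (bump 0 1)).residual (vert 0)) :=
    Isomorphic.trans ⟨(residualIso 0 1 0).trans h1⟩ (residual_bump10_vert one_ne_zero)
  have h4 := (embedsExactlyIn_one (Iso.refl _) (Iso.refl _) h3 _ _ (planeDesign (bump 0 0))
    (planeDesign.isAffineResolvable _)).1.1
    ⟨vert 0, Isomorphic.refl _, hasLightCode_bump00.pRank_residual _⟩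
  rcases h4 with h4 | h4
  · exact not_isomorphic_bump00 not_isGood_bump10_none h4
  · exact not_isomorphic_bump00 not_isGood_bump01_none h4

end planeDesign

/-! ### The design of points and planes of the affine space -/

namespace planeDesign

/-- Without deformation, the blocks are the solution sets of linear equations. -/
theorem exists_equation (b : Bl) : ∃ n₀ n₁ n₂ c : GF4, (n₀ ≠ 0 ∨ n₁ ≠ 0 ∨ n₂ ≠ 0) ∧
    ∀ x y z, (planeDesign (bump 0 0)).inc (x, y, z) b ↔ n₀ * x + n₁ * y + n₂ * z = c := by
  have h0 : ∀ z, bump 0 0 z = 0 := by decide +kernel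
  rcases b with t | ⟨_ | m, a, c⟩
  · exact ⟨0, 0, 1, t, by simp, fun x y z => by simp [inc_vert]⟩
  · exact ⟨0, 1, a, c, by simp, fun x y z => by simp [inc_pl, val]⟩
  · exact ⟨1, m, a, c, by simp, fun x y z => by simp [inc_pl, val, h0]⟩

theorem exists_block {n₀ n₁ n₂ c : GF4} (h : n₀ ≠ 0 ∨ n₁ ≠ 0 ∨ n₂ ≠ 0) :
    ∃ b, ∀ x y z, (planeDesign (bump 0 0)).inc (x, y, z) b ↔ n₀ * x + n₁ * y + n₂ * z = c := by
  have h0 : ∀ z, bump 0 0 z = 0 := by decide +kernel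
  by_cases hn : n₀ = 0
  · subst hn
    by_cases hn : n₁ = 0
    · subst hn
      have hn : n₂ ≠ 0 := by simpa using h
      refine ⟨vert (n₂⁻¹ * c), fun x y z => ?_⟩
      rw [inc_vert]
      refine eq_iff_eq_of_sub_eq hn ?_
      linear_combination c * mul_inv_cancel₀ hn
    · refine ⟨pl none (n₁⁻¹ * n₂) (n₁⁻¹ * c), fun x y z => ?_⟩
      rw [inc_pl, val]
      refine eq_iff_eq_of_sub_eq hn ?_
      linear_combination (c - n₂ * z) * mul_inv_cancel₀ hn
  · refine ⟨pl (some (n₀⁻¹ * n₁)) (n₀⁻¹ * n₂) (n₀⁻¹ * c), fun x y z => ?_⟩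
    rw [inc_pl, val, h0]
    refine eq_iff_eq_of_sub_eq hn ?_
    linear_combination (c - n₁ * y - n₂ * z) * mul_inv_cancel₀ hn

section

variable {K : Type*} [Field K]

/-- The linear form with given coefficients. -/
def linForm (n₀ n₁ n₂ : K) : (Fin 3 → K) →ₗ[K] K :=
  n₀ • LinearMap.proj 0 + n₁ • LinearMap.proj 1 + n₂ • LinearMap.proj 2

theorem linForm_apply (n₀ n₁ n₂ : K) (v : Fin 3 → K) :
    linForm n₀ n₁ n₂ v = n₀ * v 0 + n₁ * v 1 + n₂ * v 2 := by
  simp [linForm]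

/-- The coordinate map of the affine space. -/
def coordEquiv (e : GF4 ≃+* K) : Pt ≃ (Fin 3 → K) where
  toFun p := ![e p.1, e p.2.1, e p.2.2]
  invFun v := (e.symm (v 0), e.symm (v 1), e.symm (v 2))
  left_inv p := by simp
  right_inv v := by
    funext i
    fin_cases i <;> simp

theorem isomorphic_AG (e : GF4 ≃+* K) :
    (planeDesign (bump 0 0)).Isomorphic (IncStruct.AG 2 3 K) := by
  have himage : ∀ {n₀ n₁ n₂ c b}, (∀ x y z, (planeDesign (bump 0 0)).inc (x, y, z) b ↔
      n₀ * x + n₁ * y + n₂ * z = c) → coordEquiv e '' (planeDesign (bump 0 0)).pts b =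
        {v | linForm (e n₀) (e n₁) (e n₂) v = e c} := by
    intro n₀ n₁ n₂ c b h
    ext v
    obtain ⟨⟨x, y, z⟩, rfl⟩ := (coordEquiv e).surjective v
    rw [(coordEquiv e).injective.mem_set_image]
    change (planeDesign (bump 0 0)).inc (x, y, z) b ↔ linForm _ _ _ ![e x, e y, e z] = e c
    rw [h, linForm_apply, ← e.injective.eq_iff]
    simp
  refine isomorphic_of_simple (pts_injective _) ?_ (coordEquiv e) (fun b => ?_) fun A => ?_
  · intro A A' h
    exact Subtype.ext (SetLike.coe_injective h)
  · obtain ⟨n₀, n₁, n₂, c, hn, h⟩ := exists_equation b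
    rw [himage h]
    have hφ : linForm (e n₀) (e n₁) (e n₂) ≠ 0 := by
      intro h0
      have h1 := LinearMap.congr_fun h0
      have e0 := h1 ![1, 0, 0]
      have e1 := h1 ![0, 1, 0]
      have e2 := h1 ![0, 0, 1]
      simp [linForm_apply] at e0 e1 e2
      simp [e0, e1, e2] at hn
    obtain ⟨v₀, hv₀⟩ := LinearMap.surjective hφ (e c)
    refine ⟨⟨AffineSubspace.mk' v₀ (LinearMap.ker (linForm (e n₀) (e n₁) (e n₂))),
      ⟨v₀, AffineSubspace.self_mem_mk' _ _⟩, ?_⟩, ?_⟩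
    · rw [AffineSubspace.direction_mk']
      have := Module.Dual.finrank_ker_add_one_of_ne_zero hφ
      rw [Module.finrank_fin_fun] at this
      omega
    · ext v
      change _ ↔ v ∈ AffineSubspace.mk' v₀ (LinearMap.ker (linForm (e n₀) (e n₁) (e n₂)))
      rw [AffineSubspace.mem_mk', LinearMap.mem_ker, vsub_eq_sub, map_sub, hv₀, sub_eq_zero]
      rfl
  · obtain ⟨A, ⟨v₀, hv₀⟩, hA⟩ := A
    have hlt : A.direction < ⊤ := by
      rw [lt_top_iff_ne_top]
      intro htop
      rw [htop, finrank_top, Module.finrank_fin_fun] at hA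
      norm_num at hA
    obtain ⟨φ, hφ, hle⟩ := Submodule.exists_le_ker_of_lt_top _ hlt
    have hker : A.direction = LinearMap.ker φ := by
      refine Submodule.eq_of_le_of_finrank_eq hle ?_
      have := Module.Dual.finrank_ker_add_one_of_ne_zero hφ
      rw [Module.finrank_fin_fun] at this
      omega
    set n : Fin 3 → GF4 := fun i => e.symm (φ (Pi.single i 1)) with hn
    have hform : φ = linForm (e (n 0)) (e (n 1)) (e (n 2)) := by
      refine LinearMap.pi_ext' fun i => LinearMap.ext_ring ?_
      fin_cases i <;> simp [linForm_apply, hn]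
    have hn0 : n 0 ≠ 0 ∨ n 1 ≠ 0 ∨ n 2 ≠ 0 := by
      by_contra! h
      apply hφ
      rw [hform, h.1, h.2.1, h.2.2]
      ext v
      simp [linForm_apply]
    obtain ⟨b, hb⟩ := exists_block (c := e.symm (φ v₀)) hn0
    refine ⟨b, ?_⟩
    rw [himage hb, ← hform, e.apply_symm_apply]
    ext v
    change _ ↔ v ∈ A
    rw [← AffineSubspace.vsub_right_mem_direction_iff_mem hv₀, hker, LinearMap.mem_ker,
      vsub_eq_sub, map_sub, sub_eq_zero]
    rfl

end

theorem isomorphic_AG_galoisField :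
    (planeDesign (bump 0 0)).Isomorphic (IncStruct.AG 2 3 (GaloisField 2 2)) := by
  have := Fintype.ofFinite (GaloisField 2 2)
  refine isomorphic_AG (FiniteField.ringEquivOfCardEq (K := GF4) (K' := GaloisField 2 2) ?_)
  rw [GF4.card, ← Nat.card_eq_fintype_card, GaloisField.card 2 2 (by norm_num)]
  norm_num

end planeDesign

/-! ### The line spread -/

/-- The blocks of the design of a spread are cosets of the annihilators of the lines, so that there
are no repeated blocks. -/
theorem IncStruct.spreadDesign_pts_injective {K V : Type*} [Field K] [AddCommGroup V] [Module K V]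
    (S : Set (Submodule K V)) : Function.Injective (spreadDesign S).pts := by
  rintro ⟨L, θ⟩ ⟨L', θ'⟩ h
  have hmem : ∀ φ : Module.Dual K V, φ.domRestrict L.1 = θ ↔ φ.domRestrict L'.1 = θ' :=
    fun φ => Set.ext_iff.1 h φ
  obtain ⟨φ, hφ⟩ := LinearMap.exists_extend θ
  have hφ : φ.domRestrict L.1 = θ := hφ
  have hφ' := (hmem φ).1 hφ
  have hann : L.1.dualAnnihilator = L'.1.dualAnnihilator := by
    ext ψ
    have h1 : ∀ M : Submodule K V, ψ ∈ M.dualAnnihilator ↔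
        (φ + ψ).domRestrict M = φ.domRestrict M := by
      intro M
      rw [Submodule.mem_dualAnnihilator, LinearMap.ext_iff]
      simp
    rw [h1, h1, hφ, hφ', hmem]
  have hL : L = L' := Subtype.ext (Subspace.dualAnnihilator_inj.1 hann)
  subst hL
  rw [← hφ, ← hφ']

namespace GF4

noncomputable instance : Module (ZMod 2) GF4 := AddCommGroup.zmodModule (n := 2) fun a => by
  rw [two_nsmul, GF4.add_self]

theorem finrank : Module.finrank (ZMod 2) GF4 = 2 := by
  have := Module.natCard_eq_pow_finrank (K := ZMod 2) (V := GF4)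
  rw [GF4.natCard, Nat.card_zmod] at this
  exact Nat.pow_right_injective (le_refl 2) (by simpa using this.symm)

end GF4

namespace planeDesign

theorem finrank_pt : Module.finrank (ZMod 2) Pt = 6 := by
  rw [Module.finrank_prod, Module.finrank_prod, GF4.finrank]

/-- The lines of the spread, parametrized by the parallel classes. -/
def spreadLine : Option (Option GF4 × GF4) → GF4 → Pt
  | none, μ => (0, 0, μ)
  | some (none, a), μ => (0, μ, μ * a)
  | some (some m, a), μ => (μ, μ * m, μ * a + μ * μ * m)

theorem spreadLine_add (i : Option (Option GF4 × GF4)) (μ ν : GF4) :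
    spreadLine i (μ + ν) = spreadLine i μ + spreadLine i ν := by
  rcases i with _ | ⟨_ | m, a⟩
  · simp [spreadLine]
  · simp [spreadLine, add_mul]
  · simp only [spreadLine, Prod.mk_add_mk, Prod.mk.injEq, true_and]
    refine ⟨by ring, ?_⟩
    linear_combination μ * ν * m * two_eq_zero

theorem spreadLine_injective (i : Option (Option GF4 × GF4)) :
    Function.Injective (spreadLine i) := by
  rcases i with _ | ⟨_ | m, a⟩ <;> intro μ ν h <;> simp only [spreadLine, Prod.mk.injEq] at h
  · exact h.2.2
  · exact h.2.1
  · exact h.1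

/-- The lines partition the nonzero vectors. -/
theorem exists_unique_spreadLine : ∀ v : Pt, v ≠ 0 → ∃ i, (∃ μ, spreadLine i μ = v) ∧
    ∀ i', (∃ μ, spreadLine i' μ = v) → i' = i := by
  decide +kernel

/-- The trace form on the space of points. -/
def pairing (w p : Pt) : ZMod 2 := tr (w.1 * p.1 + w.2.1 * p.2.1 + w.2.2 * p.2.2)

theorem pairing_add (w w' p : Pt) : pairing (w + w') p = pairing w p + pairing w' p := by
  rw [pairing, pairing, pairing, ← tr_add]
  congr 1
  simp only [Prod.fst_add, Prod.snd_add]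
  ring

/-- The common value, up to a constant, of the forms which define the blocks of a parallel class. -/
def classForm : Option (Option GF4 × GF4) → Pt → GF4
  | none, p => p.2.2
  | some (g, a), p => val (bump 0 1) g p + a * p.2.2

theorem exists_classForm_eq (b : Bl) : ∃ c, ∀ p, (planeDesign (bump 0 1)).inc p b ↔
    classForm (parallelClass b) p = c := by
  rcases b with t | ⟨g, a, c⟩
  · exact ⟨t, fun p => Iff.rfl⟩
  · exact ⟨c, fun p => Iff.rfl⟩

theorem exists_block_classForm (i : Option (Option GF4 × GF4)) (c : GF4) :
    ∃ b, ∀ p, (planeDesign (bump 0 1)).inc p b ↔ classForm i p = c := by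
  rcases i with _ | ⟨g, a⟩
  · exact ⟨vert c, fun p => Iff.rfl⟩
  · exact ⟨pl g a c, fun p => Iff.rfl⟩

/-- Since `tr (u²) = tr u`, the restriction of a functional to a line of the spread depends only
on the form of the parallel class. -/
theorem pairing_spreadLine (i : Option (Option GF4 × GF4)) (μ : GF4) (p : Pt) :
    pairing (spreadLine i μ) p = tr (μ * classForm i p) := by
  obtain ⟨x, y, z⟩ := p
  rcases i with _ | ⟨_ | m, a⟩
  · simp [pairing, spreadLine, classForm]
  · simp only [pairing, spreadLine, classForm, val]
    congr 1
    ring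
  · have hf : bump 0 1 z = z * z := by revert z; decide
    have htr : tr (μ * (z * z * (m * m))) = tr (μ * μ * m * z) := by
      revert μ m z; decide +kernel
    have h1 : μ * (x + m * y + z * z * (m * m) + a * z) =
        (μ * x + μ * m * y + μ * a * z) + μ * (z * z * (m * m)) := by ring
    have h2 : μ * x + μ * m * y + (μ * a + μ * μ * m) * z =
        (μ * x + μ * m * y + μ * a * z) + μ * μ * m * z := by ring
    simp only [pairing, spreadLine, classForm, val, hf]
    rw [h1, h2, tr_add, tr_add _ (μ * (z * z * (m * m))), htr]

/-- Coordinates over the prime field. -/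
noncomputable def ptCoord : Pt ≃ₗ[ZMod 2] (Fin 6 → ZMod 2) :=
  LinearEquiv.ofFinrankEq _ _ (by rw [finrank_pt, Module.finrank_fin_fun])

/-- The line of the spread as a subspace. -/
noncomputable def spreadMap (i : Option (Option GF4 × GF4)) :
    GF4 →ₗ[ZMod 2] (Fin 6 → ZMod 2) :=
  ptCoord.toLinearMap ∘ₗ
    AddMonoidHom.toZModLinearMap 2 (AddMonoidHom.mk' (spreadLine i) (spreadLine_add i))

theorem spreadMap_apply (i : Option (Option GF4 × GF4)) (μ : GF4) :
    spreadMap i μ = ptCoord (spreadLine i μ) := rfl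

/-- The functional of a point. -/
noncomputable def functional (p : Pt) : Module.Dual (ZMod 2) (Fin 6 → ZMod 2) :=
  AddMonoidHom.toZModLinearMap 2 (AddMonoidHom.mk' (fun w => pairing w p)
    fun w w' => pairing_add w w' p) ∘ₗ ptCoord.symm.toLinearMap

theorem functional_ptCoord (p w : Pt) : functional p (ptCoord w) = pairing w p := by
  change pairing (ptCoord.symm (ptCoord w)) p = _
  rw [LinearEquiv.symm_apply_apply]

theorem functional_bijective : Function.Bijective functional := by
  have hinj : Function.Injective functional := by
    intro p q h
    have h1 : ∀ w, pairing w p = pairing w q := fun w => by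
      rw [← functional_ptCoord, h, functional_ptCoord]
    have hx := eq_of_tr_mul p.1 q.1 fun k => by simpa [pairing] using h1 (k, 0, 0)
    have hy := eq_of_tr_mul p.2.1 q.2.1 fun k => by simpa [pairing] using h1 (0, k, 0)
    have hz := eq_of_tr_mul p.2.2 q.2.2 fun k => by simpa [pairing] using h1 (0, 0, k)
    exact Prod.ext hx (Prod.ext hy hz)
  have : Finite (Module.Dual (ZMod 2) (Fin 6 → ZMod 2)) := Module.finite_of_finite (ZMod 2)
  refine (Nat.bijective_iff_injective_and_card _).2 ⟨hinj, ?_⟩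
  rw [Module.natCard_eq_pow_finrank (K := ZMod 2) (V := Pt),
    Module.natCard_eq_pow_finrank (K := ZMod 2)
      (V := Module.Dual (ZMod 2) (Fin 6 → ZMod 2)), Subspace.dual_finrank_eq, finrank_pt,
    Module.finrank_fin_fun]

theorem domRestrict_functional_eq_iff (i : Option (Option GF4 × GF4)) (p q : Pt) :
    (functional p).domRestrict (LinearMap.range (spreadMap i)) =
      (functional q).domRestrict (LinearMap.range (spreadMap i)) ↔
        classForm i p = classForm i q := by
  have key : ∀ p μ, functional p (spreadMap i μ) = tr (μ * classForm i p) := fun p μ => by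
    rw [spreadMap_apply, functional_ptCoord, pairing_spreadLine]
  constructor
  · intro h
    refine eq_of_tr_mul _ _ fun μ => ?_
    rw [← key, ← key]
    exact LinearMap.congr_fun h ⟨spreadMap i μ, μ, rfl⟩
  · intro h
    refine LinearMap.ext ?_
    rintro ⟨_, μ, rfl⟩
    change functional p (spreadMap i μ) = functional q (spreadMap i μ)
    rw [key, key, h]

theorem isLineSpread_range :
    IsLineSpread (Set.range fun i => LinearMap.range (spreadMap i)) := by
  constructor
  · rintro _ ⟨i, rfl⟩
    rw [LinearMap.finrank_range_of_inj, GF4.finrank]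
    exact ptCoord.injective.comp (spreadLine_injective i)
  · intro v hv
    obtain ⟨w, rfl⟩ := ptCoord.surjective v
    have hmem : ∀ i, ptCoord w ∈ LinearMap.range (spreadMap i) ↔ ∃ μ, spreadLine i μ = w := by
      intro i
      simp only [LinearMap.mem_range, spreadMap_apply, ptCoord.injective.eq_iff]
    obtain ⟨i, hi, hu⟩ := exists_unique_spreadLine w (by rintro rfl; exact hv (map_zero _))
    refine ⟨LinearMap.range (spreadMap i), ⟨⟨i, rfl⟩, (hmem i).2 hi⟩, ?_⟩
    rintro _ ⟨⟨i', rfl⟩, hi'⟩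
    rw [hu i' ((hmem i').1 hi')]

theorem arisesFromLineSpread_bump01 : (planeDesign (bump 0 1)).ArisesFromLineSpread := by
  refine ⟨_, isLineSpread_range, ?_⟩
  have himage : ∀ {b i p₀}, (∀ p, (planeDesign (bump 0 1)).inc p b ↔
      classForm i p = classForm i p₀) →
        Equiv.ofBijective _ functional_bijective '' (planeDesign (bump 0 1)).pts b =
          (spreadDesign (Set.range fun i => LinearMap.range (spreadMap i))).pts
            ⟨⟨_, i, rfl⟩, (functional p₀).domRestrict (LinearMap.range (spreadMap i))⟩ := by
    intro b i p₀ h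
    ext φ
    obtain ⟨p, rfl⟩ := (Equiv.ofBijective _ functional_bijective).surjective φ
    rw [(Equiv.injective _).mem_set_image]
    exact (h p).trans (domRestrict_functional_eq_iff i p p₀).symm
  refine isomorphic_of_simple (pts_injective _) (spreadDesign_pts_injective _)
    (Equiv.ofBijective _ functional_bijective) (fun b => ?_) ?_
  · have hb : ((planeDesign (bump 0 1)).pts b).Nonempty :=
      Set.nonempty_of_ncard_ne_zero (by rw [planeDesign.ncard_pts]; norm_num)
    obtain ⟨p₀, hp₀⟩ := hb
    obtain ⟨c, hc⟩ := exists_classForm_eq b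
    exact ⟨_, himage fun p => by rw [hc, (hc p₀).1 hp₀]⟩
  · rintro ⟨⟨_, i, rfl⟩, θ⟩
    obtain ⟨φ, hφ⟩ := LinearMap.exists_extend θ
    obtain ⟨p₀, rfl⟩ := functional_bijective.2 φ
    obtain ⟨b, hb⟩ := exists_block_classForm i (classForm i p₀)
    exact ⟨b, by rw [himage hb, ← hφ]; rfl⟩

end planeDesign

/-! ### Automorphisms fixing four points -/

theorem mask_and (s s' : Pt → Bool) : mask s &&& mask s' = mask fun p => s p && s' p := by
  have hstep : ∀ (a b : Bool) (n k : ℕ),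
      (2 * n + a.toNat) &&& (2 * k + b.toNat) = 2 * (n &&& k) + (a && b).toNat := by
    intro a b n k
    have hd : ∀ (c : Bool) (n : ℕ), (2 * n + c.toNat) / 2 = n := by
      intro c n; cases c <;> simp; omega
    have hm : ∀ (c : Bool) (n : ℕ), decide ((2 * n + c.toNat) % 2 = 1) = c := by
      intro c n; cases c <;> simp
    refine Nat.eq_of_testBit_eq fun j => ?_
    cases j with
    | zero => rw [Nat.testBit_and]; simp only [Nat.testBit_zero, hm]
    | succ j => rw [Nat.testBit_and]; simp only [Nat.testBit_succ, hd, Nat.testBit_and]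
  have key : ∀ l : List Pt, (l.foldr (fun p n => 2 * n + (s p).toNat) 0) &&&
      (l.foldr (fun p n => 2 * n + (s' p).toNat) 0) =
        l.foldr (fun p n => 2 * n + (s p && s' p).toNat) 0 := by
    intro l
    induction l with
    | nil => exact Nat.and_self 0
    | cons p l ih => simp only [List.foldr_cons, hstep, ih]
  exact key _

theorem mask_eq_zero_iff (s : Pt → Bool) : mask s = 0 ↔ ∀ p, s p = false := by
  constructor
  · intro h p
    rw [← testBit_mask s p, h, Nat.zero_testBit]
  · intro h
    rw [show s = fun _ => false from funext h]
    decide +kernel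

/-- The number of the set of points which lie in the same members of a list of sets of points
as `p`. -/
def twins (ts : List ℕ) (p : Pt) : ℕ :=
  ts.foldr (fun t n => Nat.land n
    (bif t.testBit (ptIndex p) then t else Nat.xor t (2 ^ 64 - 1))) (2 ^ 64 - 1)

theorem testBit_twins {ts : List ℕ} {p q : Pt}
    (h : ∀ t ∈ ts, t.testBit (ptIndex p) = t.testBit (ptIndex q)) :
    (twins ts p).testBit (ptIndex q) = true := by
  have h64 : (2 ^ 64 - 1).testBit (ptIndex q) = true := by
    rw [Nat.testBit_two_pow_sub_one]; exact decide_eq_true (ptIndex_lt q)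
  induction ts with
  | nil => exact h64
  | cons t ts ih =>
    have h1 : twins (t :: ts) p = twins ts p &&&
      (bif t.testBit (ptIndex p) then t else t ^^^ (2 ^ 64 - 1)) := rfl
    rw [h1, Nat.testBit_and, ih fun t' ht' => h t' (List.mem_cons_of_mem _ ht'), Bool.true_and]
    have h2 := h t List.mem_cons_self
    cases h3 : t.testBit (ptIndex p)
    · rw [h3] at h2
      rw [cond_false, Nat.testBit_xor, h64, ← h2]; rfl
    · rw [h3] at h2
      rw [cond_true, ← h2]

/-- The points determined by the members of a list of sets of points in which they lie. -/
def pointStep (ts : List ℕ) : ℕ := mask fun p => Nat.beq (twins ts p) (2 ^ ptIndex p)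

/-- Whether two blocks have the same intersection with a set `S` of points and meet the same
members of a list of blocks. -/
def sameType (S : ℕ) (ts : List ℕ) (m m' : ℕ) : Bool :=
  Nat.beq (Nat.land S m) (Nat.land S m') &&
    ts.all fun t => Nat.beq (Nat.land t m) 0 == Nat.beq (Nat.land t m') 0

/-- The blocks determined by their intersection with a set `S` of points and by the members of a
list of blocks they meet. -/
def blockStep (ms : List ℕ) (S : ℕ) (ts : List ℕ) : List ℕ :=
  ms.filter fun m => ms.all fun m' => Nat.beq m m' || !sameType S ts m m'

/-- Iteration of `blockStep` and `pointStep`. -/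
def fixClosure (ms : List ℕ) : ℕ → ℕ → List ℕ → ℕ
  | 0, S, _ => S
  | k + 1, S, ts => fixClosure ms k (pointStep (blockStep ms S ts)) (blockStep ms S ts)

/-- Points which are fixed together only by the identity. -/
def basePoints : List Pt := [(0, om, 0), (1, 0, 0), (0, 0, 1), (0, 0, 0)]

/-- The number of the set of base points. -/
def baseMask : ℕ := mask fun p => decide (p ∈ basePoints)

/-- The incidence vectors of distinct blocks are distinct. -/
theorem blockMask_injective (f : GF4 → GF4) : Function.Injective (blockMask f) := by
  intro b b' h
  refine pts_injective f (Set.ext fun p => ?_)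
  have := congrArg (fun n => n.testBit (ptIndex p)) h
  simp only [blockMask, testBit_mask] at this
  exact decide_eq_decide.1 this

namespace planeDesign

variable {f : GF4 → GF4} {g : Equiv.Perm Pt × Equiv.Perm Bl}

theorem sameType_of_mem_aut (hg : g ∈ (planeDesign f).aut) {s : Pt → Bool} {ts : List ℕ}
    (hs : ∀ p, s p = true → g.1 p = p) (ht : ∀ t ∈ ts, ∃ b, blockMask f b = t ∧ g.2 b = b)
    (b : Bl) : sameType (mask s) ts (blockMask f b) (blockMask f (g.2 b)) = true := by
  have hland : ∀ m n : ℕ, Nat.land m n = m &&& n := fun _ _ => rfl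
  have hbeq : ∀ m n : ℕ, Nat.beq m n = true ↔ m = n := fun m n =>
    ⟨Nat.eq_of_beq_eq_true, fun h => by rw [h]; exact Nat.beq_refl n⟩
  simp only [sameType, Bool.and_eq_true, List.all_eq_true, hbeq, hland, blockMask,
    mask_and]
  refine ⟨congrArg mask (funext fun p => ?_), fun t htt => ?_⟩
  · cases h : s p
    · rfl
    · rw [Bool.true_and, Bool.true_and]
      refine decide_eq_decide.2 ?_
      rw [← hg p b, hs p h]
  · obtain ⟨c, rfl, hc⟩ := ht t htt
    rw [beq_iff_eq, Bool.eq_iff_iff, hbeq, hbeq]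
    simp only [blockMask, mask_and, mask_eq_zero_iff]
    refine Iff.trans ?_ g.1.forall_congr_right
    refine forall_congr' fun p => ?_
    have h1 : (planeDesign f).inc (g.1 p) (g.2 b) ↔ (planeDesign f).inc p b := hg p b
    have h2 : (planeDesign f).inc (g.1 p) c ↔ (planeDesign f).inc p c := by
      have := hg p c
      rwa [hc] at this
    simp only [h1, h2]

/-- If the closure of a set of fixed points and fixed blocks of an automorphism contains all points,
then the automorphism fixes all points. -/
theorem fixes_of_fixClosure (hg : g ∈ (planeDesign f).aut) (p : Pt) :
    ∀ (k : ℕ) (s : Pt → Bool) (ts : List ℕ), (∀ p, s p = true → g.1 p = p) →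
      (∀ t ∈ ts, ∃ b, blockMask f b = t ∧ g.2 b = b) →
      fixClosure (blList.map (blockMask f)) k (mask s) ts = 2 ^ 64 - 1 → g.1 p = p := by
  intro k
  induction k with
  | zero =>
    intro s ts hs _ h
    refine hs p ?_
    have h1 : mask s = 2 ^ 64 - 1 := h
    rw [← testBit_mask s p, h1, Nat.testBit_two_pow_sub_one]
    exact decide_eq_true (ptIndex_lt p)
  | succ k ih =>
    intro s ts hs ht h
    have ht' : ∀ t ∈ blockStep (blList.map (blockMask f)) (mask s) ts,
        ∃ b, blockMask f b = t ∧ g.2 b = b := by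
      intro t htt
      obtain ⟨h1, h2⟩ := List.mem_filter.1 htt
      obtain ⟨b, -, rfl⟩ := List.mem_map.1 h1
      refine ⟨b, rfl, ?_⟩
      have h3 := List.all_eq_true.1 h2 _ (List.mem_map_of_mem (mem_blList (g.2 b)))
      rw [sameType_of_mem_aut hg hs ht b, Bool.not_true, Bool.or_false] at h3
      exact (blockMask_injective f (Nat.eq_of_beq_eq_true h3)).symm
    refine ih _ _ (fun q hq => ?_) ht' h
    have h1 := testBit_twins (p := q) (q := g.1 q) fun t htt => by
      obtain ⟨b, rfl, hb⟩ := ht' t htt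
      rw [blockMask, testBit_mask, testBit_mask]
      refine decide_eq_decide.2 ?_
      have := hg q b
      rw [hb] at this
      exact this.symm
    rw [Nat.eq_of_beq_eq_true hq, Nat.testBit_two_pow] at h1
    exact (ptIndex_injective (of_decide_eq_true h1)).symm

/-- An automorphism is determined by its action on the points. -/
theorem eq_one_of_fixes (hg : g ∈ (planeDesign f).aut) (h : ∀ p, g.1 p = p) : g = 1 := by
  refine Prod.ext (Equiv.ext h) (Equiv.ext fun b => ?_)
  refine pts_injective f (Set.ext fun p => ?_)
  have := hg p b
  rw [h] at this
  exact this

end planeDesign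

/-! ### Orders of automorphism groups -/

namespace IncStruct

variable {P β : Type*} (D : IncStruct P β)

/-- The automorphisms which fix the points of a set. -/
def fixer (s : Set P) : Subgroup (Equiv.Perm P × Equiv.Perm β) where
  carrier := {g | g ∈ D.aut ∧ ∀ p ∈ s, g.1 p = p}
  one_mem' := ⟨D.aut.one_mem, fun _ _ => rfl⟩
  mul_mem' := fun {g h} hg hh => ⟨D.aut.mul_mem hg.1 hh.1, fun p hp => by
    rw [Prod.fst_mul, Equiv.Perm.mul_apply, hh.2 p hp, hg.2 p hp]⟩
  inv_mem' := fun {g} hg => ⟨D.aut.inv_mem hg.1, fun p hp => by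
    rw [Prod.fst_inv, Equiv.Perm.inv_eq_iff_eq, hg.2 p hp]⟩

variable {D}

theorem mem_fixer {s : Set P} {g : Equiv.Perm P × Equiv.Perm β} :
    g ∈ D.fixer s ↔ g ∈ D.aut ∧ ∀ p ∈ s, g.1 p = p := Iff.rfl

theorem fixer_empty : D.fixer ∅ = D.aut := by
  ext g; simp [mem_fixer]

/-- The orbit of a further point, times the order of its stabilizer. -/
theorem card_fixer (s : Set P) (p : P) : Nat.card (D.fixer s) =
    {q | ∃ g ∈ D.fixer s, g.1 p = q}.ncard * Nat.card (D.fixer (insert p s)) := by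
  let _ : MulAction (D.fixer s) P :=
    MulAction.compHom P ((MonoidHom.fst _ _).comp (D.fixer s).subtype)
  have hsmul : ∀ (g : D.fixer s) (x : P), g • x = g.1.1 x := fun _ _ => rfl
  have horbit : MulAction.orbit (D.fixer s) p = {q | ∃ g ∈ D.fixer s, g.1 p = q} := by
    ext q
    simp only [MulAction.mem_orbit_iff, Set.mem_ofPred_eq, hsmul, Subtype.exists, exists_prop]
  let e : MulAction.stabilizer (D.fixer s) p ≃ D.fixer (insert p s) :=
    { toFun := fun g => ⟨g.1.1, g.1.2.1, fun x hx => hx.elim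
        (fun h => by rw [h]; exact g.2) (g.1.2.2 x)⟩
      invFun := fun g => ⟨⟨g.1, g.2.1, fun x hx => g.2.2 x (Set.mem_insert_of_mem p hx)⟩,
        g.2.2 p (Set.mem_insert p s)⟩
      left_inv := fun _ => rfl
      right_inv := fun _ => rfl }
  rw [← (MulAction.stabilizer (D.fixer s) p).card_mul_index, MulAction.index_stabilizer, mul_comm,
    horbit, Nat.card_congr e]

theorem Iso.mem_fixer (j : Iso D D) {s : Set P} (h : ∀ p ∈ s, j.onPoints p = p) :
    (j.onPoints, j.onBlocks) ∈ D.fixer s := ⟨j.mem_aut, h⟩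

end IncStruct

namespace planeDesign

section Stabilizer

variable {f : GF4 → GF4} (hgood : ¬ (planeDesign f).IsGood 4 3 (pl none 0 0))
  (hclosure : fixClosure (blList.map (blockMask f)) 4 baseMask [blockMask f (vert 0)] = 2 ^ 64 - 1)

include hgood in
theorem vert_of_mem_aut {g : Equiv.Perm Pt × Equiv.Perm Bl} (hg : g ∈ (planeDesign f).aut)
    (t : GF4) : ∃ t', g.2 (vert t) = vert t' :=
  exists_vert_of_isGood hgood ((Iso.ofAut hg).isGood (planeDesign.isGood f t))

include hgood in
theorem vert_zero_of_mem_fixer {g : Equiv.Perm Pt × Equiv.Perm Bl} {s : Set Pt}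
    (hg : g ∈ (planeDesign f).fixer s) (hs : (0, 0, 0) ∈ s) : g.2 (vert 0) = vert 0 := by
  obtain ⟨t, ht⟩ := vert_of_mem_aut hgood hg.1 0
  have h := (hg.1 (0, 0, 0) (vert 0)).2 rfl
  rw [ht, hg.2 _ hs] at h
  have h0 : (0 : GF4) = t := h
  rw [ht, ← h0]

include hgood in
theorem snd_snd_eq_zero_iff {g : Equiv.Perm Pt × Equiv.Perm Bl} {s : Set Pt}
    (hg : g ∈ (planeDesign f).fixer s) (hs : (0, 0, 0) ∈ s) (p : Pt) :
    (g.1 p).2.2 = 0 ↔ p.2.2 = 0 := by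
  have := hg.1 p (vert 0)
  rwa [vert_zero_of_mem_fixer hgood hg hs] at this

include hgood hclosure in
/-- The four base points are fixed only by the identity. -/
theorem eq_one_of_mem_fixer {g : Equiv.Perm Pt × Equiv.Perm Bl}
    (hg : g ∈ (planeDesign f).fixer {(0, om, 0), (1, 0, 0), (0, 0, 1), (0, 0, 0)}) : g = 1 := by
  refine eq_one_of_fixes hg.1 fun p => fixes_of_fixClosure hg.1 p 4
    (fun p => decide (p ∈ basePoints)) _ (fun q hq => ?_) ?_ hclosure
  · refine hg.2 q ?_
    have h1 : q ∈ basePoints := of_decide_eq_true hq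
    simpa [basePoints] using h1
  · intro t ht
    rw [List.mem_singleton.1 ht]
    exact ⟨vert 0, rfl, vert_zero_of_mem_fixer hgood hg (by simp)⟩

/-- The transvection of the first two coordinates with the compensation of the deformation
normalized to fix the points `(0, 0, 0)` and `(0, 0, 1)`. -/
noncomputable def normTransvection (f : GF4 → GF4) (l : GF4) :
    Iso (planeDesign f) (planeDesign f) :=
  transvectionIso f l (f 0) (f 0 + f 1)

theorem normTransvection_zero (l x y : GF4) :
    (normTransvection f l).onPoints (x, y, 0) = (x + l * y, y, 0) := by
  refine Prod.ext ?_ rfl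
  change x + l * y + l * l * (f 0 + f 0 + (f 0 + f 1) * 0) = _
  rw [GF4.add_self, mul_zero, add_zero, mul_zero, add_zero]

theorem normTransvection_one (l : GF4) :
    (normTransvection f l).onPoints (0, 0, 1) = (0, 0, 1) := by
  refine Prod.ext ?_ rfl
  change 0 + l * 0 + l * l * (f 1 + f 0 + (f 0 + f 1) * 1) = 0
  linear_combination l * l * (f 0 + f 1) * two_eq_zero

include hgood in
theorem orbit_one (hscale : ∀ l, l ≠ 0 → ∃ κ, κ ≠ 0 ∧ ∀ z, f (l * z) = κ * f z) :
    {q : Pt | ∃ g ∈ (planeDesign f).fixer {(0, 0, 0)}, g.1 (0, 0, 1) = q} = {q | q.2.2 ≠ 0} := by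
  ext q
  constructor
  · rintro ⟨g, hg, rfl⟩
    exact fun h => one_ne_zero ((snd_snd_eq_zero_iff hgood hg rfl _).1 h)
  · intro hz
    obtain ⟨x, y, z⟩ := q
    have hz : z ≠ 0 := hz
    obtain ⟨κ, hκ, h⟩ := hscale z hz
    refine ⟨_, ((scaleIso hκ hz h).trans (shearIso f (x * z⁻¹) (y * z⁻¹))).mem_fixer ?_, ?_⟩
    · rintro _ rfl
      change (κ * 0 + x * z⁻¹ * (z * 0), κ * 0 + y * z⁻¹ * (z * 0), z * 0) = _
      simp
    · change (κ * 0 + x * z⁻¹ * (z * 1), κ * 0 + y * z⁻¹ * (z * 1), z * 1) = _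
      simp [hz]

include hgood in
theorem orbit_two : {q : Pt | ∃ g ∈ (planeDesign f).fixer {(0, 0, 1), (0, 0, 0)}, g.1 (1, 0, 0) = q} =
    {q | q.2.2 = 0 ∧ q ≠ (0, 0, 0)} := by
  ext q
  constructor
  · rintro ⟨g, hg, rfl⟩
    refine ⟨(snd_snd_eq_zero_iff hgood hg (by simp) _).2 rfl, fun h => ?_⟩
    rw [← hg.2 (0, 0, 0) (by simp)] at h
    exact absurd (g.1.injective h) (by decide)
  · obtain ⟨x, y, z⟩ := q
    rintro ⟨hz, hq⟩
    obtain rfl : z = 0 := hz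
    by_cases hy : y = 0
    · subst hy
      have hx : x ≠ 0 := fun h => hq (by rw [h])
      refine ⟨_, (diagonalIso f hx).mem_fixer ?_, ?_⟩
      · rintro _ (rfl | rfl)
        · change (x * 0, x * x * 0, _) = _; simp
        · change (x * 0, x * x * 0, _) = _; simp
      · change (x * 1, x * x * 0, (0 : GF4)) = _; simp
    · have hyy : y * y ≠ 0 := mul_ne_zero hy hy
      have h4 : y * y * (y * y) = y := by linear_combination y * cube_eq_one y hy
      refine ⟨_, (((swapIso f).trans (diagonalIso f hyy)).trans
        (normTransvection f (x * y⁻¹))).mem_fixer ?_, ?_⟩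
      · rintro _ (rfl | rfl)
        · change (normTransvection f _).onPoints (y * y * 0, y * y * (y * y) * 0, 1) = _
          rw [mul_zero, mul_zero, normTransvection_one]
        · change (normTransvection f _).onPoints (y * y * 0, y * y * (y * y) * 0, 0) = _
          rw [mul_zero, mul_zero, normTransvection_zero, mul_zero, add_zero]
      · change (normTransvection f _).onPoints (y * y * 0, y * y * (y * y) * 1, 0) = _
        rw [normTransvection_zero, h4]
        simp [hy]

/-- The normalized transvections fix three of the base points. -/
theorem normTransvection_mem_fixer (f : GF4 → GF4) (l : GF4) :
    ((normTransvection f l).onPoints, (normTransvection f l).onBlocks) ∈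
      (planeDesign f).fixer {(1, 0, 0), (0, 0, 1), (0, 0, 0)} := by
  refine (normTransvection f l).mem_fixer ?_
  rintro _ (rfl | rfl | rfl)
  · rw [normTransvection_zero, mul_zero, add_zero]
  · exact normTransvection_one l
  · rw [normTransvection_zero, mul_zero, add_zero]

theorem frobenius_mem_fixer (hfrob : ∀ z, f (z * z) = f z * f z) :
    ((frobeniusIso hfrob).onPoints, (frobeniusIso hfrob).onBlocks) ∈
      (planeDesign f).fixer {(1, 0, 0), (0, 0, 1), (0, 0, 0)} := by
  refine (frobeniusIso hfrob).mem_fixer ?_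
  rintro _ (rfl | rfl | rfl) <;> rfl

include hgood hclosure in
theorem orbit_three (hfrob : ∀ z, f (z * z) = f z * f z)
    (hline : ∀ b, (planeDesign f).inc (0, 0, 0) b → (planeDesign f).inc (1, 0, 0) b →
      (planeDesign f).inc (0, om, 0) b → b = vert 0) :
    {q : Pt | ∃ g ∈ (planeDesign f).fixer {(1, 0, 0), (0, 0, 1), (0, 0, 0)}, g.1 (0, om, 0) = q} =
      {q | q.2.2 = 0 ∧ (q.2.1 = om ∨ q.2.1 = om2)} := by
  ext q
  constructor
  · rintro ⟨g, hg, rfl⟩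
    refine ⟨(snd_snd_eq_zero_iff hgood hg (by simp) _).2 rfl, ?_⟩
    have hz : (g.1 (0, om, 0)).2.2 = 0 := (snd_snd_eq_zero_iff hgood hg (by simp) _).2 rfl
    have hcases : ∀ y : GF4, y ≠ 0 → y ≠ 1 → y = om ∨ y = om2 := by decide
    refine hcases _ (fun h0 => ?_) fun h1 => ?_
    · -- The block `y = 0` would be the image of `z = 0`, the only block through the points
      -- `(0, 0, 0)`, `(1, 0, 0)` and `(0, om, 0)`.
      have hb : ∀ p, (planeDesign f).inc (g.1 p) (pl none 0 0) ↔
          (planeDesign f).inc p (g.2.symm (pl none 0 0)) := fun p => by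
        have := hg.1 p (g.2.symm (pl none 0 0))
        rwa [Equiv.apply_symm_apply] at this
      have hv := hline (g.2.symm (pl none 0 0))
        ((hb _).1 (by rw [hg.2 _ (by simp)]; simp [inc_pl, val]))
        ((hb _).1 (by rw [hg.2 _ (by simp)]; simp [inc_pl, val]))
        ((hb _).1 (by simp [inc_pl, val, h0]))
      rw [Equiv.symm_apply_eq, vert_zero_of_mem_fixer hgood hg (by simp)] at hv
      exact absurd hv (by decide)
    · -- A conjugate of the Frobenius automorphism would fix the four base points.
      set φ : Equiv.Perm Pt × Equiv.Perm Bl :=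
        ((frobeniusIso hfrob).onPoints, (frobeniusIso hfrob).onBlocks) with hφ
      set τ : Equiv.Perm Pt × Equiv.Perm Bl :=
        ((normTransvection f (g.1 (0, om, 0)).1).onPoints,
          (normTransvection f (g.1 (0, om, 0)).1).onBlocks) with hτ
      have hφm : φ ∈ (planeDesign f).fixer {(1, 0, 0), (0, 0, 1), (0, 0, 0)} :=
        frobenius_mem_fixer hfrob
      have hh : τ * g ∈ (planeDesign f).fixer {(1, 0, 0), (0, 0, 1), (0, 0, 0)} :=
        Subgroup.mul_mem _ (normTransvection_mem_fixer f _) hg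
      have hp : (τ * g).1 (0, om, 0) = (0, 1, 0) := by
        change (normTransvection f (g.1 (0, om, 0)).1).onPoints (g.1 (0, om, 0)) = _
        have hq : g.1 (0, om, 0) = ((g.1 (0, om, 0)).1, 1, 0) := Prod.ext rfl (Prod.ext h1 hz)
        conv_lhs => rw [hq]
        rw [normTransvection_zero, mul_one, GF4.add_self]
      have hc := Subgroup.mul_mem _ (Subgroup.mul_mem _ (Subgroup.inv_mem _ hh) hφm) hh
      have hone : (τ * g)⁻¹ * φ * (τ * g) = 1 := by
        refine eq_one_of_mem_fixer hgood hclosure ⟨hc.1, ?_⟩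
        rintro p (rfl | hp')
        · change (τ * g).1⁻¹ (φ.1 ((τ * g).1 (0, om, 0))) = _
          rw [Equiv.Perm.inv_eq_iff_eq, hp]
          rfl
        · exact hc.2 p hp'
      have hφ1 : φ = 1 := by
        rw [mul_assoc, inv_mul_eq_one] at hone
        simpa using hone.symm
      have : φ.1 (om, 0, 0) = (om, 0, 0) := by rw [hφ1]; rfl
      exact absurd (congrArg Prod.fst this) (by change ¬ (om * om = om); decide)
  · obtain ⟨x, y, z⟩ := q
    rintro ⟨hz, hy⟩
    obtain rfl : z = 0 := hz
    rcases hy with hy | hy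
    · obtain rfl : y = om := hy
      refine ⟨_, normTransvection_mem_fixer f (x * om⁻¹), ?_⟩
      change (normTransvection f _).onPoints (0, om, 0) = _
      rw [normTransvection_zero, zero_add, inv_mul_cancel_right₀ (by decide)]
    · obtain rfl : y = om2 := hy
      refine ⟨_, Subgroup.mul_mem _ (normTransvection_mem_fixer f (x * om2⁻¹))
        (frobenius_mem_fixer hfrob), ?_⟩
      change (normTransvection f _).onPoints (0, om2, 0) = _
      rw [normTransvection_zero, zero_add, inv_mul_cancel_right₀ (by decide)]

include hgood hclosure in
/-- The order `48 · 15 · 8` of the stabilizer of the point `(0, 0, 0)`. -/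
theorem card_fixer_origin (hscale : ∀ l, l ≠ 0 → ∃ κ, κ ≠ 0 ∧ ∀ z, f (l * z) = κ * f z)
    (hfrob : ∀ z, f (z * z) = f z * f z)
    (hline : ∀ b, (planeDesign f).inc (0, 0, 0) b → (planeDesign f).inc (1, 0, 0) b →
      (planeDesign f).inc (0, om, 0) b → b = vert 0) :
    Nat.card ((planeDesign f).fixer {(0, 0, 0)}) = 5760 := by
  have h1 : {q : Pt | q.2.2 ≠ 0}.ncard = 48 := by
    rw [ncard_setOf_eq_card_filter]; decide +kernel
  have h2 : {q : Pt | q.2.2 = 0 ∧ q ≠ (0, 0, 0)}.ncard = 15 := by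
    rw [ncard_setOf_eq_card_filter]; decide +kernel
  have h3 : {q : Pt | q.2.2 = 0 ∧ (q.2.1 = om ∨ q.2.1 = om2)}.ncard = 8 := by
    rw [ncard_setOf_eq_card_filter]; decide +kernel
  have h4 : (planeDesign f).fixer {(0, om, 0), (1, 0, 0), (0, 0, 1), (0, 0, 0)} = ⊥ :=
    (Subgroup.eq_bot_iff_forall _).2 fun g hg => eq_one_of_mem_fixer hgood hclosure hg
  rw [card_fixer _ (0, 0, 1), orbit_one hgood hscale, h1, card_fixer _ (1, 0, 0),
    orbit_two hgood, h2, card_fixer _ (0, om, 0), orbit_three hgood hclosure hfrob hline, h3, h4,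
    Subgroup.card_bot]

end Stabilizer

/-- After four iterations all points are determined. -/
theorem fixClosure_bump10 : fixClosure (blList.map (blockMask (bump 1 0))) 4 baseMask
    [blockMask (bump 1 0) (vert 0)] = 2 ^ 64 - 1 := by
  decide +kernel

theorem fixClosure_bump01 : fixClosure (blList.map (blockMask (bump 0 1))) 4 baseMask
    [blockMask (bump 0 1) (vert 0)] = 2 ^ 64 - 1 := by
  decide +kernel

theorem card_aut_bump10 : Nat.card (planeDesign (bump 1 0)).aut = 92160 := by
  have horbit : {q : Pt | ∃ g ∈ (planeDesign (bump 1 0)).fixer ∅, g.1 (0, 0, 0) = q} =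
      {q | q.2.2 = 0} := by
    ext q
    constructor
    · rintro ⟨g, hg, rfl⟩
      obtain ⟨t, ht⟩ := vert_of_mem_aut not_isGood_bump10_none hg.1 0
      have h0 : t = 0 := by
        by_contra h0
        obtain ⟨j, hj⟩ := exists_iso_bump10_vert h0
        refine not_sameOrbit_bump10 ⟨_, Subgroup.mul_mem _ j.symm.mem_aut hg.1, ?_⟩
        change j.onBlocks.symm (g.2 (vert 0)) = _
        rw [ht, ← hj, Equiv.symm_apply_apply]
      have h := (hg.1 (0, 0, 0) (vert 0)).2 rfl
      rw [ht, h0] at h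
      exact h
    · obtain ⟨x, y, z⟩ := q
      intro hz
      obtain rfl : z = 0 := hz
      refine ⟨_, (translationIso (bump 1 0) x y).mem_fixer (by simp), ?_⟩
      change (0 + x, 0 + y, (0 : GF4)) = _
      rw [zero_add, zero_add]
  have h16 : {q : Pt | q.2.2 = 0}.ncard = 16 := by
    rw [ncard_setOf_eq_card_filter]; decide +kernel
  rw [← fixer_empty, card_fixer _ (0, 0, 0), horbit, h16, insert_empty_eq,
    card_fixer_origin not_isGood_bump10_none fixClosure_bump10 (fun l hl => ⟨1, one_ne_zero, by
      revert l; decide +kernel⟩) (by decide +kernel) (by decide +kernel)]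

theorem card_aut_bump01 : Nat.card (planeDesign (bump 0 1)).aut = 368640 := by
  have horbit : {q : Pt | ∃ g ∈ (planeDesign (bump 0 1)).fixer ∅, g.1 (0, 0, 0) = q} =
      Set.univ := by
    refine Set.eq_univ_of_forall fun q => ?_
    obtain ⟨x, y, z⟩ := q
    refine ⟨_, ((shiftIso (f := bump 0 1) (f' := bump 0 1) z (z * z) 0
      (by revert z; decide +kernel)).trans (translationIso _ x y)).mem_fixer (by simp), ?_⟩
    change (0 + x, 0 + y, 0 + z) = _
    rw [zero_add, zero_add, zero_add]
  have h64 : (Set.univ : Set Pt).ncard = 64 := by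
    rw [Set.ncard_univ, Nat.card_prod, Nat.card_prod, GF4.natCard]
  rw [← fixer_empty, card_fixer _ (0, 0, 0), horbit, h64, insert_empty_eq,
    card_fixer_origin not_isGood_bump01_none fixClosure_bump01 (fun l hl => ⟨l * l,
      mul_ne_zero hl hl, by revert l; decide +kernel⟩) (by decide +kernel) (by decide +kernel)]

end planeDesign

/-! ### Copies on initial segments of the natural numbers -/

namespace IncStruct

variable {P β Q γ : Type*} {D : IncStruct P β} {E : IncStruct Q γ}

/-- The dual of an isomorphism. -/
def Iso.dual (i : Iso D E) : Iso D.dual E.dual := ⟨i.onBlocks, i.onPoints, fun b x => i.inc_iff x b⟩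

theorem Iso.isNet (i : Iso D E) {s m : ℕ} (h : D.IsNet s m) : E.IsNet s m := by
  obtain ⟨hd, c, hc, hm⟩ := h
  refine ⟨i.isDesign hd, _, i.isResolution hc, ?_⟩
  rintro _ ⟨S, hS, rfl⟩ _ ⟨T, hT, rfl⟩ hne _ ⟨a, ha, rfl⟩ _ ⟨b, hb, rfl⟩
  rw [i.pts_onBlocks, i.pts_onBlocks, ← Set.image_inter i.onPoints.injective,
    Set.ncard_image_of_injective _ i.onPoints.injective]
  exact hm S hS T hT (fun h => hne (by rw [h])) a ha b hb

theorem Iso.isSymmetricNet (i : Iso D E) {s m : ℕ} (h : D.IsSymmetricNet s m) :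
    E.IsSymmetricNet s m := ⟨i.isNet h.1, i.dual.isNet h.2⟩

theorem Isomorphic.arisesFromLineSpread (h : D.Isomorphic E) (hE : E.ArisesFromLineSpread) :
    D.ArisesFromLineSpread := by
  obtain ⟨S, hS, hES⟩ := hE
  exact ⟨S, hS, h.trans hES⟩

/-- The copy of a structure under bijections of the points and of the blocks. -/
def copy (D : IncStruct P β) (e : P ≃ Q) (e' : β ≃ γ) : IncStruct Q γ :=
  ⟨fun x b => D.inc (e.symm x) (e'.symm b)⟩

/-- The isomorphism of a structure with a copy of it. -/
def copyIso (D : IncStruct P β) (e : P ≃ Q) (e' : β ≃ γ) : Iso D (D.copy e e') :=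
  ⟨e, e', fun x b => by simp [copy]⟩

end IncStruct

namespace planeDesign

theorem natCard_pt : Nat.card Pt = 64 := by
  rw [Nat.card_prod, Nat.card_prod, GF4.natCard]

/-- A numbering of the points. -/
noncomputable def ptEquiv : Pt ≃ Fin 64 := Finite.equivFinOfCardEq natCard_pt

/-- A numbering of the blocks. -/
noncomputable def blEquiv : Bl ≃ Fin 84 := Finite.equivFinOfCardEq Bl.natCard

theorem arisesFromNet_copy {f : GF4 → GF4} (h : (planeDesign f).HasLightCode)
    (hcode : (planeNet f).code 2 = (planeDesign f).code 2) :
    ((planeDesign f).copy ptEquiv blEquiv).ArisesFromNet := by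
  have hE := ((planeDesign f).copyIso ptEquiv blEquiv).hasLightCode h
  have hN : ((planeNet f).copy ptEquiv ptEquiv).code 2 =
      ((planeDesign f).copy ptEquiv blEquiv).code 2 := by
    rw [((planeNet f).copyIso ptEquiv ptEquiv).code_eq,
      ((planeDesign f).copyIso ptEquiv blEquiv).code_eq, hcode]
    rfl
  refine ⟨(planeNet f).copy ptEquiv ptEquiv,
    ((planeNet f).copyIso ptEquiv ptEquiv).isSymmetricNet (planeNet.isSymmetricNet f), ?_, ?_⟩
  · rw [hN, hE.finrank_code]
  · rw [hN]
    refine hE.isomorphic_minWordDesign fun b b' hbb => ?_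
    have hinj := pts_injective f
    apply blEquiv.symm.injective
    refine hinj (Set.ext fun p => ?_)
    have := Set.ext_iff.1 hbb (ptEquiv p)
    change (planeDesign f).inc (ptEquiv.symm (ptEquiv p)) _ ↔
      (planeDesign f).inc (ptEquiv.symm (ptEquiv p)) _ at this
    rwa [Equiv.symm_apply_apply] at this

end planeDesign

theorem theorem6 :
    ∃ (E₁ E₂ : IncStruct (Fin 64) (Fin 84)),
      -- the design `E₁`
      (E₁.IsAffineResolvable 4 16 5 ∧ E₁.pRank 2 = 16 ∧ Nat.card E₁.aut = 92160 ∧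
        E₁.ArisesFromNet) ∧
      -- the design `E₂`
      (E₂.IsAffineResolvable 4 16 5 ∧ E₂.pRank 2 = 16 ∧ Nat.card E₂.aut = 368640 ∧
        E₂.ArisesFromNet ∧ E₂.ArisesFromLineSpread) ∧
      -- part (i)
      ((IncStruct.AG 2 3 (GaloisField 2 2)).IsAffineResolvable 4 16 5 ∧
        ¬ E₁.Isomorphic (IncStruct.AG 2 3 (GaloisField 2 2)) ∧
        ∀ B, ((IncStruct.AG 2 3 (GaloisField 2 2)).residual B).EmbedsExactlyIn
          (IncStruct.AG 2 3 (GaloisField 2 2)) E₁) ∧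
      -- part (ii): the good blocks of `E₁` form exactly two orbits
      (∃ B₁ B₂, E₁.IsGood 4 3 B₁ ∧ E₁.IsGood 4 3 B₂ ∧ ¬ E₁.SameOrbit B₁ B₂ ∧
        (∀ B, E₁.IsGood 4 3 B → E₁.SameOrbit B₁ B ∨ E₁.SameOrbit B₂ B) ∧
        (∀ B, E₁.SameOrbit B₁ B →
          (E₁.residual B).EmbedsExactlyIn E₁ (IncStruct.AG 2 3 (GaloisField 2 2))) ∧
        (∀ B, E₁.SameOrbit B₂ B → (E₁.residual B).EmbedsExactlyIn E₁ E₂)) ∧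
      -- part (iii)
      ((∃ B, E₂.IsGood 4 3 B) ∧
        ∀ B, E₂.IsGood 4 3 B → (E₂.residual B).EmbedsExactlyIn E₂ E₁) := by
  obtain ⟨i₀⟩ := isomorphic_AG_galoisField
  let i₁ := (planeDesign (bump 1 0)).copyIso ptEquiv blEquiv
  let i₂ := (planeDesign (bump 0 1)).copyIso ptEquiv blEquiv
  -- The residual structures at corresponding blocks, up to isomorphism.
  have hres₀ : ∀ B, ((IncStruct.AG 2 3 (GaloisField 2 2)).residual B).Isomorphic
      ((planeDesign (bump 0 0)).residual (vert 0)) := fun B => by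
    obtain ⟨b, rfl⟩ := i₀.onBlocks.surjective B
    obtain ⟨j, rfl⟩ := exists_iso_bump00 b
    exact ⟨((j.trans i₀).residual (vert 0)).symm⟩
  have hsame : ∀ {b B}, ((planeDesign (bump 1 0)).copy ptEquiv blEquiv).SameOrbit
      (i₁.onBlocks b) B → (((planeDesign (bump 1 0)).copy ptEquiv blEquiv).residual B).Isomorphic
        ((planeDesign (bump 1 0)).residual b) := by
    rintro b _ ⟨g, hg, rfl⟩
    exact ⟨((i₁.trans (Iso.ofAut hg)).residual b).symm⟩
  refine ⟨_, _,
    ⟨i₁.isAffineResolvable (planeDesign.isAffineResolvable _),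
      (i₁.hasLightCode hasLightCode_bump10).pRank, ?_,
      arisesFromNet_copy hasLightCode_bump10 (code_eq_of_lightCheck lightCheck_basis10).1⟩,
    ⟨i₂.isAffineResolvable (planeDesign.isAffineResolvable _),
      (i₂.hasLightCode hasLightCode_bump01).pRank, ?_,
      arisesFromNet_copy hasLightCode_bump01 (code_eq_of_lightCheck lightCheck_basis01).1,
      Isomorphic.arisesFromLineSpread ⟨i₂.symm⟩ arisesFromLineSpread_bump01⟩,
    ⟨i₀.isAffineResolvable (planeDesign.isAffineResolvable _), ?_,
      fun B => embedsExactlyIn_zero i₀ i₁ (hres₀ B)⟩,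
    ⟨i₁.onBlocks (vert 0), i₁.onBlocks (vert 1), i₁.isGood (planeDesign.isGood _ 0),
      i₁.isGood (planeDesign.isGood _ 1), ?_, fun B hB => ?_, fun B hB => ?_, fun B hB => ?_⟩,
    ⟨i₂.onBlocks (vert 0), i₂.isGood (planeDesign.isGood _ 0)⟩, fun B hB => ?_⟩
  · rw [i₁.card_aut, card_aut_bump10]
  · rw [i₂.card_aut, card_aut_bump01]
  · rintro ⟨j⟩
    exact not_isomorphic_bump00 not_isGood_bump10_none ⟨(i₁.trans (j.trans i₀.symm)).symm⟩
  · rw [i₁.sameOrbit_iff]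
    exact not_sameOrbit_bump10
  · obtain ⟨b, rfl⟩ := i₁.onBlocks.surjective B
    obtain ⟨t, rfl⟩ := exists_vert_of_isGood not_isGood_bump10_none (i₁.isGood_iff.1 hB)
    rw [i₁.sameOrbit_iff, i₁.sameOrbit_iff]
    rcases eq_or_ne t 0 with rfl | ht
    · exact .inl ⟨1, Subgroup.one_mem _, rfl⟩
    · obtain ⟨j, hj⟩ := exists_iso_bump10_vert ht
      exact .inr ⟨_, j.mem_aut, hj⟩
  · exact (embedsExactlyIn_zero i₀ i₁ ((hsame hB).trans ⟨residualIso 1 0 0⟩)).symm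
  · exact embedsExactlyIn_one i₁ i₂ ((hsame hB).trans (residual_bump10_vert one_ne_zero))
  · obtain ⟨b, rfl⟩ := i₂.onBlocks.surjective B
    obtain ⟨t, rfl⟩ := exists_vert_of_isGood not_isGood_bump01_none (i₂.isGood_iff.1 hB)
    obtain ⟨j, hj⟩ := exists_iso_bump01_vert t
    refine (embedsExactlyIn_one i₁ i₂ ?_).symm
    rw [← hj]
    exact ⟨((j.trans i₂).residual (vert 0)).symm⟩
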